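/- Let $p_1=0$, $p_2=1$, $p_3=e^{\pi i/3}$ in $\mathbb C$, and $$F_1(z)=\tfrac12\overline{(z-p_1)}\,e^{\pi i/3}+p_1,\quad F_2(z)=\tfrac12\overline{(z-p_2)}\,e^{-\pi i/3}+p_2,\quad F_3(z)=-\tfrac12\overline{(z-p_3)}+p_3 .$$ Let $K$ be the unique nonempty compact set with $K=\bigcup_iF_i(K)$ (the twisted Sierpiński gasket). For a word $\omega=\omega_1\cdots\omega_n$ over $\{1,2,3\}$ put $F_\omega=F_{\omega_1}\circ\cdots\circ F_{\omega_n}$; $F_\omega(K)$ is a subcell of level $n$, with vertices $F_\omega(p_1),F_\omega(p_2),F_\omega(p_3)$. For a starting set $A_0$ let $A_n=\bigcup_iF_i(A_{n-1})$ and $A_*=\bigcup_nA_n$; this defines $V_n,V_*$ from $V_0=\{p_1,p_2,p_3\}$, $U_n,U_*$ from $U_0=\{p_2,p_3\}$, and $W_n,W_*$ from $W_0=\{p_1\}$. For $x\in V_*$, a largest subcell at $x$ is a subcell of minimal level among those having $x$ as a vertex. For positive numbers $(a_n,b_n,c_n)_{n\ge0}$ let $$\mathcal E_n(u)=\sum_{|\omega|=n}\Big(a_n\big(u_\omega(p_2)-u_\omega(p_3)\big)^2+b_n\big(u_\omega(p_1)-u_\omega(p_3)\big)^2+c_n\big(u_\omega(p_1)-u_\omega(p_2)\big)^2\Big),\qquad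 u_\omega=u\circ F_\omega ,$$ and call the sequence compatible if $\mathcal E_n(u)=\min\{\mathcal E_{n+1}(v): v|_{V_n}=u|_{V_n}\}$ for all $n\ge 0$ and all $u$. In that case let $\mathcal E(u)=\lim_n\mathcal E_n(u|_{V_n})\in[0,\infty]$ for $u:V_*\to\mathbb R$, $R(x,x)=0$, and $R(x,y)^{-1}=\inf\{\mathcal E(u):u(x)=1,\ u(y)=0\}$ for distinct $x,y\in V_*$. **Proposition 4.2.** Let $a_0>b_0=c_0>0$. Compatible positive conductances with initial value $(a_0,b_0,b_0)$ exist, and for any such sequence $(a_n,b_n,c_n)_{n\ge0}$ the following hold. (i) There is $\delta>0$ such that $R(x,y)\ge\delta$ for all distinct $x,y\in W_*$, and $R(x,y)\ge\delta$ for all $x\in U_*$, $y\in W_*$. (ii) There is $C>0$ such that for every $x\in U_*$, every largest subcell $K_x$ at $x$ and every $y\in U_*\cap K_x$, $$C^{-1}|x-y|^{\log3/\log2}\le R(x,y)\le C|x-y|^{\log3/\log2}.$$ Moreover, there is $C>0$ such that for all $k\ge1$ and $q\in W_k\setminus W_{k-1}$ there are exactly two largest subcells $K_q'$, $K_q''$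 at $q$, and $$C^{-1}3^{-k}\le R(x,y)\le C\,3^{-k}\qquad\text{for all } n\ge k,\ x\in U_n\cap K_q',\ y\in U_n\cap K_q''.$$ (iii) $R$ is a metric on $V_*$. Let $\Omega$ be the completion of $(V_*,R)$, $R$ also its extended metric, and $\overline{U_*}$ the closure of $U_*$ in $\Omega$. Then $\Omega=\overline{U_*}\cup W_*$, and $\overline{U_*}$ is path-connected and locally connected. There is $C>0$ such that for all $k\ge1$ and $q\in W_k\setminus W_{k-1}$ there are $p_q',p_q''\in\overline{U_*}$ with the following properties. As $x\to q$ in the Euclidean metric, $x$ converges to $p_q'$ in $\Omega$ along $x\in U_*\cap K_q'$, and to $p_q''$ along $x\in U_*\cap K_q''$. The points $p_q',p_q''$ are precisely the cluster points in $\Omega$ of $x\in U_*$ as $x\to q$ in the Euclidean metric. Finally, $C^{-1}3^{-k}\le R(p_q',p_q'')\le C\,3^{-k}$. -/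

import Mathlib

open Filter Topology
open scoped ENNReal ComplexConjugate

namespace TwistedSG

/-! ### The twisted Sierpinski gasket

The indices `0, 1, 2 : Fin 3` stand for the customary indices `1, 2, 3`. -/

/-- The three corners `p₁ = 0`, `p₂ = 1`, `p₃ = exp (π i / 3)`. -/
noncomputable def corner : Fin 3 → ℂ :=
  ![0, 1, Complex.exp (Real.pi * Complex.I / 3)]

/-- The three twisted contractions: `contr i` fixes `corner i`, has ratio `1/2`, and is the
usual contraction of the gasket towards `corner i` composed with the reflection in the angle
bisector at that corner. -/
noncomputable def contr : Fin 3 → ℂ → ℂ :=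
  ![fun z => conj (z - corner 0) / 2 * Complex.exp (Real.pi * Complex.I / 3) + corner 0,
    fun z => conj (z - corner 1) / 2 * Complex.exp (-(Real.pi * Complex.I / 3)) + corner 1,
    fun z => -(conj (z - corner 2) / 2) + corner 2]

/-- `F_ω = F_{ω₁} ∘ ⋯ ∘ F_{ωₙ}` for a word `ω = [ω₁, …, ωₙ]`. -/
noncomputable def cellMap : List (Fin 3) → ℂ → ℂ
  | [] => id
  | i :: ω => contr i ∘ cellMap ω

/-- `A₀ = A` and `Aₙ₊₁ = ⋃ᵢ Fᵢ(Aₙ)`. -/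
noncomputable def level (A : Set ℂ) : ℕ → Set ℂ
  | 0 => A
  | n + 1 => ⋃ i : Fin 3, contr i '' level A n

/-- `Vₙ`, generated by `V₀ = {p₁, p₂, p₃}`. -/
noncomputable def V : ℕ → Set ℂ := level (Set.range corner)

/-- `Uₙ`, generated by `U₀ = {p₂, p₃}`. -/
noncomputable def U : ℕ → Set ℂ := level {corner 1, corner 2}

/-- `Wₙ`, generated by `W₀ = {p₁}`. -/
noncomputable def W : ℕ → Set ℂ := level {corner 0}

/-- `V_* = ⋃ₙ Vₙ`. -/
noncomputable def VStar : Set ℂ := ⋃ n, V n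

/-- `U_* = ⋃ₙ Uₙ`. -/
noncomputable def UStar : Set ℂ := ⋃ n, U n

/-- `W_* = ⋃ₙ Wₙ`. -/
noncomputable def WStar : Set ℂ := ⋃ n, W n

/-- The gasket `K`. It is shown below (`gasket_isAttractor`, `IsAttractor.eq_gasket`) that this is
the unique nonempty compact set with `K = ⋃ᵢ Fᵢ(K)`. -/
noncomputable def gasket : Set ℂ := closure VStar

/-- Nonempty compact sets invariant under the iterated function system. -/
structure IsAttractor (A : Set ℂ) : Prop where
  compact : IsCompact A
  nonempty : A.Nonempty
  invariant : A = ⋃ i : Fin 3, contr i '' A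

theorem norm_exp_third : ‖Complex.exp (Real.pi * Complex.I / 3)‖ = 1 := by
  have h : (Real.pi * Complex.I / 3 : ℂ) = ((Real.pi / 3 : ℝ) : ℂ) * Complex.I := by
    push_cast; ring
  rw [h, Complex.norm_exp_ofReal_mul_I]

theorem norm_exp_neg_third : ‖Complex.exp (-(Real.pi * Complex.I / 3))‖ = 1 := by
  rw [Complex.exp_neg, norm_inv, norm_exp_third, inv_one]

theorem norm_corner_le (i : Fin 3) : ‖corner i‖ ≤ 1 := by
  fin_cases i
  · simp [corner]
  · simp [corner]
  · simp only [corner]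
    exact norm_exp_third.le

theorem contr_corner (i : Fin 3) : contr i (corner i) = corner i := by
  fin_cases i <;> simp [contr]

theorem dist_contr (i : Fin 3) (z w : ℂ) : dist (contr i z) (contr i w) = dist z w / 2 := by
  have key : ∀ c e : ℂ, ‖e‖ = 1 →
      ‖(conj (z - c) / 2 * e + c) - (conj (w - c) / 2 * e + c)‖ = ‖z - w‖ / 2 := by
    intro c e he
    have h : (conj (z - c) / 2 * e + c) - (conj (w - c) / 2 * e + c)
        = conj (z - w) / 2 * e := by
      simp only [map_sub]; ring
    rw [h, norm_mul, he, norm_div, Complex.norm_conj]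
    simp
  rw [dist_eq_norm, dist_eq_norm]
  fin_cases i
  · exact key _ _ norm_exp_third
  · exact key _ _ norm_exp_neg_third
  · have := key (corner 2) (-1) (by simp)
    simpa [contr] using this

theorem continuous_contr (i : Fin 3) : Continuous (contr i) :=
  (LipschitzWith.of_dist_le_mul (K := 1) fun z w => by
    rw [dist_contr]; simp only [NNReal.coe_one, one_mul]
    linarith [dist_nonneg (x := z) (y := w)]).continuous

theorem vStar_eq : VStar = ⋃ i : Fin 3, contr i '' VStar := by
  apply Set.Subset.antisymm
  · intro z hz
    obtain ⟨n, hn⟩ := Set.mem_iUnion.1 hz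
    cases n with
    | zero =>
      obtain ⟨i, rfl⟩ := hn
      exact Set.mem_iUnion.2 ⟨i, corner i, Set.mem_iUnion.2 ⟨0, i, rfl⟩, contr_corner i⟩
    | succ n =>
      obtain ⟨i, w, hw, rfl⟩ := Set.mem_iUnion.1 hn
      exact Set.mem_iUnion.2 ⟨i, w, Set.mem_iUnion.2 ⟨n, hw⟩, rfl⟩
  · intro z hz
    obtain ⟨i, w, hw, rfl⟩ := Set.mem_iUnion.1 hz
    obtain ⟨n, hn⟩ := Set.mem_iUnion.1 hw
    exact Set.mem_iUnion.2 ⟨n + 1, Set.mem_iUnion.2 ⟨i, w, hn, rfl⟩⟩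

theorem vStar_subset : VStar ⊆ Metric.closedBall 0 3 := by
  have h : ∀ n, V n ⊆ Metric.closedBall 0 3 := by
    intro n
    induction n with
    | zero =>
      rintro _ ⟨i, rfl⟩
      rw [mem_closedBall_zero_iff]
      linarith [norm_corner_le i]
    | succ n ih =>
      intro z hz
      obtain ⟨i, w, hw, rfl⟩ := Set.mem_iUnion.1 hz
      have h1 : ‖w‖ ≤ 3 := by simpa using ih hw
      have h2 := dist_contr i w (corner i)
      rw [contr_corner, dist_eq_norm, dist_eq_norm] at h2
      have h3 := norm_corner_le i
      have h4 := norm_sub_le w (corner i)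
      have h5 := norm_le_norm_sub_add (contr i w) (corner i)
      rw [mem_closedBall_zero_iff]
      linarith
  exact Set.iUnion_subset h

theorem gasket_isAttractor : IsAttractor gasket := by
  have hc : IsCompact gasket :=
    (isCompact_closedBall (0 : ℂ) 3).of_isClosed_subset isClosed_closure
      (closure_minimal vStar_subset Metric.isClosed_closedBall)
  refine ⟨hc, ⟨corner 0, subset_closure (Set.mem_iUnion.2 ⟨0, 0, rfl⟩)⟩, ?_⟩
  have h : gasket = closure (⋃ i : Fin 3, contr i '' VStar) := by
    rw [← vStar_eq, gasket]
  conv_lhs => rw [h]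
  rw [closure_iUnion_of_finite]
  exact Set.iUnion_congr fun i =>
    (image_closure_of_isCompact hc (continuous_contr i).continuousOn).symm

theorem IsAttractor.subset {A B : Set ℂ} (hA : IsAttractor A) (hB : IsAttractor B) : A ⊆ B := by
  obtain ⟨a, ha, hmax⟩ := hA.compact.exists_isMaxOn hA.nonempty
    (Metric.continuous_infDist_pt B).continuousOn
  have h0 : Metric.infDist a B ≤ 0 := by
    have ha2 := ha
    rw [hA.invariant] at ha2
    obtain ⟨i, a', ha', rfl⟩ := Set.mem_iUnion.1 ha2
    obtain ⟨b, hb, hbd⟩ := hB.compact.exists_infDist_eq_dist hB.nonempty a'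
    have hfb : contr i b ∈ B := by
      rw [hB.invariant]; exact Set.mem_iUnion.2 ⟨i, b, hb, rfl⟩
    have h1 := Metric.infDist_le_dist_of_mem (x := contr i a') hfb
    rw [dist_contr, ← hbd] at h1
    have h2 : Metric.infDist a' B ≤ Metric.infDist (contr i a') B := hmax ha'
    linarith
  intro x hx
  have h3 : Metric.infDist x B ≤ Metric.infDist a B := hmax hx
  exact (hB.compact.isClosed.mem_iff_infDist_zero hB.nonempty).2
    (le_antisymm (h3.trans h0) Metric.infDist_nonneg)

theorem IsAttractor.eq_gasket {A : Set ℂ} (hA : IsAttractor A) : A = gasket :=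
  (hA.subset gasket_isAttractor).antisymm (gasket_isAttractor.subset hA)

/-- The subcell `K_ω = F_ω(K)`. -/
noncomputable def cell (ω : List (Fin 3)) : Set ℂ := cellMap ω '' gasket

/-- The words of the largest subcells of `K` that have `x` as a vertex, i.e. of the subcells
`F_ω(K)` with `x ∈ F_ω(V₀)` and `|ω|` minimal (a subcell `F_ω(K)` has size `2^{-|ω|}`). -/
noncomputable def largestCells (x : ℂ) : Set (List (Fin 3)) :=
  {ω | x ∈ cellMap ω '' V 0 ∧
    ∀ τ : List (Fin 3), x ∈ cellMap τ '' V 0 → ω.length ≤ τ.length}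

/-! ### Energies and the resistance metric -/

/-- The energy on `V₀` with conductances `α` on `p₂p₃`, `β` on `p₁p₃`, `γ` on `p₁p₂`. -/
noncomputable def cellEnergy (α β γ : ℝ) (u : ℂ → ℝ) : ℝ :=
  α * (u (corner 1) - u (corner 2)) ^ 2 + β * (u (corner 0) - u (corner 2)) ^ 2
    + γ * (u (corner 0) - u (corner 1)) ^ 2

/-- `ℰₙ(u)`: every cell `F_ω(V₀)` with `|ω| = n` carries the conductances `(aₙ, bₙ, cₙ)`.
Only the values of `u` on `Vₙ` matter. -/
noncomputable def energyAt (a b c : ℕ → ℝ) (n : ℕ) (u : ℂ → ℝ) : ℝ :=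
  ∑ ω : Fin n → Fin 3, cellEnergy (a n) (b n) (c n) (u ∘ cellMap (List.ofFn ω))

/-- `(aₙ, bₙ, cₙ)` are positive conductances whose energies `ℰₙ` are compatible: the restriction
(trace) of `ℰₙ₊₁` to `ℓ(Vₙ)`, that is `u ↦ min {ℰₙ₊₁(v) : v = u on Vₙ}`, equals `ℰₙ`. -/
structure IsCompatible (a b c : ℕ → ℝ) : Prop where
  pos : ∀ n, 0 < a n ∧ 0 < b n ∧ 0 < c n
  trace : ∀ (n : ℕ) (u : ℂ → ℝ),
    IsLeast {e : ℝ | ∃ v : ℂ → ℝ, Set.EqOn v u (V n) ∧ e = energyAt a b c (n + 1) v}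
      (energyAt a b c n u)

/-- `ℰ(u) = limₙ ℰₙ(u)`, a value in `[0, ∞]`. For compatible energies the sequence is
nondecreasing, so the limit is the supremum (see `IsCompatible.tendsto_energy`).
Only the values of `u` on `V_*` matter. -/
noncomputable def energy (a b c : ℕ → ℝ) (u : ℂ → ℝ) : ℝ≥0∞ :=
  ⨆ n, ENNReal.ofReal (energyAt a b c n u)

theorem IsCompatible.tendsto_energy {a b c : ℕ → ℝ} (h : IsCompatible a b c) (u : ℂ → ℝ) :
    Tendsto (fun n => ENNReal.ofReal (energyAt a b c n u)) atTop (𝓝 (energy a b c u)) :=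
  tendsto_atTop_iSup (monotone_nat_of_le_succ fun n =>
    ENNReal.ofReal_le_ofReal ((h.trace n u).2 ⟨u, fun _ _ => rfl, rfl⟩))

/-- The effective resistance, `R(x, y)⁻¹ = inf {ℰ(u) : u(x) = 1, u(y) = 0}`. For `x = y` there is
no admissible `u`, the infimum is `∞` and the value is `0`. -/
noncomputable def resistance (a b c : ℕ → ℝ) (x y : ℂ) : ℝ :=
  (⨅ (u : ℂ → ℝ) (_ : u x = 1 ∧ u y = 0), energy a b c u)⁻¹.toReal

/-- The points of `V_*`, as a type without the Euclidean topology. -/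
structure Vertex where
  pt : ℂ
  mem : pt ∈ VStar

end TwistedSG

namespace TwistedSG

/-! ### Barycentric coordinates -/

/-! The twist makes level-one cells meet in images of the same corner: `F_i(p_k) = F_j(p_k)` for
distinct `i, j, k`. Hence every vertex has a type, `U_*` and `W_*` are disjoint, and the edges with
conductance `a_n` join points of `U_*` only.

Replace each triangle by a star with legs `r, s, t`. At a new vertex two legs of equal type are in
series, so compatibility becomes the recursion `StarRecursion`. Differences of legs grow in absolute
value along it, while at least two of the three legs tend to zero; this forces `s = t` at all levels
(`StarRecursion.symmetric`). Then `s_n` is comparable to `3⁻ⁿ` and `r_n` stays away from zero, so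
`a_n` is comparable to `3ⁿ` and `b_n` is bounded (`IsCompatible.controlled`).

The `3ⁿ` edges between points of `U_n` form one path from `p₂` to `p₃`, refined through `F₂`, then
`F₁` reversed, then `F₃`; `addr` is the parameter along it. On `U_*` the resistance is comparable to
the difference of addresses. The upper bound is Cauchy-Schwarz along the path
(`sq_sub_le_arcEnergy`). The lower bound tests with the address clamped to an interval of length
`L`, whose energy is `O(L)` (`arcEnergy_le`, `bridgeEnergy_le`). The indicator of a point of `W_*`
has bounded energy (`energy_le_of_support`), which gives (i).

Each contraction halves distances and divides address differences by three, whence the exponent `log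
3 / log 2`. In the completion the closure of `U_*` is bi-Lipschitz to `[0, 1]`, and `W_*` is
uniformly discrete. At `q = F_τ(mid)` the two largest cells fill the outer thirds of an address
interval of length `3^{-|τ|}`; as points of `U_*` tend to `q`, their addresses tend to the midpoints
of these thirds, which yields the two limit points. -/

theorem corner_two : corner 2 = ⟨1 / 2, √3 / 2⟩ := by
  have h : (Real.pi * Complex.I / 3 : ℂ) = ((Real.pi / 3 : ℝ) : ℂ) * Complex.I := by
    push_cast; ring
  simp only [corner, Matrix.cons_val]
  rw [h]
  apply Complex.ext
  · rw [Complex.exp_ofReal_mul_I_re, Real.cos_pi_div_three]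
  · rw [Complex.exp_ofReal_mul_I_im, Real.sin_pi_div_three]

theorem exp_third : Complex.exp (Real.pi * Complex.I / 3) = ⟨1 / 2, √3 / 2⟩ := corner_two

theorem exp_neg_third : Complex.exp (-(Real.pi * Complex.I / 3)) = ⟨1 / 2, -(√3 / 2)⟩ := by
  have h : (-(Real.pi * Complex.I / 3) : ℂ) = ((-(Real.pi / 3) : ℝ) : ℂ) * Complex.I := by
    push_cast; ring
  rw [h]
  apply Complex.ext
  · rw [Complex.exp_ofReal_mul_I_re, Real.cos_neg, Real.cos_pi_div_three]
  · rw [Complex.exp_ofReal_mul_I_im, Real.sin_neg, Real.sin_pi_div_three]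

/-- The barycentric coordinates with respect to the three corners. -/
noncomputable def bary : Fin 3 → ℂ → ℝ :=
  ![fun z => 1 - z.re - z.im / √3, fun z => z.re - z.im / √3, fun z => 2 * z.im / √3]

theorem bary_sum (z : ℂ) : bary 0 z + bary 1 z + bary 2 z = 1 := by
  simp only [bary, Matrix.cons_val]; ring

/-- Since `0 + 1 + 2 = 0` in `Fin 3`, `-(i + j)` is the third index when `i ≠ j`; this notation
recurs below. -/
theorem bary_sum_of_ne {i j : Fin 3} (h : i ≠ j) (z : ℂ) :
    bary i z + bary j z + bary (-(i + j)) z = 1 := by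
  have e1 : (-1 : Fin 3) = 2 := rfl
  have e2 : (-2 : Fin 3) = 1 := rfl
  have := bary_sum z
  fin_cases i <;> fin_cases j <;> first | exact absurd rfl h | skip
  all_goals
    simp only [Fin.zero_eta, Fin.mk_one, Fin.reduceFinMk, Fin.reduceAdd, e1, e2, neg_zero, zero_add,
      add_zero]
    linarith

theorem bary_corner (i j : Fin 3) : bary i (corner j) = if i = j then 1 else 0 := by
  fin_cases j
  · fin_cases i <;> simp [bary, corner]
  · fin_cases i <;> simp [bary, corner]
  · have : √3 ≠ 0 := by positivity
    fin_cases i <;> simp [bary, corner_two] <;> field_simp <;> norm_num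

theorem bary_ext {z w : ℂ} (h : ∀ i, bary i z = bary i w) : z = w := by
  have h1 := h 1
  have h2 := h 2
  have h3 : √3 ≠ 0 := by positivity
  simp only [bary, Matrix.cons_val] at h1 h2
  have him : z.im = w.im := by field_simp at h2; linarith
  rw [him] at h1
  exact Complex.ext (by linarith) him

theorem continuous_bary (i : Fin 3) : Continuous (bary i) := by
  fin_cases i <;> simp only [bary] <;>
    simp only [Fin.zero_eta, Fin.mk_one, Fin.reduceFinMk, Matrix.cons_val] <;> fun_prop

theorem bary_contr_self (i : Fin 3) (z : ℂ) : bary i (contr i z) = (1 + bary i z) / 2 := by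
  have h3 : √3 * √3 = 3 := Real.mul_self_sqrt (by norm_num)
  have h : √3 ≠ 0 := by positivity
  fin_cases i <;>
    simp [bary, contr, corner, exp_third, exp_neg_third, -one_div] <;>
    field_simp <;> ring_nf <;> try (simp only [pow_two, h3]; ring_nf)

/-- The reflection in the bisector at `corner i` exchanges the other two coordinates. This swap of
indices is the whole effect of the twist. -/
theorem bary_contr_of_ne {i j : Fin 3} (hij : i ≠ j) (z : ℂ) :
    bary j (contr i z) = bary (-(i + j)) z / 2 := by
  have h3 : √3 * √3 = 3 := Real.mul_self_sqrt (by norm_num)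
  have e1 : (-1 : Fin 3) = 2 := rfl
  have e2 : (-2 : Fin 3) = 1 := rfl
  have h : √3 ≠ 0 := by positivity
  fin_cases i <;> fin_cases j <;> first | exact absurd rfl hij | skip
  all_goals
    simp only [Fin.zero_eta, Fin.mk_one, Fin.reduceFinMk, Fin.reduceAdd, e1, e2, neg_zero, zero_add,
      add_zero]
    simp [bary, contr, corner, exp_third, exp_neg_third, -one_div]
    field_simp
    ring_nf
    try (simp only [pow_two, h3]; ring_nf)

theorem neg_add_ne {i j : Fin 3} (h : i ≠ j) : -(i + j) ≠ i ∧ -(i + j) ≠ j := by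
  revert i j; decide

/-- The closed triangle spanned by the corners. -/
def tri : Set ℂ := {z | ∀ i, 0 ≤ bary i z}

theorem isClosed_tri : IsClosed tri := by
  have : tri = ⋂ i, {z | 0 ≤ bary i z} := by ext; simp [tri]
  rw [this]
  exact isClosed_iInter fun i => isClosed_le continuous_const (continuous_bary i)

theorem corner_mem_tri (i : Fin 3) : corner i ∈ tri := fun j => by
  rw [bary_corner]; split_ifs <;> norm_num

theorem contr_mem_tri {z : ℂ} (hz : z ∈ tri) (i : Fin 3) : contr i z ∈ tri := fun j => by
  by_cases h : i = j
  · subst h; rw [bary_contr_self]; linarith [hz i]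
  · rw [bary_contr_of_ne h]; linarith [hz (-(i + j))]

theorem bary_le_one {z : ℂ} (hz : z ∈ tri) (i : Fin 3) : bary i z ≤ 1 := by
  have hne : i ≠ i + 1 := by revert i; decide
  have := bary_sum_of_ne hne z
  linarith [hz (i + 1), hz (-(i + (i + 1)))]

theorem eq_corner_of_bary_eq_one {z : ℂ} (hz : z ∈ tri) {i : Fin 3} (h : bary i z = 1) :
    z = corner i := by
  apply bary_ext
  intro j
  rw [bary_corner]
  split_ifs with hj
  · rw [hj, h]
  · have := bary_sum_of_ne hj z
    linarith [hz j, hz (-(j + i))]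

theorem corner_injective : Function.Injective corner := fun i j h => by
  have h1 := bary_corner i j
  rw [← h, bary_corner, if_pos rfl] at h1
  by_contra hne
  rw [if_neg hne] at h1
  norm_num at h1

theorem contr_injective (i : Fin 3) : Function.Injective (contr i) := fun z w h => by
  have := dist_contr i z w
  rw [h, dist_self] at this
  exact dist_le_zero.1 (by linarith)

/-- Distinct first-level cells meet only at a common vertex. -/
theorem eq_corner_of_contr_eq {z w : ℂ} (hz : z ∈ tri) (hw : w ∈ tri) {i j : Fin 3} (hij : i ≠ j)
    (h : contr i z = contr j w) : z = corner (-(i + j)) ∧ w = corner (-(i + j)) := by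
  have hi := congrArg (bary i) h
  have hj := congrArg (bary j) h
  rw [bary_contr_self, bary_contr_of_ne hij.symm, add_comm j i] at hi
  rw [bary_contr_self, bary_contr_of_ne hij] at hj
  have := hz i
  have := hw j
  have := bary_le_one hw (-(i + j))
  have := bary_le_one hz (-(i + j))
  exact ⟨eq_corner_of_bary_eq_one hz (by linarith), eq_corner_of_bary_eq_one hw (by linarith)⟩

/-- In the ordinary gasket the common vertex is `F_i(p_j) = F_j(p_i)`; with the twist both cells
reach it from the same corner, so vertex types are consistent. -/
theorem contr_corner_third {i j : Fin 3} (hij : i ≠ j) :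
    contr i (corner (-(i + j))) = contr j (corner (-(i + j))) := by
  have hb : ∀ {i j : Fin 3}, i ≠ j → ∀ k, bary k (contr i (corner (-(i + j))))
      = if k = -(i + j) then 0 else 1 / 2 := by
    intro i j hij k
    by_cases hk : i = k
    · subst hk
      rw [bary_contr_self, bary_corner, if_neg (neg_add_ne hij).1.symm,
        if_neg (neg_add_ne hij).1.symm]; norm_num
    · rw [bary_contr_of_ne hk, bary_corner]
      have : (-(i + k) = -(i + j)) ↔ ¬ (k = -(i + j)) := by
        revert i j k; decide
      by_cases h : k = -(i + j)
      · rw [if_neg (by rw [this]; exact not_not.2 h), if_pos h]; norm_num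
      · rw [if_pos (this.2 h), if_neg h]
  apply bary_ext
  intro k
  rw [hb hij, add_comm i j, hb hij.symm]

theorem contr_ne_corner {z : ℂ} (hz : z ∈ tri) {i j : Fin 3} (h : i ≠ j) :
    contr i z ≠ corner j := fun he => by
  rw [← contr_corner j] at he
  have := corner_injective (eq_corner_of_contr_eq hz (corner_mem_tri j) h he).2
  exact (neg_add_ne h).2 this.symm

theorem eq_of_contr_eq_corner {z : ℂ} (hz : z ∈ tri) {i j : Fin 3} (h : contr i z = corner j) :
    i = j ∧ z = corner j := by
  by_cases hij : i = j
  · subst hij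
    exact ⟨rfl, contr_injective i (h.trans (contr_corner i).symm)⟩
  · exact absurd h (contr_ne_corner hz hij)

/-! ### Words and cells -/

theorem cellMap_append (ω τ : List (Fin 3)) (z : ℂ) :
    cellMap (ω ++ τ) z = cellMap ω (cellMap τ z) := by
  induction ω with
  | nil => rfl
  | cons i ω ih => simp only [List.cons_append, cellMap, Function.comp_apply, ih]

theorem continuous_cellMap (ω : List (Fin 3)) : Continuous (cellMap ω) := by
  induction ω with
  | nil => exact continuous_id
  | cons i ω ih => exact (continuous_contr i).comp ih

theorem dist_cellMap (ω : List (Fin 3)) (z w : ℂ) :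
    dist (cellMap ω z) (cellMap ω w) = dist z w * (1 / 2) ^ ω.length := by
  induction ω with
  | nil => simp [cellMap]
  | cons i ω ih =>
    simp only [cellMap, Function.comp_apply, dist_contr, ih, List.length_cons]
    ring

theorem cellMap_mem_tri {z : ℂ} (hz : z ∈ tri) (ω : List (Fin 3)) : cellMap ω z ∈ tri := by
  induction ω with
  | nil => exact hz
  | cons i ω ih => exact contr_mem_tri ih i

theorem mem_level_iff {A : Set ℂ} {n : ℕ} {z : ℂ} :
    z ∈ level A n ↔ ∃ ω : List (Fin 3), ω.length = n ∧ z ∈ cellMap ω '' A := by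
  induction n generalizing z with
  | zero =>
    constructor
    · exact fun h => ⟨[], rfl, z, h, rfl⟩
    · rintro ⟨ω, hω, w, hw, rfl⟩
      rw [List.length_eq_zero_iff.1 hω]
      exact hw
  | succ n ih =>
    constructor
    · intro h
      obtain ⟨i, w, hw, rfl⟩ := Set.mem_iUnion.1 h
      obtain ⟨ω, hω, a, ha, rfl⟩ := ih.1 hw
      exact ⟨i :: ω, by simp [hω], a, ha, rfl⟩
    · rintro ⟨ω, hω, a, ha, rfl⟩
      cases ω with
      | nil => simp at hω
      | cons i ω =>
        exact Set.mem_iUnion.2 ⟨i, _, ih.2 ⟨ω, by simpa using hω, a, ha, rfl⟩, rfl⟩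

theorem contr_mem_level {A : Set ℂ} {n : ℕ} {z : ℂ} (hz : z ∈ level A n) (i : Fin 3) :
    contr i z ∈ level A (n + 1) := Set.mem_iUnion.2 ⟨i, z, hz, rfl⟩

section Level

variable {A B : Set ℂ}

theorem level_subset_tri (hA : A ⊆ Set.range corner) (n : ℕ) : level A n ⊆ tri := by
  intro z hz
  obtain ⟨ω, -, w, hw, rfl⟩ := mem_level_iff.1 hz
  obtain ⟨i, rfl⟩ := hA hw
  exact cellMap_mem_tri (corner_mem_tri i) ω

theorem level_subset_succ (hA : A ⊆ Set.range corner) (n : ℕ) : level A n ⊆ level A (n + 1) := by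
  induction n with
  | zero =>
    intro z hz
    obtain ⟨i, rfl⟩ := hA hz
    exact Set.mem_iUnion.2 ⟨i, corner i, hz, contr_corner i⟩
  | succ n ih =>
    intro z hz
    obtain ⟨i, w, hw, rfl⟩ := Set.mem_iUnion.1 hz
    exact contr_mem_level (ih hw) i

theorem level_mono (hA : A ⊆ Set.range corner) : Monotone (level A) :=
  monotone_nat_of_le_succ (level_subset_succ hA)

/-- A point reached through two different cells has the same corner as preimage in both, so
membership passes from one cell to the other. -/
theorem mem_level_of_contr_mem (hA : A ⊆ Set.range corner) {n : ℕ} {i : Fin 3} {z : ℂ}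
    (hz : z ∈ tri) (h : contr i z ∈ level A (n + 1)) : z ∈ level A n := by
  obtain ⟨j, w, hw, hwz⟩ := Set.mem_iUnion.1 h
  by_cases hij : i = j
  · subst hij
    rwa [contr_injective i hwz] at hw
  · have := eq_corner_of_contr_eq hz (level_subset_tri hA n hw) hij hwz.symm
    rwa [this.1, ← this.2]

theorem corner_mem_of_mem_level (hA : A ⊆ Set.range corner) {n : ℕ} {k : Fin 3}
    (h : corner k ∈ level A n) : corner k ∈ A := by
  induction n with
  | zero => exact h
  | succ n ih =>
    obtain ⟨i, w, hw, hwz⟩ := Set.mem_iUnion.1 h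
    have := eq_of_contr_eq_corner (level_subset_tri hA n hw) hwz
    exact ih (this.2 ▸ hw)

theorem disjoint_level (hA : A ⊆ Set.range corner) (hB : B ⊆ Set.range corner)
    (hAB : Disjoint A B) (n : ℕ) : Disjoint (level A n) (level B n) := by
  induction n with
  | zero => exact hAB
  | succ n ih =>
    rw [Set.disjoint_left] at ih ⊢
    intro z hz hz'
    obtain ⟨i, w, hw, rfl⟩ := Set.mem_iUnion.1 hz
    exact ih hw (mem_level_of_contr_mem hB (level_subset_tri hA n hw) hz')

theorem level_union (A B : Set ℂ) (n : ℕ) : level (A ∪ B) n = level A n ∪ level B n := by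
  induction n with
  | zero => rfl
  | succ n ih => simp only [level, ih, Set.image_union, Set.iUnion_union_distrib]

/-- The union of all levels. -/
noncomputable def levels (A : Set ℂ) : Set ℂ := ⋃ n, level A n

theorem mem_levels {z : ℂ} : z ∈ levels A ↔ ∃ n, z ∈ level A n := Set.mem_iUnion

theorem levels_subset_tri (hA : A ⊆ Set.range corner) : levels A ⊆ tri :=
  Set.iUnion_subset (level_subset_tri hA)

theorem contr_mem_levels {z : ℂ} (hz : z ∈ levels A) (i : Fin 3) : contr i z ∈ levels A := by
  obtain ⟨n, hn⟩ := mem_levels.1 hz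
  exact mem_levels.2 ⟨n + 1, contr_mem_level hn i⟩

theorem cellMap_mem_levels {z : ℂ} (hz : z ∈ levels A) (ω : List (Fin 3)) :
    cellMap ω z ∈ levels A := by
  induction ω with
  | nil => exact hz
  | cons i ω ih => exact contr_mem_levels ih i

theorem exists_eq_contr (hA : A ⊆ Set.range corner) {z : ℂ} (hz : z ∈ levels A) :
    ∃ i, ∃ w ∈ levels A, z = contr i w := by
  obtain ⟨n, hn⟩ := mem_levels.1 hz
  obtain ⟨i, w, hw, rfl⟩ := Set.mem_iUnion.1 (level_subset_succ hA n hn)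
  exact ⟨i, w, mem_levels.2 ⟨n, hw⟩, rfl⟩

theorem mem_levels_of_contr_mem (hA : A ⊆ Set.range corner) {i : Fin 3} {z : ℂ}
    (hz : z ∈ tri) (h : contr i z ∈ levels A) : z ∈ levels A := by
  obtain ⟨n, hn⟩ := mem_levels.1 h
  exact mem_levels.2 ⟨n, mem_level_of_contr_mem hA hz (level_subset_succ hA n hn)⟩

theorem mem_levels_of_cellMap_mem (hA : A ⊆ Set.range corner) {ω : List (Fin 3)} {z : ℂ}
    (hz : z ∈ tri) (h : cellMap ω z ∈ levels A) : z ∈ levels A := by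
  induction ω with
  | nil => exact h
  | cons i ω ih => exact ih (mem_levels_of_contr_mem hA (cellMap_mem_tri hz ω) h)

theorem corner_mem_of_mem_levels (hA : A ⊆ Set.range corner) {k : Fin 3}
    (h : corner k ∈ levels A) : corner k ∈ A := by
  obtain ⟨n, hn⟩ := mem_levels.1 h
  exact corner_mem_of_mem_level hA hn

theorem disjoint_levels (hA : A ⊆ Set.range corner) (hB : B ⊆ Set.range corner)
    (hAB : Disjoint A B) : Disjoint (levels A) (levels B) := by
  rw [Set.disjoint_left]
  intro z hz hz'
  obtain ⟨n, hn⟩ := mem_levels.1 hz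
  obtain ⟨m, hm⟩ := mem_levels.1 hz'
  exact Set.disjoint_left.1 (disjoint_level hA hB hAB (max n m))
    (level_mono hA (le_max_left _ _) hn) (level_mono hB (le_max_right _ _) hm)

end Level

theorem range_corner : Set.range corner = {corner 1, corner 2} ∪ {corner 0} := by
  ext z
  simp only [Set.mem_range, Fin.exists_fin_succ, Set.mem_union, Set.mem_insert_iff,
    Set.mem_singleton_iff, eq_comm (a := z)]
  simp
  tauto

theorem uZero_subset : ({corner 1, corner 2} : Set ℂ) ⊆ Set.range corner := by
  rw [range_corner]; exact Set.subset_union_left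

theorem wZero_subset : ({corner 0} : Set ℂ) ⊆ Set.range corner := by
  rw [range_corner]; exact Set.subset_union_right

theorem v_eq_union (n : ℕ) : V n = U n ∪ W n := by
  rw [V, range_corner, level_union]; rfl

theorem vStar_eq_union : VStar = UStar ∪ WStar := by
  simp only [VStar, UStar, WStar, v_eq_union, Set.iUnion_union_distrib]

theorem disjoint_uStar_wStar : Disjoint UStar WStar := by
  refine disjoint_levels uZero_subset wZero_subset ?_
  rw [Set.disjoint_singleton_right]
  simp only [Set.mem_insert_iff, Set.mem_singleton_iff, corner_injective.eq_iff]
  decide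

theorem uStar_subset_vStar : UStar ⊆ VStar := vStar_eq_union ▸ Set.subset_union_left

theorem wStar_subset_vStar : WStar ⊆ VStar := vStar_eq_union ▸ Set.subset_union_right

theorem vStar_subset_tri : VStar ⊆ tri := levels_subset_tri subset_rfl

theorem uStar_subset_tri : UStar ⊆ tri := uStar_subset_vStar.trans vStar_subset_tri

theorem gasket_subset_tri : gasket ⊆ tri := closure_minimal vStar_subset_tri isClosed_tri

theorem corner_mem_vStar (i : Fin 3) : corner i ∈ VStar := Set.mem_iUnion.2 ⟨0, i, rfl⟩

theorem corner_one_mem_uStar : corner 1 ∈ UStar := Set.mem_iUnion.2 ⟨0, Or.inl rfl⟩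

theorem corner_two_mem_uStar : corner 2 ∈ UStar := Set.mem_iUnion.2 ⟨0, Or.inr rfl⟩

theorem corner_zero_mem_wStar : corner 0 ∈ WStar := Set.mem_iUnion.2 ⟨0, rfl⟩

theorem uStar_inter_cell (ω : List (Fin 3)) : UStar ∩ cell ω = cellMap ω '' UStar := by
  ext z
  constructor
  · rintro ⟨hz, w, hw, rfl⟩
    exact ⟨w, mem_levels_of_cellMap_mem uZero_subset (gasket_subset_tri hw) hz, rfl⟩
  · rintro ⟨w, hw, rfl⟩
    exact ⟨cellMap_mem_levels hw ω, w, subset_closure (uStar_subset_vStar hw), rfl⟩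

/-- A vertex of a cell that lies in `U_*` is the image of `p₂` or `p₃`. -/
theorem eq_cellMap_corner {x : ℂ} (hx : x ∈ UStar) {ω : List (Fin 3)}
    (h : x ∈ cellMap ω '' V 0) : x = cellMap ω (corner 1) ∨ x = cellMap ω (corner 2) := by
  obtain ⟨_, ⟨i, rfl⟩, rfl⟩ := h
  have h1 : corner i ∈ UStar :=
    mem_levels_of_cellMap_mem uZero_subset (corner_mem_tri i) hx
  have h2 := corner_mem_of_mem_levels uZero_subset h1
  rcases h2 with h2 | h2
  · exact Or.inl (by rw [h2])
  · exact Or.inr (by rw [h2])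

/-! ### The two largest cells at a point of `W_*` -/

/-- The vertex opposite to `p_k` in the subdivision of `V₀`. -/
noncomputable def edgeMid (k : Fin 3) : ℂ := contr (k + 1) (corner k)

theorem contr_corner_of_ne {i k : Fin 3} (h : i ≠ k) : contr i (corner k) = edgeMid k := by
  by_cases hi : i = k + 1
  · rw [hi, edgeMid]
  · have := contr_corner_third hi
    have hk : ∀ i k : Fin 3, i ≠ k → i ≠ k + 1 → -(i + (k + 1)) = k := by decide
    replace hk := hk i k h hi
    rwa [hk] at this

theorem edgeMid_mem_tri (k : Fin 3) : edgeMid k ∈ tri := contr_mem_tri (corner_mem_tri k) _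

theorem edgeMid_ne_corner (k i : Fin 3) : edgeMid k ≠ corner i := fun h => by
  have := eq_of_contr_eq_corner (corner_mem_tri k) h
  have h2 := corner_injective this.2
  rw [← this.1] at h2
  exact absurd h2 (by clear h h2 this; revert k; decide)

theorem edgeMid_injective : Function.Injective edgeMid := by
  have h : ∀ k, bary k (edgeMid k) = 0 := fun k => by
    rw [edgeMid, bary_contr_of_ne (by revert k; decide), bary_corner, if_neg (by revert k; decide)]
    norm_num
  intro k l hkl
  by_contra hne
  have h1 := bary_contr_self l (corner k)
  rw [contr_corner_of_ne (Ne.symm hne), hkl, h, bary_corner, if_neg (Ne.symm hne)] at h1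
  norm_num at h1

theorem cellMap_edgeMid_ne_corner (τ : List (Fin 3)) (k i : Fin 3) :
    cellMap τ (edgeMid k) ≠ corner i := by
  induction τ with
  | nil => exact edgeMid_ne_corner k i
  | cons j τ ih =>
    intro h
    exact ih (eq_of_contr_eq_corner (cellMap_mem_tri (edgeMid_mem_tri k) τ) h).2

/-- The common vertex of the cells `F₂(K)` and `F₃(K)`. -/
noncomputable def mid : ℂ := edgeMid 0

theorem contr_one_corner_zero : contr 1 (corner 0) = mid := rfl

theorem contr_two_corner_zero : contr 2 (corner 0) = mid := contr_corner_of_ne (by decide)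

theorem mid_mem_tri : mid ∈ tri := edgeMid_mem_tri 0

theorem cellMap_mid_ne_corner (τ : List (Fin 3)) (i : Fin 3) : cellMap τ mid ≠ corner i :=
  cellMap_edgeMid_ne_corner τ 0 i

/-- A new point of type `p₁` first appears when `F₂` or `F₃` moves `p₁`, and both move it to `mid`.
-/
theorem exists_eq_cellMap_mid {k : ℕ} {q : ℂ} (hq : q ∈ W (k + 1) \ W k) :
    ∃ τ : List (Fin 3), τ.length = k ∧ q = cellMap τ mid := by
  induction k generalizing q with
  | zero =>
    obtain ⟨i, w, hw, rfl⟩ := Set.mem_iUnion.1 hq.1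
    have hw : w = corner 0 := hw
    subst hw
    refine ⟨[], rfl, ?_⟩
    fin_cases i
    · exact absurd (contr_corner 0) hq.2
    · rfl
    · exact contr_two_corner_zero
  | succ k ih =>
    obtain ⟨i, w, hw, rfl⟩ := Set.mem_iUnion.1 hq.1
    obtain ⟨τ, hτ, rfl⟩ := ih ⟨hw, fun h => hq.2 (contr_mem_level h i)⟩
    exact ⟨i :: τ, by simp [hτ], rfl⟩

/-- Away from the corners, the image under `contr i` meets no other first-level cell, so every word
with this vertex starts with `i`. -/
theorem mem_cellMap_cons_iff {z : ℂ} (hz : z ∈ tri) (hc : ∀ k, z ≠ corner k) (i : Fin 3)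
    (τ : List (Fin 3)) : contr i z ∈ cellMap τ '' V 0 ↔
      ∃ τ', τ = i :: τ' ∧ z ∈ cellMap τ' '' V 0 := by
  constructor
  · rintro ⟨_, ⟨l, rfl⟩, h⟩
    cases τ with
    | nil => exact absurd (eq_of_contr_eq_corner hz h.symm).2 (hc l)
    | cons j τ =>
      by_cases hij : i = j
      · subst hij
        exact ⟨τ, rfl, _, ⟨l, rfl⟩, contr_injective i h⟩
      · exact absurd (eq_corner_of_contr_eq hz (cellMap_mem_tri (corner_mem_tri l) τ) hij
          h.symm).1 (hc _)
  · rintro ⟨τ', rfl, w, hw, rfl⟩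
    exact ⟨w, hw, rfl⟩

theorem largestCells_mid : largestCells mid = {[1], [2]} := by
  have h0 : ∀ τ : List (Fin 3), mid ∈ cellMap τ '' V 0 → τ ≠ [] := by
    rintro τ ⟨_, ⟨l, rfl⟩, h⟩ rfl
    exact edgeMid_ne_corner 0 l h.symm
  have h1 : mid ∈ cellMap [1] '' V 0 := ⟨corner 0, ⟨0, rfl⟩, rfl⟩
  have h2 : mid ∈ cellMap [2] '' V 0 := ⟨corner 0, ⟨0, rfl⟩, contr_two_corner_zero⟩
  have hl : ∀ τ : List (Fin 3), mid ∈ cellMap τ '' V 0 → 1 ≤ τ.length := fun τ hτ =>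
    List.length_pos_iff.2 (h0 τ hτ)
  ext ω
  constructor
  · rintro ⟨hω, hmin⟩
    have hlen : ω.length = 1 := le_antisymm (hmin _ h1) (hl ω hω)
    obtain ⟨i, rfl⟩ := List.length_eq_one_iff.1 hlen
    fin_cases i
    -- The cells `0` and `1` share only the image of `corner 2`, whereas `mid` is the image of
    -- `corner 0` in cell `1`.
    · obtain ⟨_, ⟨l, rfl⟩, h⟩ := hω
      exact absurd (eq_corner_of_contr_eq (corner_mem_tri l) (corner_mem_tri 0)
        (show (0 : Fin 3) ≠ 1 by decide) h).2 (corner_injective.ne (by decide))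
    · exact Or.inl rfl
    · exact Or.inr rfl
  · rintro (rfl | rfl)
    · exact ⟨h1, hl⟩
    · exact ⟨h2, hl⟩

theorem largestCells_contr {z : ℂ} (hz : z ∈ tri) (hc : ∀ k, z ≠ corner k) (i : Fin 3) :
    largestCells (contr i z) = (List.cons i) '' largestCells z := by
  ext ω
  simp only [largestCells, Set.mem_ofPred_eq, mem_cellMap_cons_iff hz hc, Set.mem_image]
  constructor
  · rintro ⟨⟨ω', rfl, hω'⟩, hmin⟩
    refine ⟨ω', ⟨hω', fun τ hτ => ?_⟩, rfl⟩
    simpa using hmin (i :: τ) ⟨τ, rfl, hτ⟩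
  · rintro ⟨ω', ⟨hω', hmin⟩, rfl⟩
    refine ⟨⟨ω', rfl, hω'⟩, ?_⟩
    rintro _ ⟨τ, rfl, hτ⟩
    simpa using hmin τ hτ

theorem largestCells_cellMap_mid (τ : List (Fin 3)) :
    largestCells (cellMap τ mid) = {τ ++ [1], τ ++ [2]} := by
  induction τ with
  | nil => exact largestCells_mid
  | cons i τ ih =>
    have := largestCells_contr (cellMap_mem_tri mid_mem_tri τ) (cellMap_mid_ne_corner τ) i
    rw [ih, Set.image_pair] at this
    exact this

/-- Near `F_τ(m₂₃)`, the set `U_*` consists of the two cells at that point. -/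
theorem eventually_mem_image (τ : List (Fin 3)) : ∀ᶠ z in 𝓝 (cellMap τ mid), z ∈ UStar →
    z ∈ cellMap (τ ++ [1]) '' UStar ∪ cellMap (τ ++ [2]) '' UStar := by
  -- All points of the cell `j` have coordinate `j` at least `1/2`, so a smaller coordinate excludes
  -- that cell near `q`.
  have step : ∀ (j : Fin 3) (q : ℂ), bary j q < 1 / 2 →
      ∀ᶠ z in 𝓝 q, ∀ w ∈ UStar, z ≠ contr j w := by
    intro j q hq
    filter_upwards [(continuous_bary j).continuousAt.eventually_lt_const hq] with z hz w hw h
    rw [h, bary_contr_self] at hz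
    linarith [uStar_subset_tri hw j]
  induction τ with
  | nil =>
    have h0 : bary 0 mid < 1 / 2 := by
      rw [← contr_one_corner_zero, bary_contr_of_ne (by decide), bary_corner, if_neg (by decide)]
      norm_num
    filter_upwards [step 0 mid h0] with z hz hzU
    obtain ⟨i, w, hw, rfl⟩ := exists_eq_contr uZero_subset hzU
    fin_cases i
    · exact absurd rfl (hz w hw)
    · exact Or.inl ⟨w, hw, rfl⟩
    · exact Or.inr ⟨w, hw, rfl⟩
  | cons i τ ih =>
    have hT := cellMap_mem_tri mid_mem_tri τ
    have h1 : ∀ᶠ z in 𝓝 (contr i (cellMap τ mid)), ∀ j, i ≠ j → ∀ w ∈ UStar, z ≠ contr j w := by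
      rw [eventually_all]
      intro j
      by_cases hij : i = j
      · exact Eventually.of_forall fun z h => absurd hij h
      · have hlt : bary j (contr i (cellMap τ mid)) < 1 / 2 := by
          rw [bary_contr_of_ne hij]
          have := lt_of_le_of_ne (bary_le_one hT (-(i + j))) fun h =>
            cellMap_mid_ne_corner τ _ (eq_corner_of_bary_eq_one hT h)
          linarith
        filter_upwards [step j _ hlt] with z hz _
        exact hz
    have h2 : ∀ᶠ z in 𝓝 (contr i (cellMap τ mid)), ∀ w, z = contr i w → w ∈ UStar →
        w ∈ cellMap (τ ++ [1]) '' UStar ∪ cellMap (τ ++ [2]) '' UStar := by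
      obtain ⟨ε, hε, h⟩ := Metric.eventually_nhds_iff.1 ih
      refine Metric.eventually_nhds_iff.2 ⟨ε / 2, by positivity, ?_⟩
      rintro _ hz w rfl hw
      rw [dist_contr] at hz
      exact h (by linarith) hw
    filter_upwards [h1, h2] with z hz1 hz2 hzU
    obtain ⟨j, w, hw, rfl⟩ := exists_eq_contr uZero_subset hzU
    by_cases hij : i = j
    · subst hij
      rcases hz2 w rfl hw with ⟨v, hv, rfl⟩ | ⟨v, hv, rfl⟩
      · exact Or.inl ⟨v, hv, rfl⟩
      · exact Or.inr ⟨v, hv, rfl⟩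
    · exact absurd rfl (hz1 j hij w hw)

/-! ### Sums over words -/

/-- The sum of `f (u ∘ F_ω)` over all words `ω` of length `n`. -/
noncomputable def wordSum (f : (ℂ → ℝ) → ℝ) : ℕ → (ℂ → ℝ) → ℝ
  | 0, u => f u
  | n + 1, u => ∑ i, wordSum f n (u ∘ contr i)

theorem sum_eq_wordSum (f : (ℂ → ℝ) → ℝ) (n : ℕ) (u : ℂ → ℝ) :
    ∑ ω : Fin n → Fin 3, f (u ∘ cellMap (List.ofFn ω)) = wordSum f n u := by
  induction n generalizing u with
  | zero => simp [wordSum, cellMap]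
  | succ n ih =>
    rw [← (Fin.consEquiv fun _ => Fin 3).sum_comp, Fintype.sum_prod_type]
    simp only [wordSum, ← ih]
    refine Finset.sum_congr rfl fun i _ => Finset.sum_congr rfl fun ω _ => ?_
    simp [Fin.consEquiv, List.ofFn_succ, cellMap, Function.comp_assoc]

theorem energyAt_eq (a b c : ℕ → ℝ) (n : ℕ) (u : ℂ → ℝ) :
    energyAt a b c n u = wordSum (cellEnergy (a n) (b n) (c n)) n u := sum_eq_wordSum _ n u

/-- The definition splits off the outermost letter; the trace needs the innermost one, so that each
cell of level `n` is subdivided. -/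
theorem wordSum_succ' (f : (ℂ → ℝ) → ℝ) (n : ℕ) (u : ℂ → ℝ) :
    wordSum f (n + 1) u = wordSum (fun v => ∑ i, f (v ∘ contr i)) n u := by
  induction n generalizing u with
  | zero => rfl
  | succ n ih =>
    rw [wordSum]
    simp only [ih]
    rfl

theorem wordSum_le {f g : (ℂ → ℝ) → ℝ} {n : ℕ} {u v : ℂ → ℝ}
    (h : ∀ ω : List (Fin 3), ω.length = n → f (u ∘ cellMap ω) ≤ g (v ∘ cellMap ω)) :
    wordSum f n u ≤ wordSum g n v := by
  induction n generalizing u v with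
  | zero => exact h [] rfl
  | succ n ih =>
    refine Finset.sum_le_sum fun i _ => ih fun ω hω => ?_
    exact h (i :: ω) (by simp [hω])

theorem wordSum_congr {f g : (ℂ → ℝ) → ℝ} {n : ℕ} {u v : ℂ → ℝ}
    (h : ∀ ω : List (Fin 3), ω.length = n → f (u ∘ cellMap ω) = g (v ∘ cellMap ω)) :
    wordSum f n u = wordSum g n v :=
  le_antisymm (wordSum_le fun ω hω => (h ω hω).le) (wordSum_le fun ω hω => (h ω hω).ge)

theorem wordSum_const (x : ℝ) (n : ℕ) (u : ℂ → ℝ) : wordSum (fun _ => x) n u = 3 ^ n * x := by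
  induction n generalizing u with
  | zero => simp [wordSum]
  | succ n ih => simp only [wordSum, ih]; simp; ring

theorem wordSum_nonneg {f : (ℂ → ℝ) → ℝ} (hf : ∀ u, 0 ≤ f u) (n : ℕ) (u : ℂ → ℝ) :
    0 ≤ wordSum f n u := by
  induction n generalizing u with
  | zero => exact hf u
  | succ n ih => exact Finset.sum_nonneg fun i _ => ih _

theorem wordSum_add (f g : (ℂ → ℝ) → ℝ) (n : ℕ) (u : ℂ → ℝ) :
    wordSum (fun v => f v + g v) n u = wordSum f n u + wordSum g n u := by
  induction n generalizing u with
  | zero => rfl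
  | succ n ih => simp only [wordSum, ih, Finset.sum_add_distrib]

theorem wordSum_mul (f : (ℂ → ℝ) → ℝ) (x : ℝ) (n : ℕ) (u : ℂ → ℝ) :
    wordSum (fun v => x * f v) n u = x * wordSum f n u := by
  induction n generalizing u with
  | zero => rfl
  | succ n ih => simp only [wordSum, ih, Finset.mul_sum]

/-! ### Star-triangle transformation and the trace to the previous level -/

/-- The energy of the triangle equivalent to the star with leg resistances `r, s, t`. -/
noncomputable def starEnergy (r s t : ℝ) : (ℂ → ℝ) → ℝ :=
  cellEnergy (r / (r * s + s * t + t * r)) (s / (r * s + s * t + t * r))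
    (t / (r * s + s * t + t * r))

/-- The energy of the triangle in terms of the three vertex values. -/
noncomputable def triForm (r s t x y z : ℝ) : ℝ :=
  r / (r * s + s * t + t * r) * (y - z) ^ 2 + s / (r * s + s * t + t * r) * (x - z) ^ 2
    + t / (r * s + s * t + t * r) * (x - y) ^ 2

theorem starEnergy_eq (r s t : ℝ) (u : ℂ → ℝ) :
    starEnergy r s t u = triForm r s t (u (corner 0)) (u (corner 1)) (u (corner 2)) := rfl

section Algebra

variable {r s t : ℝ} (hr : 0 < r) (hs : 0 < s) (ht : 0 < t)

include hr hs ht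

/-- Completing the square in the centre value `o`, whose optimum is the mean of `x, y, z` weighted
by `1/r, 1/s, 1/t`. -/
theorem star_sub_triForm (x y z o : ℝ) :
    (x - o) ^ 2 / r + (y - o) ^ 2 / s + (z - o) ^ 2 / t - triForm r s t x y z
      = (1 / r + 1 / s + 1 / t)
        * (o - (x * (s * t) + y * (r * t) + z * (r * s)) / (r * s + s * t + t * r)) ^ 2 := by
  have hD : r * s + s * t + t * r ≠ 0 := by positivity
  rw [triForm]
  field_simp
  ring

theorem triForm_le_star (x y z o : ℝ) :
    triForm r s t x y z ≤ (x - o) ^ 2 / r + (y - o) ^ 2 / s + (z - o) ^ 2 / t := by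
  have h := star_sub_triForm hr hs ht x y z o
  have : 0 ≤ (1 / r + 1 / s + 1 / t)
        * (o - (x * (s * t) + y * (r * t) + z * (r * s)) / (r * s + s * t + t * r)) ^ 2 := by
    positivity
  linarith

theorem exists_triForm_eq_star (x y z : ℝ) :
    ∃ o, triForm r s t x y z = (x - o) ^ 2 / r + (y - o) ^ 2 / s + (z - o) ^ 2 / t := by
  refine ⟨(x * (s * t) + y * (r * t) + z * (r * s)) / (r * s + s * t + t * r), ?_⟩
  have h := star_sub_triForm hr hs ht x y z
    ((x * (s * t) + y * (r * t) + z * (r * s)) / (r * s + s * t + t * r))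
  rw [sub_self] at h
  linarith

-- The series law, again by completing the square.
omit ht in
theorem series_sub (x y m : ℝ) : (x - m) ^ 2 / r + (m - y) ^ 2 / s - (x - y) ^ 2 / (r + s)
    = (1 / r + 1 / s) * (m - (s * x + r * y) / (r + s)) ^ 2 := by
  have : r + s ≠ 0 := by positivity
  field_simp
  ring

omit ht in
theorem series_le (x y m : ℝ) :
    (x - y) ^ 2 / (r + s) ≤ (x - m) ^ 2 / r + (m - y) ^ 2 / s := by
  have h := series_sub hr hs x y m
  have : 0 ≤ (1 / r + 1 / s) * (m - (s * x + r * y) / (r + s)) ^ 2 := by positivity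
  linarith

omit ht in
theorem exists_series_eq (x y : ℝ) :
    ∃ m, (x - y) ^ 2 / (r + s) = (x - m) ^ 2 / r + (m - y) ^ 2 / s := by
  refine ⟨(s * x + r * y) / (r + s), ?_⟩
  have h := series_sub hr hs x y ((s * x + r * y) / (r + s))
  rw [sub_self] at h
  linarith

/-- The triangle with resistances `2r, 2s, 2t` as a star. -/
theorem triForm_inner (x y z : ℝ) :
    triForm (2 * (s * t) / (r + s + t)) (2 * (r * t) / (r + s + t)) (2 * (r * s) / (r + s + t))
      x y z = (y - z) ^ 2 / (r + r) + (x - z) ^ 2 / (s + s) + (x - y) ^ 2 / (t + t) := by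
  have : r + s + t ≠ 0 := by positivity
  have hD : 2 * (s * t) / (r + s + t) * (2 * (r * t) / (r + s + t))
      + 2 * (r * t) / (r + s + t) * (2 * (r * s) / (r + s + t))
      + 2 * (r * s) / (r + s + t) * (2 * (s * t) / (r + s + t)) = 4 * (r * s * t) / (r + s + t) := by
    field_simp; ring
  rw [triForm, hD]
  field_simp
  ring

/-- Turn the three small triangles into stars with centres `o₁, o₂, o₃`. Legs of equal type are in
series at the midpoints, so the centres span a triangle with resistances `2r, 2s, 2t`; turned into a
star, it lengthens the three outer legs. Eliminating each inner value only lowers the energy. -/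
theorem triForm_trace_le (x y z l m n : ℝ) :
    triForm (r + 2 * (s * t) / (r + s + t)) (s + 2 * (r * t) / (r + s + t))
      (t + 2 * (r * s) / (r + s + t)) x y z
      ≤ triForm r s t x m n + triForm r s t l y n + triForm r s t l m z := by
  obtain ⟨o₁, h₁⟩ := exists_triForm_eq_star hr hs ht x m n
  obtain ⟨o₂, h₂⟩ := exists_triForm_eq_star hr hs ht l y n
  obtain ⟨o₃, h₃⟩ := exists_triForm_eq_star hr hs ht l m z
  have hρ₁ : 0 < 2 * (s * t) / (r + s + t) := by positivity
  have hρ₂ : 0 < 2 * (r * t) / (r + s + t) := by positivity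
  have hρ₃ : 0 < 2 * (r * s) / (r + s + t) := by positivity
  obtain ⟨o, h⟩ := exists_triForm_eq_star hρ₁ hρ₂ hρ₃ o₁ o₂ o₃
  rw [triForm_inner hr hs ht] at h
  have e₁ := series_le hr hr o₂ o₃ l
  have e₂ := series_le hs hs o₁ o₃ m
  have e₃ := series_le ht ht o₁ o₂ n
  have f₁ := series_le hr hρ₁ x o o₁
  have f₂ := series_le hs hρ₂ y o o₂
  have f₃ := series_le ht hρ₃ z o o₃
  have g := triForm_le_star (add_pos hr hρ₁) (add_pos hs hρ₂) (add_pos ht hρ₃) x y z o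
  rw [h₁, h₂, h₃]
  rw [sub_sq_comm o₂ l] at e₁
  rw [sub_sq_comm o₁ m] at e₂
  rw [sub_sq_comm o₁ n] at e₃
  linarith

/-- The same reduction run backwards, with an optimal value chosen at each inner node. -/
theorem exists_triForm_trace (x y z : ℝ) : ∃ l m n : ℝ,
    triForm r s t x m n + triForm r s t l y n + triForm r s t l m z ≤
    triForm (r + 2 * (s * t) / (r + s + t)) (s + 2 * (r * t) / (r + s + t))
      (t + 2 * (r * s) / (r + s + t)) x y z := by
  have hρ₁ : 0 < 2 * (s * t) / (r + s + t) := by positivity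
  have hρ₂ : 0 < 2 * (r * t) / (r + s + t) := by positivity
  have hρ₃ : 0 < 2 * (r * s) / (r + s + t) := by positivity
  obtain ⟨o, g⟩ := exists_triForm_eq_star (add_pos hr hρ₁) (add_pos hs hρ₂) (add_pos ht hρ₃) x y z
  obtain ⟨o₁, f₁⟩ := exists_series_eq hr hρ₁ x o
  obtain ⟨o₂, f₂⟩ := exists_series_eq hs hρ₂ y o
  obtain ⟨o₃, f₃⟩ := exists_series_eq ht hρ₃ z o
  obtain ⟨l, e₁⟩ := exists_series_eq hr hr o₂ o₃
  obtain ⟨m, e₂⟩ := exists_series_eq hs hs o₁ o₃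
  obtain ⟨n, e₃⟩ := exists_series_eq ht ht o₁ o₂
  refine ⟨l, m, n, ?_⟩
  have h₁ := triForm_le_star hr hs ht x m n o₁
  have h₂ := triForm_le_star hr hs ht l y n o₂
  have h₃ := triForm_le_star hr hs ht l m z o₃
  have h := triForm_le_star hρ₁ hρ₂ hρ₃ o₁ o₂ o₃ o
  rw [triForm_inner hr hs ht] at h
  rw [sub_sq_comm o₂ l] at e₁
  rw [sub_sq_comm o₁ m] at e₂
  rw [sub_sq_comm o₁ n] at e₃
  linarith

end Algebra

theorem cellMap_edgeMid_inj {ω τ : List (Fin 3)} (hl : ω.length = τ.length) {k l : Fin 3}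
    (h : cellMap ω (edgeMid k) = cellMap τ (edgeMid l)) : ω = τ ∧ k = l := by
  induction ω generalizing τ with
  | nil =>
    obtain rfl := List.length_eq_zero_iff.1 hl.symm
    exact ⟨rfl, edgeMid_injective h⟩
  | cons i ω ih =>
    cases τ with
    | nil => simp at hl
    | cons j τ =>
      by_cases hij : i = j
      · subst hij
        have := ih (by simpa using hl) (contr_injective i h)
        exact ⟨by rw [this.1], this.2⟩
      · exact absurd (eq_corner_of_contr_eq (cellMap_mem_tri (edgeMid_mem_tri k) ω)
          (cellMap_mem_tri (edgeMid_mem_tri l) τ) hij h).1 (cellMap_edgeMid_ne_corner _ _ _)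

theorem cellMap_edgeMid_notMem (ω : List (Fin 3)) (k : Fin 3) :
    cellMap ω (edgeMid k) ∉ V ω.length := by
  induction ω with
  | nil =>
    rintro ⟨i, hi⟩
    exact edgeMid_ne_corner k i hi.symm
  | cons i ω ih =>
    intro h
    exact ih (mem_level_of_contr_mem subset_rfl (cellMap_mem_tri (edgeMid_mem_tri k) ω) h)

/-- A function on `Vₙ` extends to the next level with prescribed values at the new vertices. -/
theorem exists_extension (n : ℕ) (u : ℂ → ℝ) (h : (ℂ → ℝ) → Fin 3 → ℝ) :
    ∃ v : ℂ → ℝ, Set.EqOn v u (V n) ∧ ∀ ω : List (Fin 3), ω.length = n →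
      ∀ k, v (cellMap ω (edgeMid k)) = h (u ∘ cellMap ω) k := by
  let e : {ω : List (Fin 3) // ω.length = n} × Fin 3 → ℂ := fun p => cellMap p.1 (edgeMid p.2)
  have he : Function.Injective e := by
    rintro ⟨⟨ω, hω⟩, k⟩ ⟨⟨τ, hτ⟩, l⟩ hp
    obtain ⟨rfl, rfl⟩ := cellMap_edgeMid_inj (hω.trans hτ.symm) hp
    rfl
  -- New vertices of different cells are distinct and lie outside `V n`, so the minimizations in the
  -- cells are independent.
  refine ⟨Function.extend e (fun p => h (u ∘ cellMap p.1) p.2) u, fun z hz => ?_, ?_⟩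
  · apply Function.extend_apply'
    rintro ⟨⟨⟨ω, rfl⟩, k⟩, rfl⟩
    exact cellMap_edgeMid_notMem ω k hz
  · intro ω hω k
    exact he.extend_apply _ _ (⟨ω, hω⟩, k)

theorem cellMap_corner_mem (ω : List (Fin 3)) (k : Fin 3) : cellMap ω (corner k) ∈ V ω.length :=
  mem_level_iff.2 ⟨ω, rfl, _, ⟨k, rfl⟩, rfl⟩

theorem sum_starEnergy (r s t : ℝ) (v : ℂ → ℝ) : ∑ i, starEnergy r s t (v ∘ contr i)
    = triForm r s t (v (corner 0)) (v (edgeMid 1)) (v (edgeMid 2))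
      + triForm r s t (v (edgeMid 0)) (v (corner 1)) (v (edgeMid 2))
      + triForm r s t (v (edgeMid 0)) (v (edgeMid 1)) (v (corner 2)) := by
  rw [Fin.sum_univ_three]
  simp only [starEnergy_eq, Function.comp_apply, contr_corner]
  rw [contr_corner_of_ne (i := 0) (k := 1) (by decide),
    contr_corner_of_ne (i := 0) (k := 2) (by decide),
    contr_corner_of_ne (i := 1) (k := 0) (by decide),
    contr_corner_of_ne (i := 1) (k := 2) (by decide),
    contr_corner_of_ne (i := 2) (k := 0) (by decide),
    contr_corner_of_ne (i := 2) (k := 1) (by decide)]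

/-- The trace of a level to the previous one, in terms of star resistances. -/
theorem isLeast_trace {r s t : ℝ} (hr : 0 < r) (hs : 0 < s) (ht : 0 < t) (n : ℕ) (u : ℂ → ℝ) :
    IsLeast {e : ℝ | ∃ v : ℂ → ℝ, Set.EqOn v u (V n) ∧ e = wordSum (starEnergy r s t) (n + 1) v}
      (wordSum (starEnergy (r + 2 * (s * t) / (r + s + t)) (s + 2 * (r * t) / (r + s + t))
        (t + 2 * (r * s) / (r + s + t))) n u) := by
  have lower : ∀ v : ℂ → ℝ, Set.EqOn v u (V n) →
      wordSum (starEnergy (r + 2 * (s * t) / (r + s + t)) (s + 2 * (r * t) / (r + s + t))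
        (t + 2 * (r * s) / (r + s + t))) n u ≤ wordSum (starEnergy r s t) (n + 1) v := by
    intro v hv
    rw [wordSum_succ']
    refine wordSum_le fun ω hω => ?_
    rw [sum_starEnergy, starEnergy_eq]
    have hk : ∀ k, (u ∘ cellMap ω) (corner k) = (v ∘ cellMap ω) (corner k) := fun k =>
      (hv (hω ▸ cellMap_corner_mem ω k)).symm
    rw [hk, hk, hk]
    exact triForm_trace_le hr hs ht _ _ _ _ _ _
  refine ⟨?_, ?_⟩
  · choose l m k h using fun w : ℂ → ℝ =>
      exists_triForm_trace hr hs ht (w (corner 0)) (w (corner 1)) (w (corner 2))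
    obtain ⟨v, hv, hext⟩ := exists_extension n u fun w => ![l w, m w, k w]
    refine ⟨v, hv, le_antisymm (lower v hv) ?_⟩
    rw [wordSum_succ']
    refine wordSum_le fun ω hω => ?_
    rw [sum_starEnergy, starEnergy_eq]
    have hk : ∀ k, (v ∘ cellMap ω) (corner k) = (u ∘ cellMap ω) (corner k) := fun k =>
      hv (hω ▸ cellMap_corner_mem ω k)
    rw [hk, hk, hk]
    simp only [Function.comp_apply, hext ω hω]
    exact h (u ∘ cellMap ω)
  · rintro _ ⟨v, hv, rfl⟩
    exact lower v hv

/-- A function taking a prescribed value on each of the three classes of vertices. -/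
theorem exists_typeFunction (n : ℕ) (f : Fin 3 → ℝ) : ∃ u : ℂ → ℝ,
    ∀ ω : List (Fin 3), ω.length = n → ∀ k, u (cellMap ω (corner k)) = f k := by
  classical
  have hsub : ∀ k, {corner k} ⊆ Set.range corner := fun k => by simp
  have hmem : ∀ (ω : List (Fin 3)), ω.length = n → ∀ k, cellMap ω (corner k) ∈
      level {corner k} n := fun ω hω k => mem_level_iff.2 ⟨ω, hω, _, rfl, rfl⟩
  have hnot : ∀ (ω : List (Fin 3)), ω.length = n → ∀ k l, k ≠ l → cellMap ω (corner k) ∉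
      level {corner l} n := fun ω hω k l hkl => by
    refine Set.disjoint_left.1 (disjoint_level (hsub k) (hsub l) ?_ n) (hmem ω hω k)
    simpa using corner_injective.ne hkl
  refine ⟨fun z => if z ∈ level {corner 0} n then f 0 else
    if z ∈ level {corner 1} n then f 1 else f 2, fun ω hω k => ?_⟩
  fin_cases k
  · exact if_pos (hmem ω hω 0)
  · exact (if_neg (hnot ω hω 1 0 (by decide))).trans (if_pos (hmem ω hω 1))
  · exact (if_neg (hnot ω hω 2 0 (by decide))).trans (if_neg (hnot ω hω 2 1 (by decide)))

/-- On functions depending only on the vertex type all `3ⁿ` cells contribute equally, so the total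
energy determines the conductances of one cell. -/
theorem eq_of_wordSum_cellEnergy_eq {α β γ α' β' γ' : ℝ} (n : ℕ)
    (h : ∀ u, wordSum (cellEnergy α β γ) n u = wordSum (cellEnergy α' β' γ') n u) :
    α = α' ∧ β = β' ∧ γ = γ' := by
  have key : ∀ f : Fin 3 → ℝ,
      α * (f 1 - f 2) ^ 2 + β * (f 0 - f 2) ^ 2 + γ * (f 0 - f 1) ^ 2
        = α' * (f 1 - f 2) ^ 2 + β' * (f 0 - f 2) ^ 2 + γ' * (f 0 - f 1) ^ 2 := by
    intro f
    obtain ⟨u, hu⟩ := exists_typeFunction n f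
    have h2 : ∀ α β γ : ℝ, wordSum (cellEnergy α β γ) n u
        = 3 ^ n * (α * (f 1 - f 2) ^ 2 + β * (f 0 - f 2) ^ 2 + γ * (f 0 - f 1) ^ 2) := by
      intro α β γ
      rw [← wordSum_const _ n u]
      refine wordSum_congr fun ω hω => ?_
      simp only [cellEnergy, Function.comp_apply, hu ω hω]
    have h3 := h u
    rw [h2, h2] at h3
    exact mul_left_cancel₀ (by positivity) h3
  have h0 := key ![1, 0, 0]
  have h1 := key ![0, 1, 0]
  have h2 := key ![0, 0, 1]
  simp at h0 h1 h2
  exact ⟨by linarith, by linarith, by linarith⟩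

/-- The recursion for the star resistances of compatible conductances. -/
structure StarRecursion (r s t : ℕ → ℝ) : Prop where
  pos : ∀ n, 0 < r n ∧ 0 < s n ∧ 0 < t n
  rec_r : ∀ n, r n = r (n + 1) + 2 * (s (n + 1) * t (n + 1)) / (r (n + 1) + s (n + 1) + t (n + 1))
  rec_s : ∀ n, s n = s (n + 1) + 2 * (r (n + 1) * t (n + 1)) / (r (n + 1) + s (n + 1) + t (n + 1))
  rec_t : ∀ n, t n = t (n + 1) + 2 * (r (n + 1) * s (n + 1)) / (r (n + 1) + s (n + 1) + t (n + 1))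

theorem StarRecursion.isCompatible {r s t : ℕ → ℝ} (h : StarRecursion r s t) :
    IsCompatible (fun n => r n / (r n * s n + s n * t n + t n * r n))
      (fun n => s n / (r n * s n + s n * t n + t n * r n))
      (fun n => t n / (r n * s n + s n * t n + t n * r n)) where
  pos n := by
    obtain ⟨hr, hs, ht⟩ := h.pos n
    exact ⟨by positivity, by positivity, by positivity⟩
  trace n u := by
    simp only [energyAt_eq]
    obtain ⟨hr, hs, ht⟩ := h.pos (n + 1)
    have := isLeast_trace hr hs ht n u
    rw [← h.rec_r, ← h.rec_s, ← h.rec_t] at this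
    exact this

/-- Conductances and star resistances are exchanged by one involution: division by the sum of
pairwise products. -/
theorem star_involutive {a b c : ℝ} (ha : 0 < a) (hb : 0 < b) (hc : 0 < c) (x : ℝ) :
    x / (a * b + b * c + c * a) / (a / (a * b + b * c + c * a) * (b / (a * b + b * c + c * a))
      + b / (a * b + b * c + c * a) * (c / (a * b + b * c + c * a))
      + c / (a * b + b * c + c * a) * (a / (a * b + b * c + c * a))) = x := by
  have : a * b + b * c + c * a ≠ 0 := by positivity
  field_simp

theorem starEnergy_involutive {a b c : ℝ} (ha : 0 < a) (hb : 0 < b) (hc : 0 < c) :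
    starEnergy (a / (a * b + b * c + c * a)) (b / (a * b + b * c + c * a))
      (c / (a * b + b * c + c * a)) = cellEnergy a b c := by
  rw [starEnergy, star_involutive ha hb hc, star_involutive ha hb hc, star_involutive ha hb hc]

/-- A least element is unique, so the assumed trace is the computed one of `isLeast_trace`, and
conductances can be compared. -/
theorem IsCompatible.starRecursion {a b c : ℕ → ℝ} (h : IsCompatible a b c) :
    StarRecursion (fun n => a n / (a n * b n + b n * c n + c n * a n))
      (fun n => b n / (a n * b n + b n * c n + c n * a n))
      (fun n => c n / (a n * b n + b n * c n + c n * a n)) := by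
  have hpos : ∀ n, 0 < a n / (a n * b n + b n * c n + c n * a n) ∧
      0 < b n / (a n * b n + b n * c n + c n * a n) ∧
      0 < c n / (a n * b n + b n * c n + c n * a n) := fun n => by
    obtain ⟨ha, hb, hc⟩ := h.pos n
    exact ⟨by positivity, by positivity, by positivity⟩
  have key : ∀ n, ∀ r s t : ℝ, r = a (n + 1) / (a (n + 1) * b (n + 1) + b (n + 1) * c (n + 1)
        + c (n + 1) * a (n + 1)) →
      s = b (n + 1) / (a (n + 1) * b (n + 1) + b (n + 1) * c (n + 1) + c (n + 1) * a (n + 1)) →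
      t = c (n + 1) / (a (n + 1) * b (n + 1) + b (n + 1) * c (n + 1) + c (n + 1) * a (n + 1)) →
      a n / (a n * b n + b n * c n + c n * a n) = r + 2 * (s * t) / (r + s + t) ∧
      b n / (a n * b n + b n * c n + c n * a n) = s + 2 * (r * t) / (r + s + t) ∧
      c n / (a n * b n + b n * c n + c n * a n) = t + 2 * (r * s) / (r + s + t) := by
    intro n r s t hr' hs' ht'
    obtain ⟨ha, hb, hc⟩ := h.pos (n + 1)
    obtain ⟨hr, hs, ht⟩ := hpos (n + 1)
    have hE := starEnergy_involutive ha hb hc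
    rw [← hr', ← hs', ← ht'] at hE
    rw [← hr'] at hr
    rw [← hs'] at hs
    rw [← ht'] at ht
    have hw : ∀ u, wordSum (cellEnergy (a n) (b n) (c n)) n u
        = wordSum (starEnergy (r + 2 * (s * t) / (r + s + t)) (s + 2 * (r * t) / (r + s + t))
          (t + 2 * (r * s) / (r + s + t))) n u := fun u => by
      have h1 := h.trace n u
      simp only [energyAt_eq] at h1
      rw [← hE] at h1
      exact h1.unique (isLeast_trace hr hs ht n u)
    obtain ⟨e₁, e₂, e₃⟩ := eq_of_wordSum_cellEnergy_eq n hw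
    have hρ₁ : 0 < r + 2 * (s * t) / (r + s + t) := by positivity
    have hρ₂ : 0 < s + 2 * (r * t) / (r + s + t) := by positivity
    have hρ₃ : 0 < t + 2 * (r * s) / (r + s + t) := by positivity
    rw [e₁, e₂, e₃]
    exact ⟨star_involutive hρ₁ hρ₂ hρ₃ _, star_involutive hρ₁ hρ₂ hρ₃ _,
      star_involutive hρ₁ hρ₂ hρ₃ _⟩
  exact ⟨hpos, fun n => (key n _ _ _ rfl rfl rfl).1, fun n => (key n _ _ _ rfl rfl rfl).2.1,
    fun n => (key n _ _ _ rfl rfl rfl).2.2⟩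

/-! ### The recursion for the resistances -/

theorem StarRecursion.rotate {r s t : ℕ → ℝ} (h : StarRecursion r s t) : StarRecursion s t r where
  pos n := ⟨(h.pos n).2.1, (h.pos n).2.2, (h.pos n).1⟩
  rec_r n := by rw [h.rec_s n]; ring_nf
  rec_s n := by rw [h.rec_t n]; ring_nf
  rec_t n := by rw [h.rec_r n]; ring_nf

theorem StarRecursion.antitone {r s t : ℕ → ℝ} (h : StarRecursion r s t) : Antitone r :=
  antitone_nat_of_succ_le fun n => by
    rw [h.rec_r n]
    obtain ⟨hr, hs, ht⟩ := h.pos (n + 1)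
    have : 0 < 2 * (s (n + 1) * t (n + 1)) / (r (n + 1) + s (n + 1) + t (n + 1)) := by positivity
    linarith

theorem StarRecursion.diff_eq {r s t : ℕ → ℝ} (h : StarRecursion r s t) (n : ℕ) :
    s n - t n = (s (n + 1) - t (n + 1)) * ((s (n + 1) + t (n + 1) - r (n + 1)) /
      (r (n + 1) + s (n + 1) + t (n + 1))) := by
  obtain ⟨hr, hs, ht⟩ := h.pos (n + 1)
  have : r (n + 1) + s (n + 1) + t (n + 1) ≠ 0 := by positivity
  rw [h.rec_s n, h.rec_t n]
  field_simp
  ring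

/-- The factor in `diff_eq` lies in `[-1, 1]`, so unequal legs never draw closer as `n` grows. -/
theorem StarRecursion.monotone_abs_diff {r s t : ℕ → ℝ} (h : StarRecursion r s t) :
    Monotone fun n => |s n - t n| :=
  monotone_nat_of_le_succ fun n => by
    obtain ⟨hr, hs, ht⟩ := h.pos (n + 1)
    rw [h.diff_eq n, abs_mul]
    refine mul_le_of_le_one_right (abs_nonneg _) ?_
    rw [abs_le]
    constructor
    · rw [le_div_iff₀ (by positivity)]; linarith
    · rw [div_le_iff₀ (by positivity)]; linarith

theorem StarRecursion.exists_tendsto {r s t : ℕ → ℝ} (h : StarRecursion r s t) :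
    ∃ l, 0 ≤ l ∧ Tendsto r atTop (𝓝 l) :=
  ⟨⨅ n, r n, le_ciInf fun n => (h.pos n).1.le,
    tendsto_atTop_ciInf h.antitone ⟨0, by rintro _ ⟨n, rfl⟩; exact (h.pos n).1.le⟩⟩

/-- Cleared of denominators, the recursion equates `2 s t` at level `n + 1` with a product whose
factor `r n - r (n + 1)` tends to zero. -/
theorem StarRecursion.limit_mul_eq_zero {r s t : ℕ → ℝ} (h : StarRecursion r s t) {l m k : ℝ}
    (hr : Tendsto r atTop (𝓝 l)) (hs : Tendsto s atTop (𝓝 m)) (ht : Tendsto t atTop (𝓝 k)) :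
    m * k = 0 := by
  have hr' := (tendsto_add_atTop_iff_nat 1).2 hr
  have hs' := (tendsto_add_atTop_iff_nat 1).2 hs
  have ht' := (tendsto_add_atTop_iff_nat 1).2 ht
  have h1 := (hr.sub hr').mul ((hr'.add hs').add ht')
  have h2 := (hs'.mul ht').const_mul 2
  have h3 : ∀ n, (r n - r (n + 1)) * (r (n + 1) + s (n + 1) + t (n + 1))
      = 2 * (s (n + 1) * t (n + 1)) := fun n => by
    obtain ⟨hr, hs, ht⟩ := h.pos (n + 1)
    have : r (n + 1) + s (n + 1) + t (n + 1) ≠ 0 := by positivity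
    rw [h.rec_r n]
    field_simp
    ring
  have h4 := tendsto_nhds_unique (h1.congr h3) h2
  linarith

/-- Compatible conductances that are symmetric at level zero are symmetric at all levels. -/
theorem StarRecursion.symmetric {r s t : ℕ → ℝ} (h : StarRecursion r s t) (h0 : s 0 = t 0)
    (hrs : s 0 < r 0) (n : ℕ) : s n = t n := by
  by_contra hne
  obtain ⟨l, -, hl⟩ := h.exists_tendsto
  obtain ⟨m, -, hm⟩ := h.rotate.exists_tendsto
  obtain ⟨k, -, hk⟩ := h.rotate.rotate.exists_tendsto
  have hmk := h.limit_mul_eq_zero hl hm hk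
  have hkl := h.rotate.limit_mul_eq_zero hm hk hl
  have hlm := h.rotate.rotate.limit_mul_eq_zero hk hl hm
  have d1 := h.monotone_abs_diff.ge_of_tendsto (hm.sub hk).abs n
  have d2 := h.rotate.monotone_abs_diff.ge_of_tendsto (hk.sub hl).abs 0
  have d3 := h.rotate.rotate.monotone_abs_diff.ge_of_tendsto (hl.sub hm).abs 0
  have p1 : 0 < |s n - t n| := abs_pos.2 (sub_ne_zero.2 hne)
  have p2 : 0 < |t 0 - r 0| := abs_pos.2 (sub_ne_zero.2 (by linarith))
  have p3 : 0 < |r 0 - s 0| := abs_pos.2 (sub_ne_zero.2 (by linarith))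
  have e1 : m - k ≠ 0 := abs_pos.1 (p1.trans_le d1)
  have e2 : k - l ≠ 0 := abs_pos.1 (p2.trans_le d2)
  have e3 : l - m ≠ 0 := abs_pos.1 (p3.trans_le d3)
  -- Pairwise products of the limits vanish, so two limits are zero and hence equal; but all three
  -- differences of limits are nonzero.
  rcases mul_eq_zero.1 hmk with hm0 | hk0
  · subst hm0
    rcases mul_eq_zero.1 hkl with hk0 | hl0
    · exact e1 (by rw [hk0, sub_zero])
    · exact e3 (by rw [hl0, sub_zero])
  · subst hk0
    rcases mul_eq_zero.1 hlm with hl0 | hm0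
    · exact e2 (by rw [hl0, sub_zero])
    · exact e1 (by rw [hm0, sub_zero])

/-- In the symmetric case the short legs decay like `3⁻ⁿ` and the long leg stays bounded below. -/
theorem StarRecursion.bounds {r s : ℕ → ℝ} (h : StarRecursion r s s) (hrs : s 0 < r 0) (n : ℕ) :
    s 0 ≤ 3 ^ n * s n ∧ r 0 - s 0 ≤ r n - s n ∧
      3 ^ n * s n * (r 0 - s 0) ≤ s 0 * (r n - s n) := by
  induction n with
  | zero => simp
  | succ n ih =>
    obtain ⟨h1, h2, h3⟩ := ih
    obtain ⟨hr, hs, -⟩ := h.pos (n + 1)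
    have hσ : 0 < r (n + 1) + s (n + 1) + s (n + 1) := by positivity
    -- With `d = r - s`, the two identities give `s n / d n = (3 + 2 s' / r') (s' / d')`, primes
    -- denoting level `n + 1`; hence `3ⁿ s n / d n` does not increase.
    have es : s n * (r (n + 1) + s (n + 1) + s (n + 1))
        = s (n + 1) * (3 * r (n + 1) + 2 * s (n + 1)) := by
      rw [h.rec_s n]; field_simp; ring
    have ed : (r n - s n) * (r (n + 1) + s (n + 1) + s (n + 1))
        = (r (n + 1) - s (n + 1)) * r (n + 1) := by
      rw [h.rec_s n, h.rec_r n]; field_simp; ring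
    have hd : 0 < r (n + 1) - s (n + 1) := by
      have : 0 < (r (n + 1) - s (n + 1)) * r (n + 1) := by
        rw [← ed]; exact mul_pos (by linarith) hσ
      exact pos_of_mul_pos_left this hr.le
    have p3 : (0 : ℝ) < 3 ^ n := by positivity
    refine ⟨?_, ?_, ?_⟩
    · refine h1.trans ?_
      rw [pow_succ, mul_assoc]
      refine mul_le_mul_of_nonneg_left ?_ p3.le
      refine le_of_mul_le_mul_right ?_ hσ
      rw [es]
      nlinarith [mul_pos hs hs]
    · refine h2.trans ?_
      refine le_of_mul_le_mul_right ?_ hσ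
      rw [ed]
      nlinarith [mul_pos hd hs]
    · refine le_of_mul_le_mul_right ?_ hr
      calc 3 ^ (n + 1) * s (n + 1) * (r 0 - s 0) * r (n + 1)
          ≤ 3 ^ n * (s (n + 1) * (3 * r (n + 1) + 2 * s (n + 1))) * (r 0 - s 0) := by
            rw [pow_succ]
            have : 0 ≤ 3 ^ n * (s (n + 1) * s (n + 1)) * (r 0 - s 0) :=
              mul_nonneg (by positivity) (by linarith)
            nlinarith
        _ = 3 ^ n * s n * (r 0 - s 0) * (r (n + 1) + s (n + 1) + s (n + 1)) := by rw [← es]; ring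
        _ ≤ s 0 * (r n - s n) * (r (n + 1) + s (n + 1) + s (n + 1)) :=
            mul_le_mul_of_nonneg_right h3 hσ.le
        _ = s 0 * (r (n + 1) - s (n + 1)) * r (n + 1) := by rw [mul_assoc, ed]; ring

/-- Conductances that are symmetric, with `aₙ` comparable to `3ⁿ` and `bₙ` bounded. -/
structure Controlled (a b c : ℕ → ℝ) (K : ℝ) : Prop where
  symm : ∀ n, c n = b n
  b_pos : ∀ n, 0 < b n
  b_le : ∀ n, b n ≤ K
  le_a : ∀ n, 3 ^ n ≤ K * a n
  a_le : ∀ n, a n ≤ K * 3 ^ n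

/-- With equal legs, `b = 1 / (2r + s)` and `a s = r / (2r + s)`, the latter between `1/3` and `1/2`
for `s ≤ r`. So the bounds on `r` and on `3ⁿ s` suffice. -/
theorem IsCompatible.controlled {a b c : ℕ → ℝ} (h : IsCompatible a b c) (h0 : c 0 = b 0)
    (hab : b 0 < a 0) : ∃ K, Controlled a b c K := by
  obtain ⟨ha0, hb0, hc0⟩ := h.pos 0
  have hS0 : 0 < a 0 * b 0 + b 0 * c 0 + c 0 * a 0 := by positivity
  have hrec := h.starRecursion
  have hsymm := hrec.symmetric (by rw [h0]) (div_lt_div_of_pos_right hab hS0)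
  have hcb : ∀ n, c n = b n := fun n => by
    obtain ⟨ha, hb, hc⟩ := h.pos n
    have hS : a n * b n + b n * c n + c n * a n ≠ 0 := by positivity
    exact (div_left_inj' hS).1 (hsymm n).symm
  obtain rfl : c = b := funext hcb
  set r : ℕ → ℝ := fun n => a n / (a n * c n + c n * c n + c n * a n) with hr
  set s : ℕ → ℝ := fun n => c n / (a n * c n + c n * c n + c n * a n) with hs
  have hrs : s 0 < r 0 := div_lt_div_of_pos_right hab hS0
  have hb := hrec.bounds hrs
  have hc : ∀ n, c n * (2 * r n + s n) = 1 := fun n => by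
    obtain ⟨ha, hb, -⟩ := h.pos n
    have hS : a n * c n + c n * c n + c n * a n ≠ 0 := by positivity
    simp only [hr, hs]
    field_simp
    ring
  have ha : ∀ n, a n * (s n * (2 * r n + s n)) = r n := fun n => by
    obtain ⟨ha, hb, -⟩ := h.pos n
    have hS : a n * c n + c n * c n + c n * a n ≠ 0 := by positivity
    simp only [hr, hs]
    field_simp
    ring
  have hs0 : 0 < s 0 := (hrec.pos 0).2.1
  have hd : 0 < r 0 - s 0 := by linarith
  refine ⟨max (1 / (r 0 - s 0)) (max (1 / s 0) (3 * (s 0 * r 0 / (r 0 - s 0)))), fun n => rfl,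
    fun n => (h.pos n).2.1, fun n => le_trans ?_ (le_max_left _ _), fun n => ?_, fun n => ?_⟩
  · obtain ⟨-, hsn, -⟩ := hrec.pos n
    rw [le_div_iff₀ hd, ← hc n]
    refine mul_le_mul_of_nonneg_left ?_ (h.pos n).2.1.le
    have := (hb n).2.1
    change 0 < s n at hsn
    linarith
  · obtain ⟨hrn, hsn, -⟩ := hrec.pos n
    change 0 < r n at hrn
    change 0 < s n at hsn
    have han := (h.pos n).1
    have h3 : (0 : ℝ) < 3 ^ n := by positivity
    refine le_trans ?_ (mul_le_mul_of_nonneg_right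
      ((le_max_right _ _).trans (le_max_right _ _)) han.le)
    have h1 : 1 ≤ a n * (3 * s n) := by
      refine le_of_mul_le_mul_right ?_ hrn
      rw [one_mul]
      calc r n = a n * (s n * (2 * r n + s n)) := (ha n).symm
        _ ≤ a n * (s n * (3 * r n)) := by
          have := (hb n).2.1
          gcongr
          linarith
        _ = _ := by ring
    have h2 : 3 ^ n * s n ≤ s 0 * r 0 / (r 0 - s 0) := by
      rw [le_div_iff₀ hd]
      refine (hb n).2.2.trans (mul_le_mul_of_nonneg_left ?_ hs0.le)
      have : r n ≤ r 0 := hrec.antitone (Nat.zero_le n)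
      linarith
    calc (3 : ℝ) ^ n ≤ 3 ^ n * (a n * (3 * s n)) := le_mul_of_one_le_right h3.le h1
      _ = 3 * (3 ^ n * s n) * a n := by ring
      _ ≤ _ := by gcongr
  · obtain ⟨hrn, hsn, -⟩ := hrec.pos n
    change 0 < r n at hrn
    change 0 < s n at hsn
    have han := (h.pos n).1
    have h3 : (0 : ℝ) < 3 ^ n := by positivity
    refine le_trans ?_ (mul_le_mul_of_nonneg_right
      ((le_max_left _ _).trans (le_max_right _ _)) h3.le)
    have h1 : a n * s n ≤ 1 := by
      refine le_of_mul_le_mul_right ?_ hrn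
      rw [one_mul]
      calc a n * s n * r n ≤ a n * (s n * (2 * r n + s n)) := by
            rw [mul_assoc]
            gcongr
            linarith
        _ = r n := ha n
    rw [div_mul_eq_mul_div, one_mul, le_div_iff₀ hs0]
    calc a n * s 0 ≤ a n * (3 ^ n * s n) := by gcongr; exact (hb n).1
      _ = 3 ^ n * (a n * s n) := by ring
      _ ≤ 3 ^ n := mul_le_of_le_one_right h3.le h1

/-! ### Existence of compatible conductances -/

theorem exists_symmetric_preimage {r s : ℝ} (hs : 0 < s) (hrs : s < r) : ∃ r' s' : ℝ, 0 < s' ∧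
    s' < r' ∧ r = r' + 2 * (s' * s') / (r' + s' + s') ∧
      s = s' + 2 * (r' * s') / (r' + s' + s') := by
  have hr : 0 < r := hs.trans hrs
  set τ := s / r with hτ
  have hτ0 : 0 < τ := by positivity
  have hτ1 : τ < 1 := (div_lt_one hr).2 hrs
  -- With `t = s' / r'`, dividing the two equations gives `τ = (3t + 2t²) / (1 + 2t + 2t²)`. The
  -- resulting quadratic is negative at `0` and positive at `1`.
  have hcont : Continuous fun t : ℝ => 2 * (1 - τ) * t ^ 2 + (3 - 2 * τ) * t - τ := by fun_prop
  obtain ⟨t, ⟨ht0, ht1⟩, ht⟩ := intermediate_value_Ioo (zero_le_one (α := ℝ)) hcont.continuousOn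
    (show (0 : ℝ) ∈ Set.Ioo _ _ by constructor <;> norm_num <;> linarith)
  simp only at ht
  have hD : 0 < 1 + 2 * t + 2 * t ^ 2 := by positivity
  refine ⟨r * (1 + 2 * t) / (1 + 2 * t + 2 * t ^ 2), t * (r * (1 + 2 * t) / (1 + 2 * t + 2 * t ^ 2)),
    by positivity, mul_lt_of_lt_one_left (by positivity) ht1, ?_, ?_⟩
  · field_simp
    ring
  · have hs' : s = τ * r := by rw [hτ]; field_simp
    have h2 : τ * (1 + 2 * t + 2 * t ^ 2) = 3 * t + 2 * t ^ 2 := by linarith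
    rw [hs', eq_div_of_mul_eq hD.ne' h2]
    field_simp
    ring

theorem exists_isCompatible {a₀ b₀ : ℝ} (hb₀ : 0 < b₀) (hab : b₀ < a₀) :
    ∃ a b c : ℕ → ℝ, IsCompatible a b c ∧ a 0 = a₀ ∧ b 0 = b₀ ∧ c 0 = b₀ := by
  have ha₀ : 0 < a₀ := hb₀.trans hab
  have hS : 0 < a₀ * b₀ + b₀ * b₀ + b₀ * a₀ := by positivity
  have hex : ∀ p : {p : ℝ × ℝ // 0 < p.2 ∧ p.2 < p.1}, ∃ q : {p : ℝ × ℝ // 0 < p.2 ∧ p.2 < p.1},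
      p.1.1 = q.1.1 + 2 * (q.1.2 * q.1.2) / (q.1.1 + q.1.2 + q.1.2) ∧
      p.1.2 = q.1.2 + 2 * (q.1.1 * q.1.2) / (q.1.1 + q.1.2 + q.1.2) := by
    rintro ⟨⟨r, s⟩, hs, hrs⟩
    obtain ⟨r', s', hs', hrs', h1, h2⟩ := exists_symmetric_preimage hs hrs
    exact ⟨⟨(r', s'), hs', hrs'⟩, h1, h2⟩
  choose F hF using hex
  let p₀ : {p : ℝ × ℝ // 0 < p.2 ∧ p.2 < p.1} :=
    ⟨(a₀ / (a₀ * b₀ + b₀ * b₀ + b₀ * a₀), b₀ / (a₀ * b₀ + b₀ * b₀ + b₀ * a₀)),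
      div_pos hb₀ hS, div_lt_div_of_pos_right hab hS⟩
  let p : ℕ → {p : ℝ × ℝ // 0 < p.2 ∧ p.2 < p.1} := fun n => F^[n] p₀
  have hp : ∀ n, p (n + 1) = F (p n) := fun n => Function.iterate_succ_apply' F n p₀
  have hrec : StarRecursion (fun n => (p n).1.1) (fun n => (p n).1.2) (fun n => (p n).1.2) :=
    { pos := fun n => ⟨(p n).2.1.trans (p n).2.2, (p n).2.1, (p n).2.1⟩
      rec_r := fun n => by rw [hp]; exact (hF _).1
      rec_s := fun n => by rw [hp]; exact (hF _).2
      rec_t := fun n => by rw [hp]; exact (hF _).2 }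
  exact ⟨_, _, _, hrec.isCompatible, star_involutive ha₀ hb₀ hb₀ a₀,
    star_involutive ha₀ hb₀ hb₀ b₀, star_involutive ha₀ hb₀ hb₀ b₀⟩

/-! ### The address map -/

/-- The three contractions of `[0, 1]` that correspond to `F₁, F₂, F₃` along the arc through
the points of `U_*`. -/
noncomputable def addrContr : Fin 3 → ℝ → ℝ :=
  ![fun t => (2 - t) / 3, fun t => t / 3, fun t => (2 + t) / 3]

theorem abs_addrContr_sub (i : Fin 3) (s t : ℝ) :
    |addrContr i s - addrContr i t| = |s - t| / 3 := by
  have h3 : |(3 : ℝ)| = 3 := abs_of_pos (by norm_num)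
  fin_cases i <;> simp only [addrContr, Fin.zero_eta, Fin.mk_one, Fin.reduceFinMk, Matrix.cons_val]
  · rw [abs_sub_comm s t, ← h3, ← abs_div, h3]; congr 1; ring
  · rw [← h3, ← abs_div, h3]; congr 1; ring
  · rw [← h3, ← abs_div, h3]; congr 1; ring

theorem addrContr_mem (i : Fin 3) {t : ℝ} (ht : t ∈ Set.Icc (0 : ℝ) 1) :
    addrContr i t ∈ Set.Icc (0 : ℝ) 1 := by
  obtain ⟨h0, h1⟩ := ht
  fin_cases i <;> constructor <;>
    simp only [addrContr, Fin.zero_eta, Fin.mk_one, Fin.reduceFinMk, Matrix.cons_val] <;> linarith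

theorem continuous_addrContr (i : Fin 3) : Continuous (addrContr i) := by
  fin_cases i <;>
    simp only [addrContr, Fin.zero_eta, Fin.mk_one, Fin.reduceFinMk, Matrix.cons_val] <;> fun_prop

/-- The index of a first-level cell containing a given point. -/
noncomputable def digit (z : ℂ) : Fin 3 :=
  if 1 / 2 ≤ bary 1 z then 1 else if 1 / 2 ≤ bary 2 z then 2 else 0

theorem half_le_bary_digit {z : ℂ} (hz : z ∈ tri) {i : Fin 3} (h : digit (contr i z) ≠ i) :
    1 / 2 ≤ bary (digit (contr i z)) (contr i z) := by
  have hi : 1 / 2 ≤ bary i (contr i z) := by rw [bary_contr_self]; linarith [hz i]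
  unfold digit at h ⊢
  split_ifs at h ⊢ with h1 h2
  · exact h1
  · exact h2
  · fin_cases i
    · exact absurd rfl h
    · exact absurd hi h1
    · exact absurd hi h2

/-- The choice made by `digit` can miss `i` only at a vertex shared by two first-level cells. -/
theorem contr_eq_of_digit_ne {z : ℂ} (hz : z ∈ tri) {i : Fin 3} (h : digit (contr i z) ≠ i) :
    z = corner (-(i + digit (contr i z))) := by
  have h1 := half_le_bary_digit hz h
  set j := digit (contr i z)
  rw [bary_contr_of_ne h.symm] at h1
  exact eq_corner_of_bary_eq_one hz (le_antisymm (bary_le_one hz _) (by linarith))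

/-- Approximations to the address. -/
noncomputable def addrApprox : ℕ → ℂ → ℝ
  | 0, _ => 1 / 2
  | n + 1, z => addrContr (digit z) (addrApprox n (Function.invFun (contr (digit z)) z))

theorem addrApprox_mem (n : ℕ) (z : ℂ) : addrApprox n z ∈ Set.Icc (0 : ℝ) 1 := by
  induction n generalizing z with
  | zero => constructor <;> norm_num [addrApprox]
  | succ n ih => exact addrContr_mem _ (ih _)

theorem dist_addrApprox (n : ℕ) (z : ℂ) :
    dist (addrApprox n z) (addrApprox (n + 1) z) ≤ 1 * (1 / 3) ^ n := by
  induction n generalizing z with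
  | zero =>
    obtain ⟨h0, h1⟩ := addrApprox_mem 1 z
    rw [Real.dist_eq, abs_le]
    simp only [addrApprox] at h0 h1 ⊢
    constructor <;> norm_num <;> linarith
  | succ n ih =>
    rw [Real.dist_eq]
    change |addrContr (digit z) _ - addrContr (digit z) _| ≤ _
    rw [abs_addrContr_sub, pow_succ]
    have := ih (Function.invFun (contr (digit z)) z)
    rw [Real.dist_eq] at this
    linarith

/-- The parameter of a point of `U_*` along the arc from `p₂` to `p₃` on which all of `U_*` lies. -/
noncomputable def addr (z : ℂ) : ℝ := limUnder atTop fun n => addrApprox n z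

theorem tendsto_addrApprox (z : ℂ) : Tendsto (fun n => addrApprox n z) atTop (𝓝 (addr z)) :=
  (cauchySeq_of_le_geometric (1 / 3) 1 (by norm_num) fun n => dist_addrApprox n z).tendsto_limUnder

theorem addr_mem (z : ℂ) : addr z ∈ Set.Icc (0 : ℝ) 1 :=
  isClosed_Icc.mem_of_tendsto (tendsto_addrApprox z) (Eventually.of_forall fun n =>
    addrApprox_mem n z)

theorem addr_eq (z : ℂ) :
    addr z = addrContr (digit z) (addr (Function.invFun (contr (digit z)) z)) := by
  have h1 := (tendsto_add_atTop_iff_nat 1).2 (tendsto_addrApprox z)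
  have h2 := ((continuous_addrContr (digit z)).tendsto _).comp
    (tendsto_addrApprox (Function.invFun (contr (digit z)) z))
  exact tendsto_nhds_unique h1 h2

theorem addr_of_digit_eq {z : ℂ} {i : Fin 3} (h : digit (contr i z) = i) :
    addr (contr i z) = addrContr i (addr z) := by
  rw [addr_eq, h, Function.leftInverse_invFun (contr_injective i)]

theorem digit_corner (i : Fin 3) : digit (corner i) = i := by
  fin_cases i <;> simp [digit, bary_corner] <;> norm_num

theorem addr_corner_fixed (i : Fin 3) : addr (corner i) = addrContr i (addr (corner i)) := by
  have h : digit (contr i (corner i)) = i := by rw [contr_corner, digit_corner]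
  have := addr_of_digit_eq h
  rwa [contr_corner] at this

theorem addr_corner_zero : addr (corner 0) = 1 / 2 := by
  have := addr_corner_fixed 0
  simp only [addrContr, Matrix.cons_val] at this
  linarith

theorem addr_corner_one : addr (corner 1) = 0 := by
  have := addr_corner_fixed 1
  simp only [addrContr, Matrix.cons_val] at this
  linarith

theorem addr_corner_two : addr (corner 2) = 1 := by
  have := addr_corner_fixed 2
  simp only [addrContr, Matrix.cons_val] at this
  linarith

/-- At shared vertices of types `p₂`, `p₃` the two candidate addresses agree, being the common
endpoint of neighbouring thirds. At `mid` they are `1/6` and `5/6`; the hypothesis keeps clear of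
this ambiguity. -/
theorem addr_contr {z : ℂ} (hz : z ∈ tri) {i : Fin 3} (h : i = 0 ∨ z ≠ corner 0) :
    addr (contr i z) = addrContr i (addr z) := by
  by_cases hd : digit (contr i z) = i
  · exact addr_of_digit_eq hd
  · have hzc := contr_eq_of_digit_ne hz hd
    set j := digit (contr i z) with hj
    have hji : j ≠ i := hd
    have hcz : contr i z = contr j z := by
      rw [hzc]; exact contr_corner_third hji.symm
    have h1 : addr (contr i z) = addrContr j (addr z) := by
      rw [hcz]
      exact addr_of_digit_eq (by rw [← hcz])
    rw [h1, hzc]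
    rw [hzc] at h
    clear_value j
    clear hj hd h1 hcz hzc
    fin_cases i <;> fin_cases j <;> first | exact absurd rfl hji | skip
    all_goals
      simp only [Fin.zero_eta, Fin.mk_one, Fin.reduceFinMk, Fin.reduceAdd, neg_zero, zero_add,
        add_zero, show (-1 : Fin 3) = 2 from rfl, show (-2 : Fin 3) = 1 from rfl,
        addr_corner_one, addr_corner_two, addrContr, Matrix.cons_val] at h ⊢
      first | (norm_num; done) | simp at h

/-- The sign of `d` records how often the reversing map `F₁` occurs in `ω`. -/
theorem addr_cellMap (ω : List (Fin 3)) : ∃ c d : ℝ, |d| = (1 / 3) ^ ω.length ∧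
    ∀ z ∈ UStar, addr (cellMap ω z) = c + d * addr z := by
  induction ω with
  | nil => exact ⟨0, 1, by simp, fun z _ => by simp [cellMap]⟩
  | cons i ω ih =>
    obtain ⟨c, d, hd, h⟩ := ih
    have key : ∀ z ∈ UStar, addr (cellMap (i :: ω) z) = addrContr i (c + d * addr z) := by
      intro z hz
      have hU : cellMap ω z ∈ UStar := cellMap_mem_levels hz ω
      rw [← h z hz]
      exact addr_contr (uStar_subset_tri hU) (Or.inr fun he =>
        Set.disjoint_left.1 disjoint_uStar_wStar hU (he ▸ corner_zero_mem_wStar))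
    fin_cases i
    · refine ⟨(2 - c) / 3, -d / 3, ?_, fun z hz => ?_⟩
      · rw [abs_div, abs_neg, hd, List.length_cons, pow_succ]; norm_num; ring
      · rw [key z hz]; simp [addrContr]; ring
    · refine ⟨c / 3, d / 3, ?_, fun z hz => ?_⟩
      · rw [abs_div, hd, List.length_cons, pow_succ]; norm_num; ring
      · rw [key z hz]; simp [addrContr]; ring
    · refine ⟨(2 + c) / 3, d / 3, ?_, fun z hz => ?_⟩
      · rw [abs_div, hd, List.length_cons, pow_succ]; norm_num; ring
      · rw [key z hz]; simp [addrContr]; ring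

theorem ne_corner_zero {z : ℂ} (hz : z ∈ UStar) : z ≠ corner 0 := fun he =>
  Set.disjoint_left.1 disjoint_uStar_wStar hz (he ▸ corner_zero_mem_wStar)

theorem addr_contr_of_mem {z : ℂ} (hz : z ∈ UStar) (i : Fin 3) :
    addr (contr i z) = addrContr i (addr z) :=
  addr_contr (uStar_subset_tri hz) (Or.inr (ne_corner_zero hz))

/-! ### The two parts of the energy -/

/-- The part of the energy on the edges between points of `U_*`. -/
noncomputable def arcEnergy (n : ℕ) (u : ℂ → ℝ) : ℝ :=
  wordSum (fun v => (v (corner 1) - v (corner 2)) ^ 2) n u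

/-- The part of the energy on the edges that end at points of `W_*`. -/
noncomputable def bridgeEnergy (n : ℕ) (u : ℂ → ℝ) : ℝ :=
  wordSum (fun v => (v (corner 0) - v (corner 2)) ^ 2 + (v (corner 0) - v (corner 1)) ^ 2) n u

theorem arcEnergy_succ (n : ℕ) (u : ℂ → ℝ) : arcEnergy (n + 1) u
    = arcEnergy n (u ∘ contr 0) + arcEnergy n (u ∘ contr 1) + arcEnergy n (u ∘ contr 2) := by
  simp only [arcEnergy, wordSum, Fin.sum_univ_three]

theorem bridgeEnergy_succ (n : ℕ) (u : ℂ → ℝ) : bridgeEnergy (n + 1) u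
    = bridgeEnergy n (u ∘ contr 0) + bridgeEnergy n (u ∘ contr 1) + bridgeEnergy n (u ∘ contr 2) := by
  simp only [bridgeEnergy, wordSum, Fin.sum_univ_three]

theorem arcEnergy_nonneg (n : ℕ) (u : ℂ → ℝ) : 0 ≤ arcEnergy n u :=
  wordSum_nonneg (fun _ => by positivity) n u

theorem bridgeEnergy_nonneg (n : ℕ) (u : ℂ → ℝ) : 0 ≤ bridgeEnergy n u :=
  wordSum_nonneg (fun _ => by positivity) n u

/-- `g` is monotone or antitone on `[0, 1]`, expressed by additivity of its variation, and
Lipschitz with constant `l` there. -/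
structure MonoLip (g : ℝ → ℝ) (l : ℝ) : Prop where
  add : ∀ x y z, 0 ≤ x → x ≤ y → y ≤ z → z ≤ 1 → |g x - g y| + |g y - g z| = |g x - g z|
  lip : ∀ x ∈ Set.Icc (0 : ℝ) 1, ∀ y ∈ Set.Icc (0 : ℝ) 1, |g x - g y| ≤ l * |x - y|

theorem MonoLip.comp {g : ℝ → ℝ} {l : ℝ} (h : MonoLip g l) (i : Fin 3) :
    MonoLip (g ∘ addrContr i) (l / 3) where
  add x y z hx hxy hyz hz := by
    fin_cases i <;>
      simp only [addrContr, Fin.zero_eta, Fin.mk_one, Fin.reduceFinMk, Matrix.cons_val,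
        Function.comp_apply]
    -- `addrContr 0` reverses the order, so additivity is applied to the reversed triple.
    · have := h.add ((2 - z) / 3) ((2 - y) / 3) ((2 - x) / 3) (by linarith) (by linarith)
        (by linarith) (by linarith)
      rw [abs_sub_comm (g ((2 - z) / 3)) (g ((2 - y) / 3)),
        abs_sub_comm (g ((2 - z) / 3)) (g ((2 - x) / 3)),
        abs_sub_comm (g ((2 - y) / 3)) (g ((2 - x) / 3))] at this
      linarith
    · exact h.add _ _ _ (by linarith) (by linarith) (by linarith) (by linarith)
    · exact h.add _ _ _ (by linarith) (by linarith) (by linarith) (by linarith)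
  lip x hx y hy := by
    refine (h.lip _ (addrContr_mem i hx) _ (addrContr_mem i hy)).trans ?_
    rw [abs_addrContr_sub]
    linarith

theorem MonoLip.sum_comp {g : ℝ → ℝ} {l : ℝ} (h : MonoLip g l) :
    |(g ∘ addrContr 0) 0 - (g ∘ addrContr 0) 1| + |(g ∘ addrContr 1) 0 - (g ∘ addrContr 1) 1|
      + |(g ∘ addrContr 2) 0 - (g ∘ addrContr 2) 1| = |g 0 - g 1| := by
  have h1 := h.add 0 (1 / 3) (2 / 3) (by norm_num) (by norm_num) (by norm_num) (by norm_num)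
  have h2 := h.add 0 (2 / 3) 1 (by norm_num) (by norm_num) (by norm_num) (by norm_num)
  simp only [addrContr, Matrix.cons_val, Function.comp_apply]
  norm_num at h1 h2 ⊢
  rw [abs_sub_comm (g (2 / 3))]
  linarith

theorem MonoLip.variation_le {g : ℝ → ℝ} {l : ℝ} (h : MonoLip g l) : |g 0 - g 1| ≤ l := by
  simpa using h.lip 0 (by simp) 1 (by simp)

theorem MonoLip.abs_sub_le {g : ℝ → ℝ} {l : ℝ} (h : MonoLip g l) {x y : ℝ}
    (hx : x ∈ Set.Icc (0 : ℝ) 1) (hy : y ∈ Set.Icc (0 : ℝ) 1) : |g x - g y| ≤ |g 0 - g 1| := by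
  wlog hxy : x ≤ y generalizing x y
  · rw [abs_sub_comm]; exact this hy hx (le_of_not_ge hxy)
  have h1 := h.add 0 x y le_rfl hx.1 hxy hy.2
  have h2 := h.add 0 y 1 le_rfl hy.1 hy.2 le_rfl
  linarith [abs_nonneg (g 0 - g x), abs_nonneg (g y - g 1)]

/-- Each increment over an edge of level `n` is at most `l · 3⁻ⁿ`, and the absolute increments add
up to `|g 0 - g 1|`. -/
theorem arcEnergy_le {g : ℝ → ℝ} {l : ℝ} (hg : MonoLip g l) {u : ℂ → ℝ}
    (hu : ∀ z ∈ UStar, u z = g (addr z)) (n : ℕ) :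
    arcEnergy n u ≤ l * |g 0 - g 1| * (1 / 3) ^ n := by
  induction n generalizing g l u with
  | zero =>
    rw [arcEnergy, wordSum, hu _ corner_one_mem_uStar, hu _ corner_two_mem_uStar,
      addr_corner_one, addr_corner_two, pow_zero, mul_one, ← sq_abs, sq]
    exact mul_le_mul_of_nonneg_right hg.variation_le (abs_nonneg _)
  | succ n ih =>
    have key : ∀ i, arcEnergy n (u ∘ contr i)
        ≤ l / 3 * |(g ∘ addrContr i) 0 - (g ∘ addrContr i) 1| * (1 / 3) ^ n := fun i =>
      ih (hg.comp i) fun z hz => by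
        rw [Function.comp_apply, hu _ (contr_mem_levels hz i), addr_contr_of_mem hz]
        rfl
    rw [arcEnergy_succ, ← hg.sum_comp]
    refine (add_le_add (add_le_add (key 0) (key 1)) (key 2)).trans_eq ?_
    ring

/-- The value at `corner 0` is kept free because the value at `mid` cannot match the addresses in
both adjacent cells; only its distance `m` from the values of `g` matters. Write `V = |g 0 - g 1|`.
The constant `6` is `2 + 4`: the three cells contribute `6 (l/3) V` in total, and the two cells at
`mid`, with `m = V`, add `2V² ≤ 2lV` each. -/
theorem bridgeEnergy_le {g : ℝ → ℝ} {l : ℝ} (hg : MonoLip g l) {u : ℂ → ℝ}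
    (hu : ∀ z ∈ VStar, z ≠ corner 0 → u z = g (addr z)) {m : ℝ}
    (hm : ∀ t ∈ Set.Icc (0 : ℝ) 1, |u (corner 0) - g t| ≤ m) (n : ℕ) :
    bridgeEnergy n u ≤ 6 * l * |g 0 - g 1| + 2 * m ^ 2 := by
  induction n generalizing g l u m with
  | zero =>
    rw [bridgeEnergy, wordSum, hu _ (corner_mem_vStar 1) (corner_injective.ne (by decide)),
      hu _ (corner_mem_vStar 2) (corner_injective.ne (by decide)), addr_corner_one,
      addr_corner_two]
    have h0 := sq_le_sq' (abs_le.1 (hm 0 (by simp))).1 (abs_le.1 (hm 0 (by simp))).2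
    have h1 := sq_le_sq' (abs_le.1 (hm 1 (by simp))).1 (abs_le.1 (hm 1 (by simp))).2
    have : 0 ≤ l := (abs_nonneg _).trans hg.variation_le
    have : 0 ≤ 6 * l * |g 0 - g 1| := by positivity
    linarith
  | succ n ih =>
    have hu' : ∀ i, ∀ z ∈ VStar, z ≠ corner 0 → (u ∘ contr i) z = (g ∘ addrContr i) (addr z) := by
      intro i z hz hz0
      have hne : contr i z ≠ corner 0 := fun h =>
        hz0 (eq_of_contr_eq_corner (vStar_subset_tri hz) h).2
      rw [Function.comp_apply, hu _ (contr_mem_levels hz i) hne,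
        addr_contr (vStar_subset_tri hz) (Or.inr hz0)]
      rfl
    have k0 := ih (hg.comp 0) (hu' 0) (m := m) fun t ht => by
      rw [Function.comp_apply, contr_corner]
      exact hm _ (addrContr_mem 0 ht)
    have hmid : ∀ i, i ≠ 0 → ∀ t ∈ Set.Icc (0 : ℝ) 1,
        |(u ∘ contr i) (corner 0) - (g ∘ addrContr i) t| ≤ |g 0 - g 1| := by
      intro i hi t ht
      rw [Function.comp_apply, hu _ (contr_mem_levels (corner_mem_vStar 0) i)
        (contr_ne_corner (corner_mem_tri 0) hi)]
      exact hg.abs_sub_le (addr_mem _) (addrContr_mem i ht)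
    have k1 := ih (hg.comp 1) (hu' 1) (hmid 1 (by decide))
    have k2 := ih (hg.comp 2) (hu' 2) (hmid 2 (by decide))
    have hs := hg.sum_comp
    rw [bridgeEnergy_succ]
    have hV : |g 0 - g 1| ^ 2 ≤ l * |g 0 - g 1| := by
      rw [sq]; exact mul_le_mul_of_nonneg_right hg.variation_le (abs_nonneg _)
    have hl : 2 * l * (|(g ∘ addrContr 0) 0 - (g ∘ addrContr 0) 1|
        + |(g ∘ addrContr 1) 0 - (g ∘ addrContr 1) 1|
        + |(g ∘ addrContr 2) 0 - (g ∘ addrContr 2) 1|) = 2 * l * |g 0 - g 1| := by rw [hs]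
    linarith

theorem monoLip_clamp (p q : ℝ) : MonoLip (fun t => max p (min q t)) 1 where
  add x y z _ hxy hyz _ := by
    have hm : Monotone fun t : ℝ => max p (min q t) := fun s t hst =>
      max_le_max le_rfl (min_le_min le_rfl hst)
    rw [abs_sub_comm, abs_of_nonneg (sub_nonneg.2 (hm hxy)), abs_sub_comm (max p (min q y)),
      abs_of_nonneg (sub_nonneg.2 (hm hyz)), abs_sub_comm,
      abs_of_nonneg (sub_nonneg.2 (hm (hxy.trans hyz)))]
    ring
  lip x _ y _ := by
    rw [one_mul]
    exact (abs_max_sub_max_le_max _ _ _ _).trans (max_le (by simp)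
      ((abs_min_sub_min_le_max _ _ _ _).trans (max_le (by simp) le_rfl)))

/-- Cauchy-Schwarz for two pieces in series, with lengths `d₁, d₂` and energies `e₁, e₂`. -/
theorem sq_sub_le_of_chain {p q r d₁ d₂ e₁ e₂ : ℝ} (hd₁ : 0 ≤ d₁) (hd₂ : 0 ≤ d₂) (he₁ : 0 ≤ e₁)
    (he₂ : 0 ≤ e₂) (h₁ : (p - q) ^ 2 ≤ d₁ * e₁) (h₂ : (q - r) ^ 2 ≤ d₂ * e₂) :
    (p - r) ^ 2 ≤ (d₁ + d₂) * (e₁ + e₂) := by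
  have h1 : |p - q| ≤ √d₁ * √e₁ := by
    rw [← Real.sqrt_mul hd₁]; exact Real.abs_le_sqrt h₁
  have h2 : |q - r| ≤ √d₂ * √e₂ := by
    rw [← Real.sqrt_mul hd₂]; exact Real.abs_le_sqrt h₂
  have h3 : |p - r| ≤ √d₁ * √e₁ + √d₂ * √e₂ := (abs_sub_le p q r).trans (add_le_add h1 h2)
  have h4 : (p - r) ^ 2 ≤ (√d₁ * √e₁ + √d₂ * √e₂) ^ 2 := by
    rw [← sq_abs (p - r)]; exact pow_le_pow_left₀ (abs_nonneg _) h3 2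
  have a1 := Real.sq_sqrt hd₁
  have a2 := Real.sq_sqrt hd₂
  have a3 := Real.sq_sqrt he₁
  have a4 := Real.sq_sqrt he₂
  nlinarith [sq_nonneg (√d₁ * √e₂ - √d₂ * √e₁)]

/-- Cauchy-Schwarz along the arc. -/
theorem sq_sub_le_arcEnergy (n : ℕ) (u : ℂ → ℝ) {x y : ℂ} (hx : x ∈ U n) (hy : y ∈ U n) :
    (u x - u y) ^ 2 ≤ |addr x - addr y| * (3 ^ n * arcEnergy n u) := by
  induction n generalizing u x y with
  | zero =>
    rw [arcEnergy, wordSum]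
    rcases hx with rfl | rfl <;> rcases hy with rfl | rfl <;>
      simp [addr_corner_one, addr_corner_two]
    rw [sub_sq_comm]
  | succ n ih =>
    obtain ⟨i, x', hx', rfl⟩ := Set.mem_iUnion.1 hx
    obtain ⟨j, y', hy', rfl⟩ := Set.mem_iUnion.1 hy
    clear hx hy
    rename' x' => x, y' => y, hx' => hx, hy' => hy
    set e : Fin 3 → ℝ := fun i => 3 ^ (n + 1) * arcEnergy n (u ∘ contr i) with he
    have he0 : ∀ i, 0 ≤ e i := fun i => mul_nonneg (by positivity) (arcEnergy_nonneg _ _)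
    have hsum : 3 ^ (n + 1) * arcEnergy (n + 1) u = e 0 + e 1 + e 2 := by
      rw [arcEnergy_succ]; simp only [he]; ring
    have hmem : ∀ {z}, z ∈ U n → z ∈ UStar := fun hz => Set.mem_iUnion.2 ⟨n, hz⟩
    have hin : ∀ i, ∀ z ∈ U n, ∀ w ∈ U n, (u (contr i z) - u (contr i w)) ^ 2
        ≤ |addr (contr i z) - addr (contr i w)| * e i := by
      intro i z hz w hw
      have := ih (u ∘ contr i) hz hw
      rw [addr_contr_of_mem (hmem hz), addr_contr_of_mem (hmem hw), abs_addrContr_sub]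
      refine this.trans_eq ?_
      simp only [he]; ring
    have h1U : corner 1 ∈ U n := level_mono uZero_subset (Nat.zero_le n) (Or.inl rfl)
    have h2U : corner 2 ∈ U n := level_mono uZero_subset (Nat.zero_le n) (Or.inr rfl)
    have p : ∀ i, ∀ z ∈ U n, addr (contr i z) = addrContr i (addr z) := fun i z hz =>
      addr_contr_of_mem (hmem hz) i
    -- The arc runs through the cells `1, 0, 2`, joined at these two points, with addresses `1/3`
    -- and `2/3`. Splitting there makes address lengths and energies add.
    have q01 : contr 0 (corner 2) = contr 1 (corner 2) :=
      contr_corner_third (i := 0) (j := 1) (by decide)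
    have q02 : contr 0 (corner 1) = contr 2 (corner 1) :=
      contr_corner_third (i := 0) (j := 2) (by decide)
    have h10 : ∀ z ∈ U n, ∀ w ∈ U n, (u (contr 1 z) - u (contr 0 w)) ^ 2
        ≤ |addr (contr 1 z) - addr (contr 0 w)| * (e 0 + e 1 + e 2) := by
      intro z hz w hw
      have a1 := hin 1 z hz _ h2U
      have a2 := hin 0 _ h2U w hw
      rw [← q01] at a1
      refine (sq_sub_le_of_chain (abs_nonneg _) (abs_nonneg _) (he0 _) (he0 _) a1 a2).trans ?_
      have hz' := addr_mem z
      have hw' := addr_mem w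
      have : |addr (contr 1 z) - addr (contr 0 (corner 2))|
          + |addr (contr 0 (corner 2)) - addr (contr 0 w)|
          = |addr (contr 1 z) - addr (contr 0 w)| := by
        simp only [p _ _ hz, p _ _ hw, p _ _ h2U, addr_corner_two, addrContr, Matrix.cons_val]
        rw [abs_of_nonpos (by linarith [hz'.2]), abs_of_nonpos (by linarith [hw'.2]),
          abs_of_nonpos (by linarith [hz'.2, hw'.2])]
        ring
      rw [this]
      exact mul_le_mul_of_nonneg_left (by linarith [he0 2]) (abs_nonneg _)
    have h02 : ∀ z ∈ U n, ∀ w ∈ U n, (u (contr 0 z) - u (contr 2 w)) ^ 2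
        ≤ |addr (contr 0 z) - addr (contr 2 w)| * (e 0 + e 1 + e 2) := by
      intro z hz w hw
      have a1 := hin 0 z hz _ h1U
      have a2 := hin 2 _ h1U w hw
      rw [← q02] at a2
      refine (sq_sub_le_of_chain (abs_nonneg _) (abs_nonneg _) (he0 _) (he0 _) a1 a2).trans ?_
      have hz' := addr_mem z
      have hw' := addr_mem w
      have : |addr (contr 0 z) - addr (contr 0 (corner 1))|
          + |addr (contr 0 (corner 1)) - addr (contr 2 w)|
          = |addr (contr 0 z) - addr (contr 2 w)| := by
        simp only [p _ _ hz, p _ _ hw, p _ _ h1U, addr_corner_one, addrContr, Matrix.cons_val]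
        rw [abs_of_nonpos (by linarith [hz'.1]), abs_of_nonpos (by linarith [hw'.1]),
          abs_of_nonpos (by linarith [hz'.1, hw'.1])]
        ring
      rw [this]
      exact mul_le_mul_of_nonneg_left (by linarith [he0 1]) (abs_nonneg _)
    have h12 : ∀ z ∈ U n, ∀ w ∈ U n, (u (contr 1 z) - u (contr 2 w)) ^ 2
        ≤ |addr (contr 1 z) - addr (contr 2 w)| * (e 0 + e 1 + e 2) := by
      intro z hz w hw
      have a1 := hin 1 z hz _ h2U
      have a2 := hin 0 _ h2U _ h1U
      have a3 := hin 2 _ h1U w hw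
      rw [← q01] at a1
      rw [← q02] at a3
      have a12 := sq_sub_le_of_chain (abs_nonneg _) (abs_nonneg _) (he0 _) (he0 _) a1 a2
      refine (sq_sub_le_of_chain (add_nonneg (abs_nonneg _) (abs_nonneg _)) (abs_nonneg _)
        (add_nonneg (he0 _) (he0 _)) (he0 _) a12 a3).trans_eq ?_
      have hz' := addr_mem z
      have hw' := addr_mem w
      have : |addr (contr 1 z) - addr (contr 0 (corner 2))|
          + |addr (contr 0 (corner 2)) - addr (contr 0 (corner 1))|
          + |addr (contr 0 (corner 1)) - addr (contr 2 w)|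
          = |addr (contr 1 z) - addr (contr 2 w)| := by
        simp only [p _ _ hz, p _ _ hw, p _ _ h1U, p _ _ h2U, addr_corner_one, addr_corner_two,
          addrContr, Matrix.cons_val]
        rw [abs_of_nonpos (by linarith [hz'.2]), abs_of_nonpos (by linarith),
          abs_of_nonpos (by linarith [hw'.1]), abs_of_nonpos (by linarith [hz'.2, hw'.1])]
        ring
      rw [this]
      ring
    rw [hsum]
    by_cases hij : i = j
    · subst hij
      refine (hin i x hx y hy).trans (mul_le_mul_of_nonneg_left ?_ (abs_nonneg _))
      have := he0 0
      have := he0 1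
      have := he0 2
      fin_cases i <;> simp only [Fin.zero_eta, Fin.mk_one, Fin.reduceFinMk] <;> linarith
    · fin_cases i <;> fin_cases j <;> first | exact absurd rfl hij | skip
      · have := h10 y hy x hx; rw [sub_sq_comm, abs_sub_comm] at this; exact this
      · exact h02 x hx y hy
      · exact h10 x hx y hy
      · exact h12 x hx y hy
      · have := h02 y hy x hx; rw [sub_sq_comm, abs_sub_comm] at this; exact this
      · have := h12 y hy x hx; rw [sub_sq_comm, abs_sub_comm] at this; exact this

/-- Every point of `Wₙ` is joined by an edge to a point of `Uₙ`. -/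
theorem exists_sq_sub_le_bridgeEnergy (n : ℕ) {x : ℂ} (hx : x ∈ W n) :
    ∃ y ∈ U n, ∀ u : ℂ → ℝ, (u x - u y) ^ 2 ≤ bridgeEnergy n u := by
  induction n generalizing x with
  | zero =>
    refine ⟨corner 1, Or.inl rfl, fun u => ?_⟩
    obtain rfl : x = corner 0 := hx
    rw [bridgeEnergy, wordSum]
    linarith [sq_nonneg (u (corner 0) - u (corner 2))]
  | succ n ih =>
    obtain ⟨i, x, hx', rfl⟩ := Set.mem_iUnion.1 hx
    obtain ⟨y, hy, h⟩ := ih hx'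
    refine ⟨contr i y, contr_mem_level hy i, fun u => (h (u ∘ contr i)).trans ?_⟩
    rw [bridgeEnergy_succ]
    have := bridgeEnergy_nonneg n (u ∘ contr 0)
    have := bridgeEnergy_nonneg n (u ∘ contr 1)
    have := bridgeEnergy_nonneg n (u ∘ contr 2)
    fin_cases i <;> simp only [Fin.zero_eta, Fin.mk_one, Fin.reduceFinMk] <;> linarith

/-! ### Functions supported at a point of `W_*` -/

theorem energy_eq_zero_of_forall {u : ℂ → ℝ} (hu : ∀ z ∈ VStar, u z = 0) (n : ℕ) :
    arcEnergy n u = 0 ∧ bridgeEnergy n u = 0 := by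
  have h : ∀ (ω : List (Fin 3)) k, (u ∘ cellMap ω) (corner k) = 0 := fun ω k =>
    hu _ (cellMap_mem_levels (corner_mem_vStar k) ω)
  constructor
  · rw [arcEnergy, ← mul_zero ((3 : ℝ) ^ n), ← wordSum_const 0 n u]
    exact wordSum_congr fun ω _ => by simp only [h]; norm_num
  · rw [bridgeEnergy, ← mul_zero ((3 : ℝ) ^ n), ← wordSum_const 0 n u]
    exact wordSum_congr fun ω _ => by simp only [h]; norm_num

theorem energy_le_of_support_corner_zero {u : ℂ → ℝ} (hu : ∀ z ∈ VStar, z ≠ corner 0 → u z = 0)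
    (h1 : u (corner 0) ^ 2 ≤ 1) (n : ℕ) : arcEnergy n u = 0 ∧ bridgeEnergy n u ≤ 2 := by
  induction n generalizing u with
  | zero =>
    have e1 := hu _ (corner_mem_vStar 1) (corner_injective.ne (by decide))
    have e2 := hu _ (corner_mem_vStar 2) (corner_injective.ne (by decide))
    simp only [arcEnergy, bridgeEnergy, wordSum, e1, e2, sub_zero]
    exact ⟨by norm_num, by linarith⟩
  | succ n ih =>
    obtain ⟨a0, b0⟩ := ih (u := u ∘ contr 0)
      (fun z hz hz0 => hu _ (contr_mem_levels hz 0) fun h =>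
        hz0 (eq_of_contr_eq_corner (vStar_subset_tri hz) h).2)
      (by rw [Function.comp_apply, contr_corner]; exact h1)
    have hz : ∀ i, i ≠ 0 → ∀ z ∈ VStar, (u ∘ contr i) z = 0 := fun i hi z hz =>
      hu _ (contr_mem_levels hz i) (contr_ne_corner (vStar_subset_tri hz) hi)
    obtain ⟨a1, b1⟩ := energy_eq_zero_of_forall (hz 1 (by decide)) n
    obtain ⟨a2, b2⟩ := energy_eq_zero_of_forall (hz 2 (by decide)) n
    rw [arcEnergy_succ, bridgeEnergy_succ, a0, a1, a2, b1, b2]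
    exact ⟨by norm_num, by linarith⟩

/-- At each level a point of `W_*` lies in at most two cells and has two bridge edges in each: at
most four bridges and no arc edge, whatever `n` is. -/
theorem energy_le_of_support {u : ℂ → ℝ} {q : ℂ} (hq : q ∈ WStar)
    (hu : ∀ z ∈ VStar, z ≠ q → u z = 0) (h1 : u q ^ 2 ≤ 1) (n : ℕ) :
    arcEnergy n u = 0 ∧ bridgeEnergy n u ≤ 4 := by
  induction n generalizing u q with
  | zero =>
    have hU : ∀ z ∈ UStar, u z = 0 := fun z hz => hu z (uStar_subset_vStar hz) fun h =>
      Set.disjoint_left.1 disjoint_uStar_wStar hz (h ▸ hq)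
    have h0 : u (corner 0) ^ 2 ≤ 1 := by
      by_cases h : corner 0 = q
      · rw [h]; exact h1
      · rw [hu _ (corner_mem_vStar 0) h]; norm_num
    simp only [arcEnergy, bridgeEnergy, wordSum, hU _ corner_one_mem_uStar,
      hU _ corner_two_mem_uStar, sub_zero]
    exact ⟨by norm_num, by linarith⟩
  | succ n ih =>
    obtain ⟨j, w, hw, rfl⟩ := exists_eq_contr wZero_subset hq
    have hwT : w ∈ tri := vStar_subset_tri (wStar_subset_vStar hw)
    have hother : ∀ i, i ≠ j → (w ≠ corner 0 ∨ i = 0 ∨ j = 0) →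
        ∀ z ∈ VStar, (u ∘ contr i) z = 0 := by
      intro i hij h z hz
      refine hu _ (contr_mem_levels hz i) fun he => ?_
      have hc := (eq_corner_of_contr_eq (vStar_subset_tri hz) hwT hij he).2
      have hk : corner (-(i + j)) = corner 0 :=
        corner_mem_of_mem_levels wZero_subset (hc ▸ hw)
      have hk0 := corner_injective hk
      rw [hk] at hc
      have : ∀ i j : Fin 3, i ≠ j → -(i + j) = 0 → i ≠ 0 ∧ j ≠ 0 := by decide
      have := this i j hij hk0
      rcases h with h | h | h
      · exact h hc
      · exact this.1 h
      · exact this.2 h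
    have hin : arcEnergy n (u ∘ contr j) = 0 ∧ bridgeEnergy n (u ∘ contr j) ≤ 4 :=
      ih hw (fun z hz hzw => hu _ (contr_mem_levels hz j) ((contr_injective j).ne hzw)) h1
    rw [arcEnergy_succ, bridgeEnergy_succ]
    -- Two first-level cells share the point only if it is `mid`, where each of the cells `1`, `2`
    -- contributes at most `2`; otherwise a single cell carries everything.
    by_cases hw0 : w = corner 0
    · have hin' : ∀ i, contr i w = contr j w →
          arcEnergy n (u ∘ contr i) = 0 ∧ bridgeEnergy n (u ∘ contr i) ≤ 2 := by
        intro i hi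
        rw [← hi] at hu h1
        subst hw0
        exact energy_le_of_support_corner_zero
          (fun z hz hzw => hu _ (contr_mem_levels hz i) ((contr_injective i).ne hzw)) h1 n
      by_cases hj : j = 0
      · subst hj
        obtain ⟨a1, b1⟩ := energy_eq_zero_of_forall
          (hother 1 (by decide) (Or.inr (Or.inr rfl))) n
        obtain ⟨a2, b2⟩ := energy_eq_zero_of_forall
          (hother 2 (by decide) (Or.inr (Or.inr rfl))) n
        rw [a1, a2, b1, b2, hin.1]
        exact ⟨by norm_num, by linarith [hin.2]⟩
      · obtain ⟨a0, b0⟩ := energy_eq_zero_of_forall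
          (hother 0 (Ne.symm hj) (Or.inr (Or.inl rfl))) n
        have e : contr 1 w = contr 2 w := by rw [hw0, contr_two_corner_zero]; rfl
        have e1 : contr 1 w = contr j w := by
          fin_cases j
          · exact absurd rfl hj
          · rfl
          · exact e
        obtain ⟨a1, b1⟩ := hin' 1 e1
        obtain ⟨a2, b2⟩ := hin' 2 (e.symm.trans e1)
        rw [a0, a1, a2, b0]
        exact ⟨by norm_num, by linarith⟩
    · have hz := fun i hi => energy_eq_zero_of_forall (hother i hi (Or.inl hw0)) n
      fin_cases j
      · rw [(hz 1 (by decide)).1, (hz 1 (by decide)).2, (hz 2 (by decide)).1,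
          (hz 2 (by decide)).2]
        exact ⟨by simpa using hin.1, by simpa using hin.2⟩
      · rw [(hz 0 (by decide)).1, (hz 0 (by decide)).2, (hz 2 (by decide)).1,
          (hz 2 (by decide)).2]
        exact ⟨by simpa using hin.1, by simpa using hin.2⟩
      · rw [(hz 0 (by decide)).1, (hz 0 (by decide)).2, (hz 1 (by decide)).1,
          (hz 1 (by decide)).2]
        exact ⟨by simpa using hin.1, by simpa using hin.2⟩

/-! ### Effective resistance -/

theorem IsCompatible.energyAt_mono {a b c : ℕ → ℝ} (h : IsCompatible a b c) (u : ℂ → ℝ) :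
    Monotone fun n => energyAt a b c n u :=
  monotone_nat_of_le_succ fun n => (h.trace n u).2 ⟨u, fun _ _ => rfl, rfl⟩

theorem IsCompatible.cellEnergy_nonneg {a b c : ℕ → ℝ} (h : IsCompatible a b c) (n : ℕ)
    (u : ℂ → ℝ) : 0 ≤ cellEnergy (a n) (b n) (c n) u := by
  obtain ⟨ha, hb, hc⟩ := h.pos n
  unfold cellEnergy
  positivity

theorem IsCompatible.energyAt_nonneg {a b c : ℕ → ℝ} (h : IsCompatible a b c) (n : ℕ)
    (u : ℂ → ℝ) : 0 ≤ energyAt a b c n u := by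
  rw [energyAt_eq]
  exact wordSum_nonneg (h.cellEnergy_nonneg n) n u

theorem Controlled.energyAt_eq {a b c : ℕ → ℝ} {K : ℝ} (h : Controlled a b c K) (n : ℕ)
    (u : ℂ → ℝ) : energyAt a b c n u = a n * arcEnergy n u + b n * bridgeEnergy n u := by
  rw [TwistedSG.energyAt_eq, arcEnergy, bridgeEnergy, ← wordSum_mul, ← wordSum_mul, ← wordSum_add]
  refine wordSum_congr fun ω _ => ?_
  rw [cellEnergy, h.symm n]
  ring

theorem energyAt_affine (a b c : ℕ → ℝ) (n : ℕ) (u : ℂ → ℝ) (k d : ℝ) :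
    energyAt a b c n (fun z => (u z - k) / d) = energyAt a b c n u / d ^ 2 := by
  rw [energyAt_eq, energyAt_eq, div_eq_inv_mul, ← wordSum_mul]
  refine wordSum_congr fun ω _ => ?_
  simp only [cellEnergy, Function.comp_apply]
  have h : ∀ p q : ℝ, ((p - k) / d - (q - k) / d) ^ 2 = (d ^ 2)⁻¹ * (p - q) ^ 2 := fun p q => by
    rw [← sub_div, div_pow, div_eq_inv_mul]; ring
  rw [h, h, h]
  ring

/-- The inequality `(u x - u y)² ≤ M ℰ(u)` for all `u`. -/
def ResBound (a b c : ℕ → ℝ) (x y : ℂ) (M : ℝ) : Prop :=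
  0 ≤ M ∧ ∀ (u : ℂ → ℝ) (e : ℝ), (∀ n, energyAt a b c n u ≤ e) → (u x - u y) ^ 2 ≤ M * e

theorem energy_le {a b c : ℕ → ℝ} {u : ℂ → ℝ} {e : ℝ} (h : ∀ n, energyAt a b c n u ≤ e) :
    energy a b c u ≤ ENNReal.ofReal e := iSup_le fun n => ENNReal.ofReal_le_ofReal (h n)

theorem le_toReal_energy {a b c : ℕ → ℝ} {u : ℂ → ℝ} (h : energy a b c u ≠ ⊤) (n : ℕ) :
    energyAt a b c n u ≤ (energy a b c u).toReal :=
  (ENNReal.ofReal_le_iff_le_toReal h).1 (le_iSup (fun n => ENNReal.ofReal (energyAt a b c n u)) n)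

theorem ResBound.inv_conductance_le {a b c : ℕ → ℝ} {x y : ℂ} {M : ℝ}
    (h : ResBound a b c x y M) :
    (⨅ (u : ℂ → ℝ) (_ : u x = 1 ∧ u y = 0), energy a b c u)⁻¹ ≤ ENNReal.ofReal M := by
  rw [ENNReal.inv_le_iff_inv_le]
  refine le_iInf₂ fun u hu => ?_
  by_cases htop : energy a b c u = ⊤
  · rw [htop]; exact le_top
  have h1 := h.2 u _ (le_toReal_energy htop)
  rw [hu.1, hu.2, sub_zero, one_pow] at h1
  have hM : 0 < M := lt_of_le_of_ne h.1 fun h0 => by rw [← h0, zero_mul] at h1; linarith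
  rw [← ENNReal.ofReal_inv_of_pos hM, ENNReal.ofReal_le_iff_le_toReal htop, inv_le_iff_one_le_mul₀ hM,
    mul_comm]
  exact h1

theorem ResBound.resistance_le {a b c : ℕ → ℝ} {x y : ℂ} {M : ℝ} (h : ResBound a b c x y M) :
    resistance a b c x y ≤ M := ENNReal.toReal_le_of_le_ofReal h.1 h.inv_conductance_le

theorem resistance_nonneg {a b c : ℕ → ℝ} {x y : ℂ} : 0 ≤ resistance a b c x y :=
  ENNReal.toReal_nonneg

/-- If the resistance is finite, it is itself an admissible constant. -/
theorem ResBound.resistance {a b c : ℕ → ℝ} (hc : IsCompatible a b c) {x y : ℂ} {M : ℝ}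
    (h : ResBound a b c x y M) : ResBound a b c x y (resistance a b c x y) := by
  refine ⟨resistance_nonneg, fun u e hu => ?_⟩
  by_cases hd : u x - u y = 0
  · rw [hd]
    have := mul_nonneg (resistance_nonneg (a := a) (b := b) (c := c) (x := x) (y := y))
      ((hc.energyAt_nonneg 0 u).trans (hu 0))
    simpa using this
  set G := ⨅ (u : ℂ → ℝ) (_ : u x = 1 ∧ u y = 0), energy a b c u with hG
  have hGe : G ≤ ENNReal.ofReal (e / (u x - u y) ^ 2) := by
    -- Normalize `u` to the values `1` at `x` and `0` at `y`; the energy scales by the inverse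
    -- square.
    refine (iInf₂_le (fun z => (u z - u y) / (u x - u y)) ⟨div_self hd, by simp⟩).trans
      (energy_le fun n => ?_)
    rw [energyAt_affine]
    exact div_le_div_of_nonneg_right (hu n) (sq_nonneg _)
  have hG0 : G ≠ 0 := fun h0 => by
    have := h.inv_conductance_le
    rw [← hG, h0, ENNReal.inv_zero] at this
    exact absurd (top_le_iff.1 this) ENNReal.ofReal_ne_top
  have hGt : G ≠ ⊤ := (hGe.trans_lt ENNReal.ofReal_lt_top).ne
  have hR : TwistedSG.resistance a b c x y = G.toReal⁻¹ := by
    rw [TwistedSG.resistance, ENNReal.toReal_inv]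
  have hpos : 0 < G.toReal := ENNReal.toReal_pos hG0 hGt
  have he : 0 ≤ e / (u x - u y) ^ 2 :=
    div_nonneg ((hc.energyAt_nonneg 0 u).trans (hu 0)) (sq_nonneg _)
  have h2 := ENNReal.toReal_le_of_le_ofReal he hGe
  rw [le_div_iff₀ (by positivity)] at h2
  rw [hR, inv_mul_eq_div, le_div_iff₀ hpos, mul_comm]
  exact h2

theorem ResBound.symm {a b c : ℕ → ℝ} {x y : ℂ} {M : ℝ} (h : ResBound a b c x y M) :
    ResBound a b c y x M := ⟨h.1, fun u e hu => by rw [sub_sq_comm]; exact h.2 u e hu⟩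

/-- Truncation at `k` splits `p - q` into two parts of equal sign, so their squares add up to at
most the square of the sum. -/
theorem sq_max_add_sq_min_le (k p q : ℝ) :
    (max p k - max q k) ^ 2 + (min p k - min q k) ^ 2 ≤ (p - q) ^ 2 := by
  rcases le_total p k with hp | hp <;> rcases le_total q k with hq | hq <;>
    simp only [max_eq_left, max_eq_right, min_eq_left, min_eq_right, hp, hq] <;> nlinarith

theorem IsCompatible.energyAt_max_add_min_le {a b c : ℕ → ℝ} (h : IsCompatible a b c) (n : ℕ)
    (u : ℂ → ℝ) (k : ℝ) : energyAt a b c n (fun z => max (u z) k)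
      + energyAt a b c n (fun z => min (u z) k) ≤ energyAt a b c n u := by
  simp only [TwistedSG.energyAt_eq]
  have key : ∀ (n : ℕ) (f : (ℂ → ℝ) → ℝ), (∀ v : ℂ → ℝ, f (fun z => max (v z) k)
      + f (fun z => min (v z) k) ≤ f v) → ∀ v : ℂ → ℝ, wordSum f n (fun z => max (v z) k)
      + wordSum f n (fun z => min (v z) k) ≤ wordSum f n v := by
    intro n f hf
    induction n with
    | zero => exact hf
    | succ n ih =>
      intro v
      simp only [wordSum, ← Finset.sum_add_distrib]
      exact Finset.sum_le_sum fun i _ => ih (v ∘ contr i)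
  refine key n _ (fun v => ?_) u
  obtain ⟨ha, hb, hc⟩ := h.pos n
  simp only [cellEnergy]
  have h1 := mul_le_mul_of_nonneg_left
    (sq_max_add_sq_min_le k (v (corner 1)) (v (corner 2))) ha.le
  have h2 := mul_le_mul_of_nonneg_left
    (sq_max_add_sq_min_le k (v (corner 0)) (v (corner 2))) hb.le
  have h3 := mul_le_mul_of_nonneg_left
    (sq_max_add_sq_min_le k (v (corner 0)) (v (corner 1))) hc.le
  linarith

theorem sq_sub_le_of_between {p q r α β e₁ e₂ e : ℝ} (hα : 0 ≤ α) (hβ : 0 ≤ β) (he₁ : 0 ≤ e₁)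
    (he₂ : 0 ≤ e₂) (he : e₁ + e₂ ≤ e) (h₁ : (p - q) ^ 2 ≤ α * e₁) (h₂ : (q - r) ^ 2 ≤ β * e₂) :
    (p - r) ^ 2 ≤ (α + β) * e :=
  (sq_sub_le_of_chain hα hβ he₁ he₂ h₁ h₂).trans
    (mul_le_mul_of_nonneg_left he (add_nonneg hα hβ))

/-- Truncation gives the triangle inequality for the resistance. -/
theorem ResBound.trans {a b c : ℕ → ℝ} (hc : IsCompatible a b c) {x y z : ℂ} {α β : ℝ}
    (h₁ : ResBound a b c x y α) (h₂ : ResBound a b c y z β) : ResBound a b c x z (α + β) := by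
  refine ⟨add_nonneg h₁.1 h₂.1, fun u e hu => ?_⟩
  have he : 0 ≤ e := (hc.energyAt_nonneg 0 u).trans (hu 0)
  set v : ℂ → ℝ := fun w => max (u w) (u y) with hv
  set w : ℂ → ℝ := fun w => min (u w) (u y) with hw
  -- Different levels are allowed by monotonicity in the level; so once `e₁` is the supremum for
  -- `v`, what is left for `w` is at most `e - e₁`.
  have hsum : ∀ n m, energyAt a b c n v + energyAt a b c m w ≤ e := fun n m =>
    (add_le_add (hc.energyAt_mono v (le_max_left n m)) (hc.energyAt_mono w (le_max_right n m))).trans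
      ((hc.energyAt_max_add_min_le (max n m) u (u y)).trans (hu _))
  have hbv : BddAbove (Set.range fun n => energyAt a b c n v) := ⟨e, by
    rintro _ ⟨n, rfl⟩; linarith [hsum n 0, hc.energyAt_nonneg 0 w]⟩
  set e₁ := ⨆ n, energyAt a b c n v with he₁
  have hv1 : ∀ n, energyAt a b c n v ≤ e₁ := le_ciSup hbv
  have hw1 : ∀ n, energyAt a b c n w ≤ e - e₁ := fun n => by
    have : e₁ ≤ e - energyAt a b c n w := ciSup_le fun m => by linarith [hsum m n]
    linarith
  have he1 : 0 ≤ e₁ := (hc.energyAt_nonneg 0 v).trans (hv1 0)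
  have he2 : 0 ≤ e - e₁ := (hc.energyAt_nonneg 0 w).trans (hw1 0)
  have hα := mul_nonneg h₁.1 he
  have hβ := mul_nonneg h₂.1 he
  have hu1 := h₁.2 u e hu
  have hu2 := h₂.2 u e hu
  -- If `u y` lies between the other two values, the two steps see different truncations and the
  -- energies split. Otherwise one of the two differences alone dominates `u x - u z`.
  rcases le_total (u x) (u y) with hxy | hxy <;> rcases le_total (u y) (u z) with hyz | hyz
  · have g1 := h₁.2 w _ hw1
    have g2 := h₂.2 v _ hv1
    simp only [hv, hw, min_eq_left hxy, max_eq_left hyz, min_self, max_self] at g1 g2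
    exact sq_sub_le_of_between h₁.1 h₂.1 he2 he1 (by linarith) g1 g2
  · rw [add_mul]
    nlinarith
  · rw [add_mul]
    nlinarith
  · have g1 := h₁.2 v _ hv1
    have g2 := h₂.2 w _ hw1
    simp only [hv, hw, max_eq_left hxy, min_eq_left hyz, min_self, max_self] at g1 g2
    exact sq_sub_le_of_between h₁.1 h₂.1 he1 he2 (by linarith) g1 g2

/-! ### Resistance bounds on `U_*` and at `W_*` -/

theorem addr_injOn {x y : ℂ} (hx : x ∈ UStar) (hy : y ∈ UStar) (h : addr x = addr y) : x = y := by
  classical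
  by_contra hne
  obtain ⟨n, hn⟩ := Set.mem_iUnion.1 hx
  obtain ⟨m, hm⟩ := Set.mem_iUnion.1 hy
  have h1 := sq_sub_le_arcEnergy (max n m) (fun z => if z = y then 1 else 0)
    (level_mono uZero_subset (le_max_left n m) hn)
    (level_mono uZero_subset (le_max_right n m) hm)
  rw [h, sub_self, abs_zero, zero_mul, if_neg hne, if_pos rfl] at h1
  norm_num at h1

section Estimates

variable {a b c : ℕ → ℝ} {K : ℝ} (hc : IsCompatible a b c) (hK : Controlled a b c K)

include hK in
theorem Controlled.pos : 0 < K := (hK.b_pos 0).trans_le (hK.b_le 0)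

include hK in
theorem arcEnergy_le_of_energyAt_le {n : ℕ} {u : ℂ → ℝ} {e : ℝ} (h : energyAt a b c n u ≤ e) :
    3 ^ n * arcEnergy n u ≤ K * e := by
  have h1 := mul_le_mul_of_nonneg_right (hK.le_a n) (arcEnergy_nonneg n u)
  have h2 := mul_nonneg (hK.b_pos n).le (bridgeEnergy_nonneg n u)
  rw [hK.energyAt_eq] at h
  refine h1.trans ?_
  rw [mul_assoc]
  exact mul_le_mul_of_nonneg_left (by linarith) hK.pos.le

include hK in
theorem resBound_of_mem_uStar {x y : ℂ} (hx : x ∈ UStar) (hy : y ∈ UStar) :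
    ResBound a b c x y (K * |addr x - addr y|) := by
  refine ⟨mul_nonneg hK.pos.le (abs_nonneg _), fun u e hu => ?_⟩
  obtain ⟨n, hn⟩ := Set.mem_iUnion.1 hx
  obtain ⟨m, hm⟩ := Set.mem_iUnion.1 hy
  have h1 := sq_sub_le_arcEnergy (max n m) u (level_mono uZero_subset (le_max_left n m) hn)
    (level_mono uZero_subset (le_max_right n m) hm)
  refine h1.trans ?_
  have := mul_le_mul_of_nonneg_left (arcEnergy_le_of_energyAt_le hK (hu (max n m)))
    (abs_nonneg (addr x - addr y))
  linarith

include hc hK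

theorem exists_resBound_uStar {x : ℂ} (hx : x ∈ VStar) :
    ∃ y ∈ UStar, ∃ M, ResBound a b c x y M := by
  rw [vStar_eq_union] at hx
  rcases hx with hx | hx
  · exact ⟨x, hx, 0, le_rfl, fun u e _ => by simp⟩
  · obtain ⟨n, hn⟩ := Set.mem_iUnion.1 hx
    obtain ⟨y, hy, h⟩ := exists_sq_sub_le_bridgeEnergy n hn
    refine ⟨y, Set.mem_iUnion.2 ⟨n, hy⟩, (b n)⁻¹, (inv_pos.2 (hK.b_pos n)).le, fun u e hu => ?_⟩
    refine (h u).trans ?_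
    rw [inv_mul_eq_div, le_div_iff₀ (hK.b_pos n), mul_comm]
    have h1 := hu n
    rw [hK.energyAt_eq] at h1
    have := mul_nonneg (hc.pos n).1.le (arcEnergy_nonneg n u)
    linarith

/-- Some finite bound is needed before `ResBound.resistance` can replace it by the resistance
itself. -/
theorem exists_resBound {x y : ℂ} (hx : x ∈ VStar) (hy : y ∈ VStar) :
    ∃ M, ResBound a b c x y M := by
  obtain ⟨x', hx', M, hM⟩ := exists_resBound_uStar hc hK hx
  obtain ⟨y', hy', N, hN⟩ := exists_resBound_uStar hc hK hy
  exact ⟨_, (hM.trans hc (resBound_of_mem_uStar hK hx' hy')).trans hc hN.symm⟩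

theorem resBound_resistance {x y : ℂ} (hx : x ∈ VStar) (hy : y ∈ VStar) :
    ResBound a b c x y (resistance a b c x y) := by
  obtain ⟨M, hM⟩ := exists_resBound hc hK hx hy
  exact hM.resistance hc

omit hc in
theorem resistance_le_of_mem_uStar {x y : ℂ} (hx : x ∈ UStar) (hy : y ∈ UStar) :
    resistance a b c x y ≤ K * |addr x - addr y| :=
  (resBound_of_mem_uStar hK hx hy).resistance_le

/-- Test with the address clamped to the interval between the two given addresses, of length `L ≤
1`. The arcs cost at most `K L` and the bridges `K (6L + 2L²) ≤ 8 K L`, so `L² ≤ R · 9 K L`. -/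
theorem le_resistance_of_mem_uStar {x y : ℂ} (hx : x ∈ UStar) (hy : y ∈ UStar) :
    |addr x - addr y| ≤ 9 * K * resistance a b c x y := by
  set p := min (addr x) (addr y) with hp
  set q := max (addr x) (addr y) with hq
  set g : ℝ → ℝ := fun t => max p (min q t) with hg
  have hpx : p ≤ addr x := min_le_left _ _
  have hpy : p ≤ addr y := min_le_right _ _
  have hqx : addr x ≤ q := le_max_left _ _
  have hqy : addr y ≤ q := le_max_right _ _
  have hp0 : 0 ≤ p := le_min (addr_mem x).1 (addr_mem y).1
  have hq1 : q ≤ 1 := max_le (addr_mem x).2 (addr_mem y).2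
  have hL : q - p = |addr x - addr y| := max_sub_min_eq_abs' _ _
  have g0 : g 0 = p := by
    simp only [hg]
    rw [min_eq_right (by linarith), max_eq_left hp0]
  have g1 : g 1 = q := by
    simp only [hg]
    rw [min_eq_left hq1, max_eq_right (by linarith)]
  have gx : g (addr x) = addr x := by
    simp only [hg]
    rw [min_eq_right hqx, max_eq_right hpx]
  have gy : g (addr y) = addr y := by
    simp only [hg]
    rw [min_eq_right hqy, max_eq_right hpy]
  have hgl : MonoLip g 1 := monoLip_clamp p q
  set L := |addr x - addr y| with hLdef
  have hV : |g 0 - g 1| = L := by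
    rw [g0, g1, abs_sub_comm, hL, hLdef, abs_abs]
  have hL0 : 0 ≤ L := abs_nonneg _
  have hL1 : L ≤ 1 := by rw [← hL]; linarith
  have hE : ∀ n, energyAt a b c n (fun z => g (addr z)) ≤ 9 * K * L := by
    intro n
    have hA := arcEnergy_le hgl (u := fun z => g (addr z)) (fun z _ => rfl) n
    have hB := bridgeEnergy_le hgl (u := fun z => g (addr z)) (fun z _ _ => rfl)
      (fun t ht => hgl.abs_sub_le (addr_mem _) ht) n
    rw [hV] at hA hB
    rw [hK.energyAt_eq]
    have h3 : (0 : ℝ) < 3 ^ n := by positivity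
    have k1 : a n * arcEnergy n (fun z => g (addr z)) ≤ K * L := by
      calc a n * arcEnergy n (fun z => g (addr z)) ≤ (K * 3 ^ n) * (1 * L * (1 / 3) ^ n) :=
            mul_le_mul (hK.a_le n) hA (arcEnergy_nonneg _ _) (mul_nonneg hK.pos.le h3.le)
        _ = K * L := by rw [one_div, inv_pow]; field_simp
    have k2 : b n * bridgeEnergy n (fun z => g (addr z)) ≤ K * (8 * L) := by
      refine mul_le_mul (hK.b_le n) (hB.trans ?_) (bridgeEnergy_nonneg _ _) hK.pos.le
      nlinarith
    linarith
  have h := (resBound_resistance hc hK (uStar_subset_vStar hx) (uStar_subset_vStar hy)).2 _ _ hE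
  rw [gx, gy, ← sq_abs] at h
  rcases hL0.eq_or_lt with h0 | h0
  · rw [← h0]
    exact mul_nonneg (mul_nonneg (by norm_num) hK.pos.le) resistance_nonneg
  · refine le_of_mul_le_mul_right ?_ h0
    linarith

/-- Test with the indicator of `y`, whose energy is at most `4 K`. -/
theorem le_resistance_of_mem_wStar {x y : ℂ} (hx : x ∈ VStar) (hy : y ∈ WStar) (hxy : x ≠ y) :
    (4 * K)⁻¹ ≤ resistance a b c x y := by
  classical
  have hE : ∀ n, energyAt a b c n (fun z => if z = y then 1 else 0) ≤ 4 * K := by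
    intro n
    obtain ⟨hA, hB⟩ := energy_le_of_support hy (u := fun z => if z = y then 1 else 0)
      (fun z _ hz => if_neg hz) (by simp) n
    rw [hK.energyAt_eq, hA, mul_zero, zero_add]
    have := mul_le_mul (hK.b_le n) hB (bridgeEnergy_nonneg _ _) hK.pos.le
    linarith
  have h := (resBound_resistance hc hK hx (wStar_subset_vStar hy)).2 _ _ hE
  rw [if_neg hxy, if_pos rfl] at h
  rw [inv_le_iff_one_le_mul₀ (by linarith [hK.pos])]
  linarith

theorem resistance_pos {x y : ℂ} (hx : x ∈ VStar) (hy : y ∈ VStar) (hxy : x ≠ y) :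
    0 < resistance a b c x y := by
  have hK0 := hK.pos
  have hx' := hx
  have hy' := hy
  rw [vStar_eq_union] at hx' hy'
  rcases hy' with hyU | hyW
  · rcases hx' with hxU | hxW
    · have h1 := le_resistance_of_mem_uStar hc hK hxU hyU
      have h2 : 0 < |addr x - addr y| :=
        abs_pos.2 (sub_ne_zero.2 fun h => hxy (addr_injOn hxU hyU h))
      exact pos_of_mul_pos_right (h2.trans_le h1) (by positivity)
    · have h1 := le_resistance_of_mem_wStar hc hK hy hxW hxy.symm
      have h2 : 0 < (4 * K)⁻¹ := by positivity
      exact (h2.trans_le h1).trans_le (resBound_resistance hc hK hx hy).symm.resistance_le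
  · have h1 := le_resistance_of_mem_wStar hc hK hx hyW hxy
    have h2 : 0 < (4 * K)⁻¹ := by positivity
    exact h2.trans_le h1

/-- The resistance metric on `V_*`. -/
@[reducible] noncomputable def resistanceMetric : MetricSpace Vertex where
  dist x y := resistance a b c x.pt y.pt
  dist_self x := le_antisymm (ResBound.resistance_le ⟨le_rfl, fun u e _ => by simp⟩)
    resistance_nonneg
  dist_comm x y := le_antisymm (resBound_resistance hc hK y.mem x.mem).symm.resistance_le
    (resBound_resistance hc hK x.mem y.mem).symm.resistance_le
  dist_triangle x y z := ((resBound_resistance hc hK x.mem y.mem).trans hc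
    (resBound_resistance hc hK y.mem z.mem)).resistance_le
  eq_of_dist_eq_zero {x y} h := by
    by_contra hne
    refine (resistance_pos hc hK x.mem y.mem fun he => hne ?_).ne' h
    cases x; cases y; congr

end Estimates

/-! ### Comparison with the Euclidean metric -/

theorem abs_bary_sub_le (i : Fin 3) (z w : ℂ) : |bary i z - bary i w| ≤ 2 * dist z w := by
  have h3 : (1 : ℝ) ≤ √3 := Real.one_le_sqrt.2 (by norm_num)
  have hre := abs_le.1 (Complex.abs_re_le_norm (z - w))
  have him : |(z.im - w.im) / √3| ≤ dist z w := by
    rw [abs_div, abs_of_pos (by positivity : 0 < √3)]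
    refine (div_le_self (abs_nonneg _) h3).trans ?_
    rw [← Complex.sub_im, dist_eq_norm]
    exact Complex.abs_im_le_norm _
  rw [sub_div] at him
  have him := abs_le.1 him
  rw [Complex.sub_re, ← dist_eq_norm] at hre
  rw [abs_le]
  fin_cases i <;>
    simp only [bary, Fin.zero_eta, Fin.mk_one, Fin.reduceFinMk, Matrix.cons_val, mul_div_assoc] <;>
    constructor <;> linarith

theorem two_rpow_dim : (2 : ℝ) ^ (Real.log 3 / Real.log 2) = 3 := by
  rw [Real.rpow_def_of_pos (by norm_num), mul_div_cancel₀ _ (Real.log_pos (by norm_num)).ne',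
    Real.exp_log (by norm_num)]

theorem dim_pos : 0 < Real.log 3 / Real.log 2 :=
  div_pos (Real.log_pos (by norm_num)) (Real.log_pos (by norm_num))

theorem two_pow_rpow_dim (n : ℕ) : ((2 : ℝ) ^ n) ^ (Real.log 3 / Real.log 2) = 3 ^ n := by
  rw [← Real.rpow_natCast, ← Real.rpow_mul (by norm_num), mul_comm, Real.rpow_mul (by norm_num),
    two_rpow_dim, Real.rpow_natCast]

theorem scale_rpow_dim {d : ℝ} (hd : 0 ≤ d) (n : ℕ) :
    (d * (1 / 2) ^ n) ^ (Real.log 3 / Real.log 2)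
      = d ^ (Real.log 3 / Real.log 2) * (1 / 3) ^ n := by
  rw [Real.mul_rpow hd (by positivity), one_div, inv_pow, Real.inv_rpow (by positivity),
    two_pow_rpow_dim, one_div, inv_pow]

/-- The address differences from the corner `p_i` compared with the Euclidean distances, for points
outside the cell at `p_i`. -/
theorem compare_of_ne {i j : Fin 3} (hi : i ≠ 0) (hij : j ≠ i) {w : ℂ} (hw : w ∈ UStar) :
    dist (corner i) (contr j w) ^ (Real.log 3 / Real.log 2)
        ≤ 81 * |addr (corner i) - addr (contr j w)| ∧
      |addr (corner i) - addr (contr j w)|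
        ≤ 9 * dist (corner i) (contr j w) ^ (Real.log 3 / Real.log 2) := by
  have hV : ∀ z ∈ VStar, ‖z‖ ≤ 3 := fun z hz => by simpa using vStar_subset hz
  have hd : dist (corner i) (contr j w) ≤ 2 ^ 3 := by
    rw [dist_eq_norm]
    have h1 := hV _ (corner_mem_vStar i)
    have h2 := hV _ (uStar_subset_vStar (contr_mem_levels hw j))
    have := norm_sub_le (corner i) (contr j w)
    norm_num
    linarith
  -- Coordinate `i` equals `1` at the corner and is at most `1/2` in another first-level cell.
  have hd' : (1 / 4 : ℝ) ≤ dist (corner i) (contr j w) := by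
    have h1 := abs_bary_sub_le i (corner i) (contr j w)
    rw [bary_corner, if_pos rfl, bary_contr_of_ne hij] at h1
    have h2 := bary_le_one (uStar_subset_tri hw) (-(j + i))
    have h3 := (le_abs_self _).trans h1
    linarith
  have hΔ : 1 / 3 ≤ |addr (corner i) - addr (contr j w)| := by
    obtain ⟨h0, h1⟩ := addr_mem w
    rw [addr_contr_of_mem hw]
    fin_cases i
    · exact absurd rfl hi
    · simp only [Fin.mk_one, addr_corner_one]
      rw [zero_sub, abs_neg]
      refine le_trans ?_ (le_abs_self _)
      fin_cases j
      · simp only [Fin.zero_eta, addrContr, Matrix.cons_val]; linarith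
      · exact absurd rfl hij
      · simp only [Fin.reduceFinMk, addrContr, Matrix.cons_val]; linarith
    · simp only [Fin.reduceFinMk, addr_corner_two]
      refine le_trans ?_ (le_abs_self _)
      fin_cases j
      · simp only [Fin.zero_eta, addrContr, Matrix.cons_val]; linarith
      · simp only [Fin.mk_one, addrContr, Matrix.cons_val]; linarith
      · exact absurd rfl hij
  have hΔ' : |addr (corner i) - addr (contr j w)| ≤ 1 := by
    have h1 := addr_mem (corner i)
    have h2 := addr_mem (contr j w)
    rw [abs_le]
    constructor <;> linarith [h1.1, h1.2, h2.1, h2.2]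
  -- The constants come from `8 ^ dim = 27 ≤ 81 · (1/3)` and `1 ≤ 9 · (1/4) ^ dim`, where `dim = log
  -- 3 / log 2`.
  constructor
  · have := Real.rpow_le_rpow dist_nonneg hd dim_pos.le
    rw [two_pow_rpow_dim] at this
    linarith
  · have := Real.rpow_le_rpow (by norm_num) hd' dim_pos.le
    rw [show (1 / 4 : ℝ) = 1 * (1 / 2) ^ 2 by norm_num, scale_rpow_dim zero_le_one,
      Real.one_rpow] at this
    linarith

/-- Applying `contr i` halves distances from its fixed corner and divides address differences by
three. The exponent makes both sides scale alike, so the constants survive the induction. -/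
theorem compare_corner {i : Fin 3} (hi : i ≠ 0) {y : ℂ} (hy : y ∈ UStar) :
    dist (corner i) y ^ (Real.log 3 / Real.log 2) ≤ 81 * |addr (corner i) - addr y| ∧
      |addr (corner i) - addr y| ≤ 9 * dist (corner i) y ^ (Real.log 3 / Real.log 2) := by
  obtain ⟨n, hn⟩ := Set.mem_iUnion.1 hy
  clear hy
  induction n generalizing y with
  | zero =>
    obtain ⟨j, rfl⟩ := uZero_subset hn
    by_cases hij : j = i
    · subst hij
      rw [dist_self, sub_self, abs_zero, Real.zero_rpow dim_pos.ne']
      norm_num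
    · have := compare_of_ne hi hij (Set.mem_iUnion.2 ⟨0, hn⟩ : corner j ∈ UStar)
      rwa [contr_corner] at this
  | succ n ih =>
    obtain ⟨j, w, hw, rfl⟩ := Set.mem_iUnion.1 hn
    have hwU : w ∈ UStar := Set.mem_iUnion.2 ⟨n, hw⟩
    by_cases hij : j = i
    · subst hij
      obtain ⟨h1, h2⟩ := ih hw
      have e1 : dist (corner j) (contr j w) = dist (corner j) w * (1 / 2) ^ 1 := by
        conv_lhs => rw [← contr_corner j, dist_contr]
        ring
      have e2 : |addr (corner j) - addr (contr j w)| = |addr (corner j) - addr w| / 3 := by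
        rw [addr_contr_of_mem hwU, addr_corner_fixed j, abs_addrContr_sub, ← addr_corner_fixed j]
      rw [e1, e2, scale_rpow_dim dist_nonneg]
      constructor <;> linarith
    · exact compare_of_ne hi hij hwU

/-- For a vertex of a cell in `U_*`, address differences in the cell are comparable to a power of
the Euclidean distance. -/
theorem compare_cell {x y : ℂ} (hx : x ∈ UStar) {ω : List (Fin 3)} (hxω : x ∈ cellMap ω '' V 0)
    (hy : y ∈ UStar ∩ cell ω) :
    dist x y ^ (Real.log 3 / Real.log 2) ≤ 81 * |addr x - addr y| ∧
      |addr x - addr y| ≤ 9 * dist x y ^ (Real.log 3 / Real.log 2) := by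
  rw [uStar_inter_cell] at hy
  obtain ⟨y, hy, rfl⟩ := hy
  obtain ⟨c, d, hd, hω⟩ := addr_cellMap ω
  have key : ∀ i : Fin 3, i ≠ 0 → corner i ∈ UStar → x = cellMap ω (corner i) →
      dist x (cellMap ω y) ^ (Real.log 3 / Real.log 2) ≤ 81 * |addr x - addr (cellMap ω y)| ∧
      |addr x - addr (cellMap ω y)|
        ≤ 9 * dist x (cellMap ω y) ^ (Real.log 3 / Real.log 2) := by
    rintro i hi hiU rfl
    obtain ⟨h1, h2⟩ := compare_corner hi hy
    rw [dist_cellMap, scale_rpow_dim dist_nonneg, hω _ hiU, hω _ hy, add_sub_add_left_eq_sub,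
      ← mul_sub, abs_mul, hd]
    have h3 : (0 : ℝ) < (1 / 3) ^ ω.length := by positivity
    constructor <;> nlinarith
  rcases eq_cellMap_corner hx hxω with h | h
  · exact key 1 (by decide) corner_one_mem_uStar h
  · exact key 2 (by decide) corner_two_mem_uStar h

/-- The addresses in the two cells at a point of `W_*`. -/
theorem addr_cells_mid (τ : List (Fin 3)) : ∃ c d : ℝ, |d| = (1 / 3) ^ τ.length ∧
    (∀ z ∈ UStar, addr (cellMap (τ ++ [1]) z) = c + d * (addr z / 3)) ∧
    ∀ z ∈ UStar, addr (cellMap (τ ++ [2]) z) = c + d * ((2 + addr z) / 3) := by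
  obtain ⟨c, d, hd, h⟩ := addr_cellMap τ
  refine ⟨c, d, hd, fun z hz => ?_, fun z hz => ?_⟩
  · rw [cellMap_append]
    change addr (cellMap τ (contr 1 z)) = _
    rw [h _ (contr_mem_levels hz 1), addr_contr_of_mem hz]
    simp [addrContr]
  · rw [cellMap_append]
    change addr (cellMap τ (contr 2 z)) = _
    rw [h _ (contr_mem_levels hz 2), addr_contr_of_mem hz]
    simp [addrContr]

/-- The two cells occupy the outer thirds of an address interval of length `3^{-|τ|}`, with the
middle third, from `τ ++ [0]`, between them. -/
theorem addr_sub_cells_mid {τ : List (Fin 3)} {x y : ℂ} (hx : x ∈ UStar ∩ cell (τ ++ [1]))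
    (hy : y ∈ UStar ∩ cell (τ ++ [2])) : (1 / 3) ^ (τ.length + 1) ≤ |addr x - addr y| ∧
      |addr x - addr y| ≤ 3 * (1 / 3) ^ (τ.length + 1) := by
  rw [uStar_inter_cell] at hx hy
  obtain ⟨x, hx, rfl⟩ := hx
  obtain ⟨y, hy, rfl⟩ := hy
  obtain ⟨c, d, hd, h1, h2⟩ := addr_cells_mid τ
  have hx' := addr_mem x
  have hy' := addr_mem y
  rw [h1 x hx, h2 y hy, add_sub_add_left_eq_sub, ← mul_sub, abs_mul, hd, pow_succ, abs_sub_comm,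
    abs_of_nonneg (a := (2 + addr y) / 3 - addr x / 3) (by linarith [hx'.2, hy'.1])]
  have h3 : (0 : ℝ) < (1 / 3) ^ τ.length := by positivity
  constructor <;> nlinarith [hx'.1, hx'.2, hy'.1, hy'.2]

/-- Points of `U_*` close to `p₁` have addresses close to `1 / 2`. -/
theorem abs_addr_sub_half_le (n : ℕ) {w : ℂ} (hw : w ∈ UStar)
    (h : dist w (corner 0) < 1 / 4 * (1 / 2) ^ n) : |addr w - 1 / 2| ≤ (1 / 3) ^ n := by
  induction n generalizing w with
  | zero =>
    have := addr_mem w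
    rw [abs_le]
    constructor <;> norm_num <;> linarith [this.1, this.2]
  | succ n ih =>
    obtain ⟨j, w, hw', rfl⟩ := exists_eq_contr uZero_subset hw
    have hj : j = 0 := by
      by_contra hj
      have h1 := abs_bary_sub_le 0 (corner 0) (contr j w)
      rw [bary_corner, if_pos rfl, bary_contr_of_ne hj, dist_comm] at h1
      have h2 := bary_le_one (uStar_subset_tri hw') (-(j + 0))
      have h3 := (le_abs_self _).trans h1
      have h4 : (1 / 2 : ℝ) ^ (n + 1) ≤ 1 := pow_le_one₀ (by norm_num) (by norm_num)
      linarith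
    subst hj
    have h1 : dist (contr 0 w) (corner 0) = dist w (corner 0) / 2 := by
      conv_lhs => rw [← contr_corner 0, dist_contr]
    have h2 := ih hw' (by rw [h1, pow_succ] at h; linarith)
    rw [addr_contr_of_mem hw', ← addr_corner_zero, addr_corner_fixed 0, abs_addrContr_sub,
      addr_corner_zero, pow_succ]
    linarith

theorem exists_addr_close (n : ℕ) {t : ℝ} (ht : t ∈ Set.Icc (0 : ℝ) 1) :
    ∃ x ∈ UStar, |addr x - t| ≤ (1 / 3) ^ n := by
  induction n generalizing t with
  | zero =>
    refine ⟨corner 1, corner_one_mem_uStar, ?_⟩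
    rw [addr_corner_one, zero_sub, abs_neg, pow_zero, abs_of_nonneg ht.1]
    exact ht.2
  | succ n ih =>
    have key : ∀ i, ∀ s ∈ Set.Icc (0 : ℝ) 1, addrContr i s = t →
        ∃ x ∈ UStar, |addr x - t| ≤ (1 / 3) ^ (n + 1) := by
      rintro i s hs rfl
      obtain ⟨x, hx, h⟩ := ih hs
      refine ⟨contr i x, contr_mem_levels hx i, ?_⟩
      rw [addr_contr_of_mem hx, abs_addrContr_sub, pow_succ]
      linarith
    obtain ⟨h0, h1⟩ := ht
    rcases le_total t (1 / 3) with h | h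
    · exact key 1 (3 * t) ⟨by linarith, by linarith⟩ (by simp [addrContr])
    · rcases le_total t (2 / 3) with h' | h'
      · exact key 0 (2 - 3 * t) ⟨by linarith, by linarith⟩ (by simp [addrContr])
      · exact key 2 (3 * t - 2) ⟨by linarith, by linarith⟩ (by simp [addrContr])

/-- Iterates of `F₁` fix `p₁` and draw `p₂` towards it. -/
theorem corner_zero_mem_closure : corner 0 ∈ closure UStar := by
  rw [Metric.mem_closure_iff]
  intro ε hε
  have hfix : ∀ n, cellMap (List.replicate n 0) (corner 0) = corner 0 := fun n => by
    induction n with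
    | zero => rfl
    | succ n ih => rw [List.replicate_succ, cellMap, Function.comp_apply, ih, contr_corner]
  have hd : 0 < dist (corner 0) (corner 1) + 1 := by positivity
  obtain ⟨n, hn⟩ := exists_pow_lt_of_lt_one (div_pos hε hd) (by norm_num : (1 / 2 : ℝ) < 1)
  refine ⟨cellMap (List.replicate n 0) (corner 1), cellMap_mem_levels corner_one_mem_uStar _, ?_⟩
  conv_lhs => rw [← hfix n]
  rw [dist_cellMap, List.length_replicate]
  rw [lt_div_iff₀ hd] at hn
  have : (0 : ℝ) < (1 / 2) ^ n := by positivity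
  linarith

/-! ### Closures in the completion -/

section Arc

variable {Y : Type*} [MetricSpace Y] [CompleteSpace Y]

/-- A map `f` on a subset `S` of a complete space that is bi-Lipschitz onto a dense subset of
`[0, 1]` extends to a bi-Lipschitz map of the closure of `S` onto `[0, 1]`. -/
theorem exists_extension_closure {S : Set Y} {f : Y → ℝ} {A B : ℝ}
    (h₁ : ∀ x ∈ S, ∀ y ∈ S, |f x - f y| ≤ A * dist x y)
    (h₂ : ∀ x ∈ S, ∀ y ∈ S, dist x y ≤ B * |f x - f y|)
    (h01 : ∀ x ∈ S, f x ∈ Set.Icc (0 : ℝ) 1) (hdense : Set.Icc (0 : ℝ) 1 ⊆ closure (f '' S)) :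
    ∃ F : Y → ℝ, Continuous F ∧ Set.EqOn f F S ∧
      (∀ x ∈ closure S, ∀ y ∈ closure S, |F x - F y| ≤ A * dist x y) ∧
      (∀ x ∈ closure S, ∀ y ∈ closure S, dist x y ≤ B * |F x - F y|) ∧
      F '' closure S = Set.Icc 0 1 ∧ IsPathConnected (closure S) ∧
      LocallyConnectedSpace (closure S) := by
  have hlip : LipschitzOnWith A.toNNReal f S := LipschitzOnWith.of_dist_le_mul fun x hx y hy => by
    rw [Real.dist_eq]
    exact (h₁ x hx y hy).trans (mul_le_mul_of_nonneg_right (Real.le_coe_toNNReal A) dist_nonneg)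
  obtain ⟨F, hF, hfF⟩ := hlip.extend_real
  have hc := hF.continuous
  have key : ∀ P : Y → Y → Prop, IsClosed {p : Y × Y | P p.1 p.2} → (∀ x ∈ S, ∀ y ∈ S, P x y) →
      ∀ x ∈ closure S, ∀ y ∈ closure S, P x y := by
    intro P hP h x hx y hy
    have h3 : closure (S ×ˢ S) ⊆ {p : Y × Y | P p.1 p.2} :=
      closure_minimal (fun p hp => h p.1 hp.1 p.2 hp.2) hP
    exact h3 (by rw [closure_prod_eq]; exact ⟨hx, hy⟩ : (x, y) ∈ closure (S ×ˢ S))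
  have k1 : ∀ x ∈ closure S, ∀ y ∈ closure S, |F x - F y| ≤ A * dist x y :=
    key _ (isClosed_le (by fun_prop) (by fun_prop)) fun x hx y hy => by
      rw [← hfF hx, ← hfF hy]; exact h₁ x hx y hy
  have k2 : ∀ x ∈ closure S, ∀ y ∈ closure S, dist x y ≤ B * |F x - F y| :=
    key _ (isClosed_le (by fun_prop) (by fun_prop)) fun x hx y hy => by
      rw [← hfF hx, ← hfF hy]; exact h₂ x hx y hy
  have hanti : AntilipschitzWith B.toNNReal fun x : closure S => F x :=
    AntilipschitzWith.of_le_mul_dist fun x y => by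
      rw [Real.dist_eq]
      exact (k2 x x.2 y y.2).trans
        (mul_le_mul_of_nonneg_right (Real.le_coe_toNNReal B) (abs_nonneg _))
  have : CompleteSpace (closure S) := isClosed_closure.completeSpace_coe
  have huc : UniformContinuous fun x : closure S => F x :=
    hF.uniformContinuous.comp uniformContinuous_subtype_val
  -- A uniformly continuous antilipschitz map on a complete space has closed range, so a dense image
  -- is all of `[0, 1]`.
  have hemb := hanti.isClosedEmbedding huc
  have hrange : Set.range (fun x : closure S => F x) = Set.Icc 0 1 := by
    apply Set.Subset.antisymm
    · rintro _ ⟨⟨x, hx⟩, rfl⟩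
      have : closure S ⊆ F ⁻¹' Set.Icc 0 1 :=
        closure_minimal (fun x hx => by rw [Set.mem_preimage, ← hfF hx]; exact h01 x hx)
          (isClosed_Icc.preimage hc)
      exact this hx
    · refine hdense.trans (closure_minimal ?_ hemb.isClosed_range)
      rintro _ ⟨x, hx, rfl⟩
      exact ⟨⟨x, subset_closure hx⟩, (hfF hx).symm⟩
  let e : closure S ≃ₜ Set.Icc (0 : ℝ) 1 :=
    hemb.toIsEmbedding.toHomeomorph.trans (Homeomorph.setCongr hrange)
  refine ⟨F, hc, hfF, k1, k2, ?_, ?_, ?_⟩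
  · rw [← hrange]
    exact Set.image_eq_range _ _
  · rw [isPathConnected_iff_pathConnectedSpace]
    have : PathConnectedSpace (Set.Icc (0 : ℝ) 1) :=
      isPathConnected_iff_pathConnectedSpace.1
        ((convex_Icc 0 1).isPathConnected ⟨0, by simp⟩)
    exact e.symm.surjective.pathConnectedSpace e.symm.continuous
  · have := (convex_Icc (0 : ℝ) 1).locallyPathConnectedSpace
    exact e.locallyConnectedSpace

end Arc

/-- A cluster point along a supremum of two filters is one along either, and in a Hausdorff space a
limit is the only cluster point. -/
theorem setOf_mapClusterPt_sup {X Y : Type*} [TopologicalSpace Y] [T2Space Y] {f : X → Y}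
    {l₁ l₂ : Filter X} [l₁.NeBot] [l₂.NeBot] {p₁ p₂ : Y} (h₁ : Tendsto f l₁ (𝓝 p₁))
    (h₂ : Tendsto f l₂ (𝓝 p₂)) : {p | MapClusterPt p (l₁ ⊔ l₂) f} = {p₁, p₂} := by
  have key : ∀ {l : Filter X} [l.NeBot] {q : Y}, Tendsto f l (𝓝 q) →
      ∀ p, ClusterPt p (map f l) ↔ p = q := by
    intro l _ q h p
    constructor
    · intro hp
      have h3 : ClusterPt p (𝓝 q) := hp.mono h
      exact eq_of_nhds_neBot h3
    · rintro rfl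
      exact h.mapClusterPt
  ext p
  simp only [Set.mem_ofPred_eq, MapClusterPt, map_sup, clusterPt_sup, key h₁, key h₂,
    Set.mem_insert_iff, Set.mem_singleton_iff]

/-! ### Points of `U_*` approaching a point of `W_*` -/

theorem nhdsWithin_uStar (τ : List (Fin 3)) : 𝓝[UStar] (cellMap τ mid)
    = 𝓝[UStar ∩ cell (τ ++ [1])] (cellMap τ mid) ⊔ 𝓝[UStar ∩ cell (τ ++ [2])] (cellMap τ mid) := by
  rw [← nhdsWithin_union, ← Set.inter_union_distrib_left]
  refine (nhdsWithin_inter_of_mem' ?_).symm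
  rw [mem_nhdsWithin_iff_eventually]
  filter_upwards [eventually_mem_image τ] with z hz hzU
  rw [← uStar_inter_cell, ← uStar_inter_cell] at hz
  exact (hz hzU).imp And.right And.right

theorem cellMap_append_one (τ : List (Fin 3)) :
    cellMap (τ ++ [1]) (corner 0) = cellMap τ mid := cellMap_append τ [1] _

theorem cellMap_append_two (τ : List (Fin 3)) :
    cellMap (τ ++ [2]) (corner 0) = cellMap τ mid := by
  rw [cellMap_append, ← contr_two_corner_zero]
  rfl

/-- Guarantees that the one-sided limits at points of `W_*` are not vacuous. -/
theorem neBot_comap_pt (ω : List (Fin 3)) :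
    (comap Vertex.pt (𝓝[UStar ∩ cell ω] (cellMap ω (corner 0)))).NeBot := by
  rw [comap_neBot_iff]
  intro t ht
  have hcl : cellMap ω (corner 0) ∈ closure (UStar ∩ cell ω) := by
    rw [uStar_inter_cell]
    exact image_closure_subset_closure_image (continuous_cellMap ω)
      ⟨_, corner_zero_mem_closure, rfl⟩
  have := mem_closure_iff_nhdsWithin_neBot.1 hcl
  obtain ⟨z, hz1, hz2⟩ := nonempty_of_mem (inter_mem ht self_mem_nhdsWithin)
  exact ⟨⟨z, uStar_subset_vStar hz2.1⟩, hz1⟩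

/-- Inside one cell, approach to the image of `p₁` means that the preimages approach `p₁`, where
addresses tend to `1/2`. -/
theorem tendsto_addr_cell {ω : List (Fin 3)} {c d : ℝ}
    (h : ∀ z ∈ UStar, addr (cellMap ω z) = c + d * addr z) :
    Tendsto addr (𝓝[UStar ∩ cell ω] (cellMap ω (corner 0))) (𝓝 (c + d * (1 / 2))) := by
  rw [Metric.tendsto_nhds]
  intro ε hε
  have hd : 0 < |d| + 1 := by positivity
  obtain ⟨n, hn⟩ := exists_pow_lt_of_lt_one (div_pos hε hd) (by norm_num : (1 / 3 : ℝ) < 1)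
  rw [lt_div_iff₀ hd] at hn
  have hδ : (0 : ℝ) < 1 / 4 * (1 / 2) ^ n * (1 / 2) ^ ω.length := by positivity
  filter_upwards [self_mem_nhdsWithin, mem_nhdsWithin_of_mem_nhds (Metric.ball_mem_nhds _ hδ)]
    with z hz hzb
  rw [uStar_inter_cell] at hz
  obtain ⟨w, hw, rfl⟩ := hz
  rw [Metric.mem_ball, dist_cellMap] at hzb
  have h1 := abs_addr_sub_half_le n hw (lt_of_mul_lt_mul_right hzb (by positivity))
  rw [h w hw, Real.dist_eq, add_sub_add_left_eq_sub, ← mul_sub, abs_mul]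
  have : (0 : ℝ) < (1 / 3) ^ n := by positivity
  have := mul_le_mul_of_nonneg_left h1 (abs_nonneg d)
  linarith

/-- Of the resistance metric only the two-sided address bound on `U_*` and the uniform separation on
`W_*` are used. -/
theorem completion_structure [MetricSpace Vertex] {K δ : ℝ} (hK : 0 < K)
    (hlow : ∀ x y : Vertex, x.pt ∈ UStar → y.pt ∈ UStar →
      |addr x.pt - addr y.pt| ≤ 9 * K * dist x y)
    (hup : ∀ x y : Vertex, x.pt ∈ UStar → y.pt ∈ UStar →
      dist x y ≤ K * |addr x.pt - addr y.pt|)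
    (hδ : 0 < δ)
    (hW : ∀ x y : Vertex, x.pt ∈ WStar → y.pt ∈ WStar → x ≠ y → δ ≤ dist x y) :
    ∃ Ubar : Set (UniformSpace.Completion Vertex),
      Ubar = closure ((fun v : Vertex => (v : UniformSpace.Completion _)) ''
        {v | v.pt ∈ UStar}) ∧
      Ubar ∪ (fun v : Vertex => (v : UniformSpace.Completion _)) ''
        {v | v.pt ∈ WStar} = Set.univ ∧
      IsPathConnected Ubar ∧
      LocallyConnectedSpace Ubar ∧
      ∃ C : ℝ, 0 < C ∧ ∀ k : ℕ, 1 ≤ k → ∀ q ∈ W k \ W (k - 1),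
        ∃ ω' ω'' : List (Fin 3), ω' ≠ ω'' ∧ largestCells q = {ω', ω''} ∧
        ∃ p' ∈ Ubar, ∃ p'' ∈ Ubar,
          Tendsto (fun v : Vertex => (v : UniformSpace.Completion _))
            (comap Vertex.pt (𝓝[UStar ∩ cell ω'] q)) (𝓝 p') ∧
          Tendsto (fun v : Vertex => (v : UniformSpace.Completion _))
            (comap Vertex.pt (𝓝[UStar ∩ cell ω''] q)) (𝓝 p'') ∧
          {p : UniformSpace.Completion Vertex |
            MapClusterPt p (comap Vertex.pt (𝓝[UStar] q))
              (fun v : Vertex => (v : UniformSpace.Completion _))} = {p', p''} ∧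
          C⁻¹ * (1 / 3 : ℝ) ^ k ≤ dist p' p'' ∧ dist p' p'' ≤ C * (1 / 3 : ℝ) ^ k := by
  set ι : Vertex → UniformSpace.Completion Vertex := fun v => v with hι
  have hinj : Function.Injective ι := UniformSpace.Completion.coe_injective Vertex
  have hdist : ∀ x y, dist (ι x) (ι y) = dist x y := UniformSpace.Completion.dist_eq
  set S := ι '' {v | v.pt ∈ UStar} with hS
  set f : UniformSpace.Completion Vertex → ℝ := Function.extend ι (fun v => addr v.pt) 0 with hf
  have hfι : ∀ v, f (ι v) = addr v.pt := fun v => hinj.extend_apply _ _ v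
  obtain ⟨F, hFc, hFf, k1, k2, himg, hpath, hloc⟩ :=
    exists_extension_closure (S := S) (f := f) (A := 9 * K) (B := K)
      (by
        rintro _ ⟨x, hx, rfl⟩ _ ⟨y, hy, rfl⟩
        rw [hfι, hfι, hdist]
        exact hlow x y hx hy)
      (by
        rintro _ ⟨x, hx, rfl⟩ _ ⟨y, hy, rfl⟩
        rw [hfι, hfι, hdist]
        exact hup x y hx hy)
      (by
        rintro _ ⟨x, hx, rfl⟩
        rw [hfι]
        exact addr_mem _)
      (by
        intro t ht
        rw [Metric.mem_closure_iff]
        intro ε hε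
        obtain ⟨n, hn⟩ := exists_pow_lt_of_lt_one hε (by norm_num : (1 / 3 : ℝ) < 1)
        obtain ⟨x, hx, h⟩ := exists_addr_close n ht
        refine ⟨_, ⟨ι ⟨x, uStar_subset_vStar hx⟩, ⟨_, hx, rfl⟩, rfl⟩, ?_⟩
        rw [hfι, dist_comm, Real.dist_eq]
        exact h.trans_lt hn)
  have hFι : ∀ v : Vertex, v.pt ∈ UStar → F (ι v) = addr v.pt := fun v hv => by
    rw [← hFf ⟨v, hv, rfl⟩, hfι]
  have hι_mem : ∀ v : Vertex, v.pt ∈ UStar → ι v ∈ closure S := fun v hv =>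
    subset_closure ⟨v, hv, rfl⟩
  have hlim : ∀ (s : Set ℂ) (q : ℂ), s ⊆ UStar → ∀ t : ℝ, Tendsto addr (𝓝[s] q) (𝓝 t) →
      ∀ p ∈ closure S, F p = t → Tendsto ι (comap Vertex.pt (𝓝[s] q)) (𝓝 p) := by
    intro s q hs t ht p hp hpt
    rw [tendsto_iff_dist_tendsto_zero]
    have h1 : Tendsto (fun v : Vertex => K * |addr v.pt - t|) (comap Vertex.pt (𝓝[s] q)) (𝓝 0) := by
      have h2 : Tendsto (fun v : Vertex => addr v.pt) (comap Vertex.pt (𝓝[s] q)) (𝓝 t) :=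
        ht.comp tendsto_comap
      have h3 := ((h2.sub_const t).abs).const_mul K
      simpa using h3
    refine squeeze_zero' (Eventually.of_forall fun _ => dist_nonneg) ?_ h1
    filter_upwards [preimage_mem_comap (self_mem_nhdsWithin (s := s) (a := q))] with v hv
    have := k2 _ (hι_mem v (hs hv)) p hp
    rwa [hFι v (hs hv), hpt] at this
  refine ⟨closure S, rfl, ?_, hpath, hloc, 9 * K, by positivity, ?_⟩
  -- Uniform separation makes the image of `W_*` closed, so taking closures adds points to the `U_*`
  -- part only.
  · have hWc : IsClosed (ι '' {v | v.pt ∈ WStar}) := by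
      refine Metric.isClosed_of_pairwise_le_dist hδ ?_
      rintro _ ⟨x, hx, rfl⟩ _ ⟨y, hy, rfl⟩ hne
      rw [hdist]
      exact hW x y hx hy fun h => hne (by rw [h])
    rw [← hWc.closure_eq, ← closure_union, ← Set.image_union]
    have : {v : Vertex | v.pt ∈ UStar} ∪ {v : Vertex | v.pt ∈ WStar} = Set.univ := by
      ext v
      have := v.mem
      rw [vStar_eq_union] at this
      simpa using this
    rw [this, Set.image_univ]
    exact (UniformSpace.Completion.denseRange_coe (α := Vertex)).closure_range
  · intro k hk q hq
    obtain ⟨k, rfl⟩ := Nat.exists_eq_succ_of_ne_zero (by omega : k ≠ 0)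
    obtain ⟨τ, hτ, rfl⟩ := exists_eq_cellMap_mid hq
    obtain ⟨c, d, hd, ha1, ha2⟩ := addr_cells_mid τ
    have hfirst : ∀ (ω : List (Fin 3)) (q : ℂ) (c d : ℝ), cellMap ω (corner 0) = q →
        (∀ z ∈ UStar, addr (cellMap ω z) = c + d * addr z) →
        ∃ p ∈ closure S, F p = c + d * (1 / 2) ∧
          Tendsto ι (comap Vertex.pt (𝓝[UStar ∩ cell ω] q)) (𝓝 p) := by
      rintro ω _ c d rfl h
      -- This is the midpoint of the addresses of the images of `p₂` and `p₃`, hence lies in `[0,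
      -- 1]`.
      have hmem : c + d * (1 / 2) ∈ F '' closure S := by
        rw [himg]
        have e1 := h _ corner_one_mem_uStar
        have e2 := h _ corner_two_mem_uStar
        rw [addr_corner_one] at e1
        rw [addr_corner_two] at e2
        have b1 := addr_mem (cellMap ω (corner 1))
        have b2 := addr_mem (cellMap ω (corner 2))
        rw [e1] at b1
        rw [e2] at b2
        constructor <;> linarith [b1.1, b1.2, b2.1, b2.2]
      obtain ⟨p, hp, hpF⟩ := hmem
      exact ⟨p, hp, hpF, hlim _ _ Set.inter_subset_left _ (tendsto_addr_cell h) p hp hpF⟩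
    obtain ⟨p', hp', hF', ht'⟩ := hfirst (τ ++ [1]) _ c (d / 3) (cellMap_append_one τ)
      fun z hz => by rw [ha1 z hz]; ring
    obtain ⟨p'', hp'', hF'', ht''⟩ := hfirst (τ ++ [2]) _ (c + d * (2 / 3)) (d / 3)
      (cellMap_append_two τ) fun z hz => by rw [ha2 z hz]; ring
    have hne1 : (comap Vertex.pt (𝓝[UStar ∩ cell (τ ++ [1])] (cellMap τ mid))).NeBot := by
      rw [← cellMap_append_one]; exact neBot_comap_pt _
    have hne2 : (comap Vertex.pt (𝓝[UStar ∩ cell (τ ++ [2])] (cellMap τ mid))).NeBot := by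
      rw [← cellMap_append_two]; exact neBot_comap_pt _
    -- The midpoints of the outer thirds are two thirds of `|d| = (1/3) ^ k` apart; `k` is now the
    -- length of `τ`, one less than the level of the point.
    have hΔ : |F p' - F p''| = 2 * (1 / 3) ^ (k + 1) := by
      rw [hF', hF'', ← hτ, pow_succ, ← hd,
        show c + d / 3 * (1 / 2) - (c + d * (2 / 3) + d / 3 * (1 / 2)) = -(d * (2 / 3)) by ring,
        abs_neg, abs_mul, abs_of_pos (by norm_num : (0 : ℝ) < 2 / 3)]
      ring
    have h3 : (0 : ℝ) < (1 / 3) ^ (k + 1) := by positivity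
    rw [Nat.succ_eq_add_one]
    refine ⟨τ ++ [1], τ ++ [2], by simp, largestCells_cellMap_mid τ, p', hp', p'', hp'', ht', ht'',
      ?_, ?_, ?_⟩
    · rw [nhdsWithin_uStar, comap_sup]
      exact setOf_mapClusterPt_sup ht' ht''
    · have := k1 p' hp' p'' hp''
      rw [hΔ] at this
      rw [inv_mul_le_iff₀ (by positivity)]
      linarith
    · have := k2 p' hp' p'' hp''
      rw [hΔ] at this
      nlinarith

end TwistedSG

/-! ### Assembly of the proposition -/

theorem proposition4p2 (a₀ b₀ : ℝ) (hb₀ : 0 < b₀) (hab : b₀ < a₀) :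
    -- compatible conductances with initial data `(a₀, b₀, b₀)` exist, and for any such:
    (∃ a b c : ℕ → ℝ, TwistedSG.IsCompatible a b c ∧ a 0 = a₀ ∧ b 0 = b₀ ∧ c 0 = b₀) ∧
    ∀ a b c : ℕ → ℝ, TwistedSG.IsCompatible a b c → a 0 = a₀ → b 0 = b₀ → c 0 = b₀ →
      -- `R` is uniformly discrete on `W_*`
      (∃ δ : ℝ, 0 < δ ∧ ∀ x ∈ TwistedSG.WStar, ∀ y ∈ TwistedSG.WStar, x ≠ y →
        δ ≤ TwistedSG.resistance a b c x y) ∧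
      -- `U_*` and `W_*` are at positive distance
      (∃ δ : ℝ, 0 < δ ∧ ∀ x ∈ TwistedSG.UStar, ∀ y ∈ TwistedSG.WStar,
        δ ≤ TwistedSG.resistance a b c x y) ∧
      -- `R(x, y) ≍ |x - y| ^ (log 3 / log 2)` for `x ∈ U_*` and `y ∈ U_* ∩ K_x`
      (∃ C : ℝ, 0 < C ∧ ∀ x ∈ TwistedSG.UStar, ∀ ω ∈ TwistedSG.largestCells x,
        ∀ y ∈ TwistedSG.UStar ∩ TwistedSG.cell ω,
          C⁻¹ * ‖x - y‖ ^ (Real.log 3 / Real.log 2) ≤ TwistedSG.resistance a b c x y ∧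
          TwistedSG.resistance a b c x y ≤ C * ‖x - y‖ ^ (Real.log 3 / Real.log 2)) ∧
      -- `R(x, y) ≍ 3 ^ (-k)` across the two cells adjacent to `q ∈ W_k \ W_{k-1}`
      (∃ C : ℝ, 0 < C ∧ ∀ k : ℕ, 1 ≤ k → ∀ q ∈ TwistedSG.W k \ TwistedSG.W (k - 1),
        ∃ ω' ω'' : List (Fin 3), ω' ≠ ω'' ∧ TwistedSG.largestCells q = {ω', ω''} ∧
          ∀ n : ℕ, k ≤ n → ∀ x ∈ TwistedSG.U n ∩ TwistedSG.cell ω',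
            ∀ y ∈ TwistedSG.U n ∩ TwistedSG.cell ω'',
              C⁻¹ * (1 / 3 : ℝ) ^ k ≤ TwistedSG.resistance a b c x y ∧
              TwistedSG.resistance a b c x y ≤ C * (1 / 3 : ℝ) ^ k) ∧
      -- `R` is a metric on `V_*`; the completion is `UniformSpace.Completion TwistedSG.Vertex`
      ∃ m : MetricSpace TwistedSG.Vertex,
        (∀ x y : TwistedSG.Vertex, dist x y = TwistedSG.resistance a b c x.pt y.pt) ∧
        ∃ Ubar : Set (UniformSpace.Completion TwistedSG.Vertex),
          Ubar = closure ((fun v : TwistedSG.Vertex => (v : UniformSpace.Completion _)) ''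
            {v | v.pt ∈ TwistedSG.UStar}) ∧
          Ubar ∪ (fun v : TwistedSG.Vertex => (v : UniformSpace.Completion _)) ''
            {v | v.pt ∈ TwistedSG.WStar} = Set.univ ∧
          IsPathConnected Ubar ∧
          LocallyConnectedSpace Ubar ∧
          -- the two limit points of `U_*` at each `q`
          ∃ C : ℝ, 0 < C ∧ ∀ k : ℕ, 1 ≤ k → ∀ q ∈ TwistedSG.W k \ TwistedSG.W (k - 1),
            ∃ ω' ω'' : List (Fin 3), ω' ≠ ω'' ∧ TwistedSG.largestCells q = {ω', ω''} ∧
            ∃ p' ∈ Ubar, ∃ p'' ∈ Ubar,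
              Tendsto (fun v : TwistedSG.Vertex => (v : UniformSpace.Completion _))
                (comap TwistedSG.Vertex.pt (𝓝[TwistedSG.UStar ∩ TwistedSG.cell ω'] q)) (𝓝 p') ∧
              Tendsto (fun v : TwistedSG.Vertex => (v : UniformSpace.Completion _))
                (comap TwistedSG.Vertex.pt (𝓝[TwistedSG.UStar ∩ TwistedSG.cell ω''] q)) (𝓝 p'') ∧
              {p : UniformSpace.Completion TwistedSG.Vertex |
                MapClusterPt p (comap TwistedSG.Vertex.pt (𝓝[TwistedSG.UStar] q))
                  (fun v : TwistedSG.Vertex => (v : UniformSpace.Completion _))} = {p', p''} ∧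
              C⁻¹ * (1 / 3 : ℝ) ^ k ≤ dist p' p'' ∧ dist p' p'' ≤ C * (1 / 3 : ℝ) ^ k := by
  refine ⟨TwistedSG.exists_isCompatible hb₀ hab, ?_⟩
  rintro a b c hc rfl rfl hcb
  obtain ⟨K, hK⟩ := hc.controlled hcb hab
  have hK0 := hK.pos
  refine ⟨⟨(4 * K)⁻¹, by positivity, fun x hx y hy hxy =>
      TwistedSG.le_resistance_of_mem_wStar hc hK (TwistedSG.wStar_subset_vStar hx) hy hxy⟩,
    ⟨(4 * K)⁻¹, by positivity, fun x hx y hy =>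
      TwistedSG.le_resistance_of_mem_wStar hc hK (TwistedSG.uStar_subset_vStar hx) hy fun h =>
        Set.disjoint_left.1 TwistedSG.disjoint_uStar_wStar hx (h ▸ hy)⟩, ?_, ?_, ?_⟩
  -- `729 K = 81 · 9 K` combines the comparison of distance with address and that of address with
  -- resistance.
  · refine ⟨729 * K, by positivity, fun x hx ω hω y hy => ?_⟩
    obtain ⟨h1, h2⟩ := TwistedSG.compare_cell hx hω.1 hy
    rw [dist_eq_norm] at h1 h2
    have h3 := TwistedSG.le_resistance_of_mem_uStar hc hK hx hy.1
    have h4 := TwistedSG.resistance_le_of_mem_uStar hK hx hy.1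
    constructor
    · rw [inv_mul_le_iff₀ (by positivity)]
      linarith
    · have h5 := mul_le_mul_of_nonneg_left h2 hK0.le
      have h6 : 0 ≤ K * ‖x - y‖ ^ (Real.log 3 / Real.log 2) := by positivity
      linarith
  · refine ⟨9 * K, by positivity, fun k hk q hq => ?_⟩
    obtain ⟨k, rfl⟩ := Nat.exists_eq_succ_of_ne_zero (by omega : k ≠ 0)
    obtain ⟨τ, rfl, rfl⟩ := TwistedSG.exists_eq_cellMap_mid hq
    refine ⟨τ ++ [1], τ ++ [2], by simp, TwistedSG.largestCells_cellMap_mid τ,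
      fun n _ x hx y hy => ?_⟩
    have hx' : x ∈ TwistedSG.UStar := Set.mem_iUnion.2 ⟨n, hx.1⟩
    have hy' : y ∈ TwistedSG.UStar := Set.mem_iUnion.2 ⟨n, hy.1⟩
    obtain ⟨h1, h2⟩ := TwistedSG.addr_sub_cells_mid ⟨hx', hx.2⟩ ⟨hy', hy.2⟩
    have h3 := TwistedSG.le_resistance_of_mem_uStar hc hK hx' hy'
    have h4 := TwistedSG.resistance_le_of_mem_uStar hK hx' hy'
    constructor
    · rw [inv_mul_le_iff₀ (by positivity)]
      exact h1.trans h3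
    · have h5 := mul_le_mul_of_nonneg_left h2 hK0.le
      have h6 : 0 ≤ K * (1 / 3 : ℝ) ^ (τ.length + 1) := by positivity
      rw [Nat.succ_eq_add_one]
      linarith
  · let _ := TwistedSG.resistanceMetric hc hK
    exact ⟨TwistedSG.resistanceMetric hc hK, fun x y => rfl,
      TwistedSG.completion_structure (δ := (4 * K)⁻¹) hK0
        (fun x y hx hy => TwistedSG.le_resistance_of_mem_uStar hc hK hx hy)
        (fun x y hx hy => TwistedSG.resistance_le_of_mem_uStar hK hx hy) (by positivity)
        fun x y hx hy hxy => TwistedSG.le_resistance_of_mem_wStar hc hK x.mem hy fun h =>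
          hxy (by cases x; cases y; congr)⟩
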